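/- For $p\in\{1,3\}$, a triple of integers $\bar\alpha=(\alpha_1,\alpha_2,\alpha_3)$ and an integer $t$, the variant $(p,\bar\alpha,t)$ of 3-LDT is the following decision problem. An instance of size $n$ consists of $p$ sets of exactly $n$ integers each, contained in $\{-n^3,\ldots,n^3\}$. If $p=1$, with set $X$, the question is whether there are distinct $x_1,x_2,x_3\in X$ with $\sum_{i=1}^3\alpha_ix_i=t$. If $p=3$, with sets $A_1,A_2,A_3$, the question is whether there are $x_1\in A_1$, $x_2\in A_2$, $x_3\in A_3$ with $\sum_{i=1}^3\alpha_ix_i=t$. The variant is called trivial if some $\alpha_i$ is zero, or if $t\neq 0$ and $\gcd(\alpha_1,\alpha_2,\alpha_3)\nmid t$; otherwise it is non-trivial. A subquadratic reduction from a problem $A$ to a problem $B$ is a deterministic word RAM algorithm $\mathcal A$ with words of $O(\log n)$ bits on inputs of size $n$ and with oracle access to $B$, such that $\mathcal A$ solves $A$ correctly on every instance and, for every $\varepsilon>0$, there is $\delta>0$ such that (i) $\mathcal A$ runs in $O(n^{2-\delta})$ time on instances of size $n$, and (ii) for all sufficiently large $n$ and every instance of $A$ of size $n$, if $m_i$ denotes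 the size of the $i$-th oracle call to $B$ made by $\mathcal A$ on this instance, then $\sum_i m_i^{2-\varepsilon}\le n^{2-\delta}$. Two problems are subquadratic-equivalent if there are subquadratic reductions from each of them to the other. **Theorem.** Any two non-trivial variants $(p,\bar\alpha,s)$ and $(q,\bar\beta,t)$ of 3-LDT, with $p,q\in\{1,3\}$ arbitrary (1-partite and 3-partite), are subquadratic-equivalent. -/

import Mathlib

open Filter

/-! ### Set problems and the variants of 3-LDT -/

/-- A decision problem about `arity` many finite sets of integers. Its instances of size `n` are
singled out by `SetProblem.IsInstance`; `yes` says which of them are YES-instances. -/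
structure SetProblem where
  arity : ℕ
  yes : (Fin arity → Finset ℤ) → Prop

/-- An instance of size `n`: every set has exactly `n` elements and lies in `{-n³, …, n³}`. -/
def SetProblem.IsInstance (A : SetProblem) (n : ℕ) (X : Fin A.arity → Finset ℤ) : Prop :=
  ∀ j, (X j).card = n ∧ X j ⊆ Finset.Icc (-(n : ℤ) ^ 3) ((n : ℤ) ^ 3)

/-- 1-partite 3-LDT: are there distinct `x₁, x₂, x₃ ∈ X` with `α₁ x₁ + α₂ x₂ + α₃ x₃ = t`? -/
def ldtOne (α : Fin 3 → ℤ) (t : ℤ) : SetProblem where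
  arity := 1
  yes X := ∃ x : Fin 3 → ℤ, Function.Injective x ∧ (∀ i, x i ∈ X 0) ∧ ∑ i, α i * x i = t

/-- 3-partite 3-LDT: are there `x₁ ∈ A₁, x₂ ∈ A₂, x₃ ∈ A₃` with `α₁ x₁ + α₂ x₂ + α₃ x₃ = t`? -/
def ldtThree (α : Fin 3 → ℤ) (t : ℤ) : SetProblem where
  arity := 3
  yes A := ∃ x : Fin 3 → ℤ, (∀ i, x i ∈ A i) ∧ ∑ i, α i * x i = t

/-- The two partities of 3-LDT. -/
inductive Partity where
  | one
  | three

/-- The variant `(p, α, t)` of 3-LDT. -/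
def ldt (p : Partity) (α : Fin 3 → ℤ) (t : ℤ) : SetProblem :=
  match p with
  | .one => ldtOne α t
  | .three => ldtThree α t

/-- The variant `(p, α, t)` is trivial if some coefficient is zero, or if `t ≠ 0` and
`gcd(α₁, α₂, α₃)` does not divide `t`. -/
def IsTrivialVariant (α : Fin 3 → ℤ) (t : ℤ) : Prop :=
  (∃ i, α i = 0) ∨ (t ≠ 0 ∧ ¬ Finset.univ.gcd α ∣ t)

/-! ### A word RAM with an oracle -/

namespace WordRAM

/-- Reduction of an integer to a signed machine word of `w` bits (two's complement), that is, to
the range `[-2 ^ (w - 1), 2 ^ (w - 1))`. -/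
def wrap (w : ℕ) (z : ℤ) : ℤ := Int.bmod z (2 ^ w)

/-- The unit-cost word operations. -/
inductive Op where
  | add | sub | mul | div | mod | lt | eq

/-- The integer function computed by a word operation, before reduction to a word. Division by
zero returns zero; comparisons return `1` or `0`. -/
def Op.apply : Op → ℤ → ℤ → ℤ
  | .add, x, y => x + y
  | .sub, x, y => x - y
  | .mul, x, y => x * y
  | .div, x, y => x / y
  | .mod, x, y => x % y
  | .lt, x, y => if x < y then 1 else 0
  | .eq, x, y => if x = y then 1 else 0

/-- The state of the machine: registers and randomly accessible arrays of words. A program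
mentions finitely many registers and arrays, by fixed numbers; only addresses inside an array are
computed. -/
structure State where
  reg : ℕ → ℤ
  mem : ℕ → ℤ → ℤ

/-- Expressions: constants, registers, array reads (array `a` at a computed address), and word
operations. -/
inductive Expr where
  | const (z : ℤ)
  | var (x : ℕ)
  | read (a : ℕ) (e : Expr)
  | bin (op : Op) (e₁ e₂ : Expr)

/-- The value of an expression on a machine with `w`-bit words; every intermediate result is
reduced to a word. -/
def Expr.eval (w : ℕ) (s : State) : Expr → ℤ
  | .const z => wrap w z
  | .var x => s.reg x
  | .read a e => s.mem a (e.eval w s)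
  | .bin op e₁ e₂ => wrap w (op.apply (e₁.eval w s) (e₂.eval w s))

/-- The time for evaluating an expression: the number of its nodes. -/
def Expr.cost : Expr → ℕ
  | .const _ => 1
  | .var _ => 1
  | .read _ e => e.cost + 1
  | .bin _ e₁ e₂ => e₁.cost + e₂.cost + 1

/-- Programs. `assign x e` sets register `x`; `write a e₁ e₂` stores the value of `e₂` in array `a`
at the address `e₁`; `query x e a` puts to the oracle the instance whose size is the value of `e`
and whose sets are listed at the beginnings of the consecutive arrays `a, a + 1, …`, and stores the
answer in register `x`. -/
inductive Prog where
  | skip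
  | assign (x : ℕ) (e : Expr)
  | write (a : ℕ) (e₁ e₂ : Expr)
  | seq (c₁ c₂ : Prog)
  | branch (e : Expr) (c₁ c₂ : Prog)
  | loop (e : Expr) (c : Prog)
  | query (x : ℕ) (e : Expr) (a : ℕ)

/-- The state after setting register `x` to `v`. -/
def State.setReg (s : State) (x : ℕ) (v : ℤ) : State :=
  { s with reg := Function.update s.reg x v }

/-- The state after setting cell `i` of array `a` to `v`. -/
def State.setMem (s : State) (a : ℕ) (i v : ℤ) : State :=
  { s with mem := Function.update s.mem a (Function.update (s.mem a) i v) }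

/-- The set of integers listed in the cells `0, …, n - 1` of array `a`. -/
def State.contents (s : State) (a n : ℕ) : Finset ℤ :=
  (Finset.range n).image fun i : ℕ => s.mem a (i : ℤ)

/-- `Exec B w c s s' τ L`: with an oracle for the problem `B` and with `w`-bit words, the program
`c`, started in the state `s`, halts in the state `s'` after `τ` time units, and `L` lists the sizes
of its successive oracle calls. Only instances of `B` may be put to the oracle: on anything else the
machine gets stuck. A call is charged the number of integers in the query, besides the time that
the program has spent on writing it. -/
inductive Exec (B : SetProblem) (w : ℕ) : Prog → State → State → ℕ → List ℕ → Prop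
  | skip (s : State) : Exec B w .skip s s 1 []
  | assign (x : ℕ) (e : Expr) (s : State) :
      Exec B w (.assign x e) s (s.setReg x (e.eval w s)) (e.cost + 1) []
  | write (a : ℕ) (e₁ e₂ : Expr) (s : State) :
      Exec B w (.write a e₁ e₂) s (s.setMem a (e₁.eval w s) (e₂.eval w s))
        (e₁.cost + e₂.cost + 1) []
  | seq {c₁ c₂ : Prog} {s₁ s₂ s₃ : State} {τ₁ τ₂ : ℕ} {L₁ L₂ : List ℕ} :
      Exec B w c₁ s₁ s₂ τ₁ L₁ → Exec B w c₂ s₂ s₃ τ₂ L₂ →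
      Exec B w (.seq c₁ c₂) s₁ s₃ (τ₁ + τ₂) (L₁ ++ L₂)
  | branch_true {e : Expr} {c₁ c₂ : Prog} {s s' : State} {τ : ℕ} {L : List ℕ} :
      e.eval w s ≠ 0 → Exec B w c₁ s s' τ L →
      Exec B w (.branch e c₁ c₂) s s' (e.cost + 1 + τ) L
  | branch_false {e : Expr} {c₁ c₂ : Prog} {s s' : State} {τ : ℕ} {L : List ℕ} :
      e.eval w s = 0 → Exec B w c₂ s s' τ L →
      Exec B w (.branch e c₁ c₂) s s' (e.cost + 1 + τ) L
  | loop_true {e : Expr} {c : Prog} {s₁ s₂ s₃ : State} {τ₁ τ₂ : ℕ} {L₁ L₂ : List ℕ} :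
      e.eval w s₁ ≠ 0 → Exec B w c s₁ s₂ τ₁ L₁ → Exec B w (.loop e c) s₂ s₃ τ₂ L₂ →
      Exec B w (.loop e c) s₁ s₃ (e.cost + 1 + τ₁ + τ₂) (L₁ ++ L₂)
  | loop_false {e : Expr} {c : Prog} {s : State} :
      e.eval w s = 0 → Exec B w (.loop e c) s s (e.cost + 1) []
  | query_yes {x : ℕ} {e : Expr} {a : ℕ} {s : State} {m : ℕ} :
      e.eval w s = (m : ℤ) →
      B.IsInstance m (fun j => s.contents (a + j) m) →
      B.yes (fun j => s.contents (a + j) m) →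
      Exec B w (.query x e a) s (s.setReg x 1) (e.cost + 1 + B.arity * m) [m]
  | query_no {x : ℕ} {e : Expr} {a : ℕ} {s : State} {m : ℕ} :
      e.eval w s = (m : ℤ) →
      B.IsInstance m (fun j => s.contents (a + j) m) →
      ¬ B.yes (fun j => s.contents (a + j) m) →
      Exec B w (.query x e a) s (s.setReg x 0) (e.cost + 1 + B.arity * m) [m]

/-- The word length `κ (⌊log₂ n⌋ + 1)` on inputs of size `n`. -/
def wordSize (κ n : ℕ) : ℕ := κ * (Nat.log 2 n + 1)

/-- `s` is an initial state for the instance `X` of size `n`: register `0` holds `n`, the first `n`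
cells of array `j` list the elements of the `j`-th set, in any order, and all else is zero. -/
def IsInitial (A : SetProblem) (n : ℕ) (X : Fin A.arity → Finset ℤ) (s : State) : Prop :=
  s.reg 0 = (n : ℤ) ∧ (∀ x, x ≠ 0 → s.reg x = 0) ∧
    (∀ j : Fin A.arity, s.contents j n = X j) ∧
    ∀ (a : ℕ) (i : ℤ), (A.arity ≤ a ∨ i < 0 ∨ (n : ℤ) ≤ i) → s.mem a i = 0

/-- With an oracle for `B` and words of length `wordSize κ n`, the program `c`, started on some
instance of `A` of size `n`, can halt in the state `s'` after `τ` time units, with oracle calls of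
the sizes `L`. -/
def IsRun (A B : SetProblem) (κ : ℕ) (c : Prog) (n : ℕ) (s' : State) (τ : ℕ) (L : List ℕ) : Prop :=
  ∃ X s, A.IsInstance n X ∧ IsInitial A n X s ∧ Exec B (wordSize κ n) c s s' τ L

/-- With an oracle for `B` and words of length `wordSize κ n`, the program `c` solves `A`: on every
instance it halts, and leaves the correct answer (`1` or `0`) in register `0`. -/
def Solves (A B : SetProblem) (κ : ℕ) (c : Prog) : Prop :=
  ∀ n X s, A.IsInstance n X → IsInitial A n X s →
    ∃ s' τ L, Exec B (wordSize κ n) c s s' τ L ∧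
      (A.yes X → s'.reg 0 = 1) ∧ (¬ A.yes X → s'.reg 0 = 0)

/-- Runs are deterministic, so the final state, the running time and the oracle calls are functions
of the initial state. -/
theorem Exec.deterministic {B : SetProblem} {w : ℕ} {c : Prog} {s s₁ s₂ : State} {τ₁ τ₂ : ℕ}
    {L₁ L₂ : List ℕ} (h₁ : Exec B w c s s₁ τ₁ L₁) (h₂ : Exec B w c s s₂ τ₂ L₂) :
    s₁ = s₂ ∧ τ₁ = τ₂ ∧ L₁ = L₂ := by
  induction h₁ generalizing s₂ τ₂ L₂ with
  | skip | assign | write => cases h₂; simp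
  | seq _ _ ih₁ ih₂ =>
    cases h₂ with
    | seq g₁ g₂ =>
      obtain ⟨rfl, rfl, rfl⟩ := ih₁ g₁
      obtain ⟨rfl, rfl, rfl⟩ := ih₂ g₂
      simp
  | branch_true h _ ih =>
    cases h₂ with
    | branch_true _ g => obtain ⟨rfl, rfl, rfl⟩ := ih g; simp
    | branch_false h' _ => exact absurd h' h
  | branch_false h _ ih =>
    cases h₂ with
    | branch_true h' _ => exact absurd h h'
    | branch_false _ g => obtain ⟨rfl, rfl, rfl⟩ := ih g; simp
  | loop_true h _ _ ih₁ ih₂ =>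
    cases h₂ with
    | loop_true _ g₁ g₂ =>
      obtain ⟨rfl, rfl, rfl⟩ := ih₁ g₁
      obtain ⟨rfl, rfl, rfl⟩ := ih₂ g₂
      simp
    | loop_false h' => exact absurd h' h
  | loop_false h =>
    cases h₂ with
    | loop_true h' _ _ => exact absurd h h'
    | loop_false _ => simp
  | query_yes hm _ hy =>
    cases h₂ with
    | query_yes hm' _ _ => obtain rfl := Int.ofNat_inj.1 (hm.symm.trans hm'); simp
    | query_no hm' _ hn => obtain rfl := Int.ofNat_inj.1 (hm.symm.trans hm'); exact absurd hy hn
  | query_no hm _ hn =>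
    cases h₂ with
    | query_yes hm' _ hy => obtain rfl := Int.ofNat_inj.1 (hm.symm.trans hm'); exact absurd hy hn
    | query_no hm' _ _ => obtain rfl := Int.ofNat_inj.1 (hm.symm.trans hm'); simp

end WordRAM

/-! ### Subquadratic reductions -/

/-- A (deterministic) subquadratic reduction from `A` to `B`: a word RAM program with an oracle for
`B` and with words of `O(log n)` bits that solves `A` and has the following property. For every
`ε > 0` there is `δ > 0` such that it runs in time `O(n ^ (2 - δ))` on instances of size `n` and, for
all sufficiently large `n`, its oracle calls on an instance of size `n` have sizes `m₁, m₂, …` with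
`∑ i, mᵢ ^ (2 - ε) ≤ n ^ (2 - δ)`. The condition `4 ≤ κ` lets every number of the input fit into a
word. -/
def SubquadraticReduction (A B : SetProblem) : Prop :=
  ∃ (c : WordRAM.Prog) (κ : ℕ), 4 ≤ κ ∧ WordRAM.Solves A B κ c ∧
    ∀ ε : ℝ, 0 < ε → ∃ δ : ℝ, 0 < δ ∧
      (∃ K : ℝ, ∀ᶠ n : ℕ in atTop, ∀ s' τ L, WordRAM.IsRun A B κ c n s' τ L →
        (τ : ℝ) ≤ K * (n : ℝ) ^ (2 - δ)) ∧
      (∀ᶠ n : ℕ in atTop, ∀ s' τ L, WordRAM.IsRun A B κ c n s' τ L →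
        (L.map fun m : ℕ => (m : ℝ) ^ (2 - ε)).sum ≤ (n : ℝ) ^ (2 - δ))

/-- Subquadratic equivalence of two problems. -/
def SubquadraticEquivalent (A B : SetProblem) : Prop :=
  SubquadraticReduction A B ∧ SubquadraticReduction B A

/-! An element `x` of the `k`-th set is sent to `W * w k + c k + γ k * x`. The constants `c` and
`γ`, found by Bézout, turn `∑ α i * x i = s` into `∑ β i * y i = t` (`Gadget.exists`). The scale `W`
exceeds every combination of the remaining terms, so a solution of the target equation also solves
the equation for the weights alone. The weights are a generic integer vector on the hyperplane `∑ β
i * w i = 0` (`exists_weights`). Hence only two kinds of solutions survive: the three values come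
from the three classes, permuted in a way that preserves `β`, and reindexing gives a solution of the
source equation; or `∑ β i = 0` and all three values come from a single class. The second kind is
spurious. A 3-partite target excludes it, as its arrays have no class in common; a 1-partite target
needs a further idea.

That idea is Behrend's construction. Write the shifted elements in base `b * p` with `b ≥ ∑ |β i|`
and `p` about `2 ^ √(log n)`. Among numbers whose digits have the same quotients by `p`, and whose
vectors of residues modulo `p` have the same norm, a translation-invariant equation involves no
carries, and strict convexity of the sphere leaves only trivial solutions
(`eq_of_topDigits_eq_of_normSq_eq`). This splits the input into `n ^ o(1)` solution-free pieces,
indexed by labels. One oracle call is made for each triple of labels, so no class of images contains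
a spurious solution.

A 1-partite source asks for distinct elements. The label therefore also records two digits at
variable positions. For suitable positions three distinct numbers get distinct labels
(`exists_twoDigits_injective`), and elements are selected only if the three prescribed labels are
distinct.

Each query must consist of sets of exactly `m = O(n)` integers in `{-m³, …, m³}`. Dummies with
weights of their own fill it up; they lie on a paraboloid, which again has only trivial solutions.
Altogether `n ^ o(1)` calls of size `O(n)` cost `n ^ (2 - ε + o(1))`.

The algorithm is an explicit program, verified with the total-correctness judgement `Ter`, which
also tracks time, oracle calls and the absence of overflow. -/

namespace WordRAM

/-! ### Program verification: exact arithmetic, time and oracle calls -/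

/-- The value of an expression on a machine with unbounded words. -/
def Expr.exact (s : State) : Expr → ℤ
  | .const z => z
  | .var x => s.reg x
  | .read a e => s.mem a (e.exact s)
  | .bin op e₁ e₂ => op.apply (e₁.exact s) (e₂.exact s)

/-- If all words of the state are at most `X ^ d` in absolute value, with `X ≥ 2`, then the exact
value of the expression and of all its subexpressions is at most `X ^ deg`. -/
def Expr.deg (d : ℕ) : Expr → ℕ
  | .const z => z.natAbs
  | .var _ => d
  | .read _ e => d + e.deg d
  | .bin _ e₁ e₂ => e₁.deg d + e₂.deg d + 1

/-- The sum over all expressions bounds the degree of each of them, so the single condition `c.deg d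
+ 2 ≤ κ` excludes overflow throughout the program as long as the state stays bounded. -/
def Prog.deg (d : ℕ) : Prog → ℕ
  | .skip => 0
  | .assign _ e => e.deg d
  | .write _ e₁ e₂ => e₁.deg d + e₂.deg d
  | .seq c₁ c₂ => c₁.deg d + c₂.deg d
  | .branch e c₁ c₂ => e.deg d + c₁.deg d + c₂.deg d
  | .loop e c => e.deg d + c.deg d
  | .query _ e _ => e.deg d

/-- The total size of a program, counting a query to a problem of the given arity as well. -/
def Prog.size (r : ℕ) : Prog → ℕ
  | .skip => 1
  | .assign _ e => e.cost + 1
  | .write _ e₁ e₂ => e₁.cost + e₂.cost + 1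
  | .seq c₁ c₂ => c₁.size r + c₂.size r
  | .branch e c₁ c₂ => e.cost + 1 + c₁.size r + c₂.size r
  | .loop e c => e.cost + 1 + c.size r
  | .query _ e _ => e.cost + 1 + r

def State.Bounded (Y : ℤ) (s : State) : Prop :=
  (∀ x, |s.reg x| ≤ Y) ∧ ∀ a i, |s.mem a i| ≤ Y

/-- A power of two above `n`, of the order of `n`. -/
def radix (n : ℕ) : ℤ := 2 ^ (Nat.log 2 n + 1)

theorem two_le_radix (n : ℕ) : 2 ≤ radix n := by
  unfold radix
  calc (2 : ℤ) = 2 ^ 1 := by norm_num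
    _ ≤ _ := pow_le_pow_right₀ (by norm_num) (by omega)

theorem radix_pow_mono (n : ℕ) {a b : ℕ} (h : a ≤ b) : radix n ^ a ≤ radix n ^ b :=
  pow_le_pow_right₀ (by linarith [two_le_radix n]) h

theorem one_le_radix_pow (n a : ℕ) : 1 ≤ radix n ^ a :=
  one_le_pow₀ (by linarith [two_le_radix n])

theorem succ_le_radix (n : ℕ) : (n : ℤ) + 1 ≤ radix n := by
  unfold radix
  have := Nat.lt_pow_succ_log_self (b := 2) (by norm_num) n
  exact_mod_cast this

theorem nat_le_radix_pow (n a : ℕ) : (a : ℤ) ≤ radix n ^ a := by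
  calc (a : ℤ) ≤ 2 ^ a := by exact_mod_cast Nat.lt_two_pow_self.le
    _ ≤ _ := pow_le_pow_left₀ (by norm_num) (two_le_radix n) a

/-- Since `2 ^ wordSize κ n = radix n ^ κ`, spare factors `radix n ≥ 2` leave room for the sign bit.
-/
theorem wrap_eq_self {κ n : ℕ} {z : ℤ} {a : ℕ} (hz : |z| ≤ radix n ^ a) (ha : a + 2 ≤ κ) :
    wrap (wordSize κ n) z = z := by
  have h1 : radix n ^ a * 2 < 2 ^ (wordSize κ n) := by
    have : (2 : ℤ) ^ (wordSize κ n) = radix n ^ κ := by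
      unfold wordSize radix
      rw [← pow_mul, mul_comm]
    rw [this]
    calc radix n ^ a * 2 ≤ radix n ^ a * radix n :=
          mul_le_mul_of_nonneg_left (two_le_radix n) (by linarith [one_le_radix_pow n a])
      _ = radix n ^ (a + 1) := by ring
      _ < radix n ^ κ := pow_lt_pow_right₀ (by linarith [two_le_radix n]) (by omega)
  have h2 := abs_le.1 hz
  unfold wrap
  apply Int.bmod_eq_of_le_mul_two
  · push_cast; linarith [h2.1]
  · push_cast; linarith [h2.2]

/-- One extra factor `X ≥ 2` absorbs sums as well as products, so degrees just add up along an
expression. -/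
theorem Op.abs_apply_le (op : Op) {x y X : ℤ} {a b : ℕ} (hX : 2 ≤ X) (hx : |x| ≤ X ^ a)
    (hy : |y| ≤ X ^ b) : |op.apply x y| ≤ X ^ (a + b + 1) := by
  have ha : 1 ≤ X ^ a := one_le_pow₀ (by linarith)
  have hb : 1 ≤ X ^ b := one_le_pow₀ (by linarith)
  have hab : X ^ a + X ^ b ≤ X ^ (a + b + 1) := by
    have h1 : X ^ a + X ^ b ≤ 2 * (X ^ a * X ^ b) := by nlinarith
    calc X ^ a + X ^ b ≤ 2 * (X ^ a * X ^ b) := h1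
      _ ≤ X * (X ^ a * X ^ b) := by gcongr
      _ = _ := by ring
  have hab' : X ^ a * X ^ b ≤ X ^ (a + b + 1) := by
    calc X ^ a * X ^ b = 1 * (X ^ a * X ^ b) := by ring
      _ ≤ X * (X ^ a * X ^ b) := by gcongr; linarith
      _ = _ := by ring
  cases op with
  | add => exact (abs_add_le x y).trans (by linarith)
  | sub => exact (abs_sub x y).trans (by linarith)
  | mul =>
    simp only [Op.apply, abs_mul]
    exact (mul_le_mul hx hy (abs_nonneg _) (by linarith)).trans hab'
  | div =>
    have : |x / y| ≤ |x| := by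
      have := Int.natAbs_ediv_le_natAbs x y
      rw [Int.abs_eq_natAbs, Int.abs_eq_natAbs]; exact_mod_cast this
    simp only [Op.apply]; linarith
  | mod =>
    have : |x % y| ≤ |x| + |y| := by
      rcases eq_or_ne y 0 with rfl | h
      · simp
      · have h1 := Int.emod_nonneg x h
        have h2 := Int.emod_lt_abs x h
        rw [abs_of_nonneg h1]; linarith [abs_nonneg x]
    simp only [Op.apply]; linarith
  | lt => simp only [Op.apply]; split_ifs <;> simp <;> linarith
  | eq => simp only [Op.apply]; split_ifs <;> simp <;> linarith

theorem Expr.abs_exact_le {n d : ℕ} {s : State} (hs : s.Bounded (radix n ^ d)) (e : Expr) :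
    |e.exact s| ≤ radix n ^ e.deg d := by
  induction e with
  | const z =>
    simp only [exact, deg, Int.abs_eq_natAbs]
    exact nat_le_radix_pow n _
  | var x => exact hs.1 x
  | read a e ih => exact (hs.2 a _).trans (radix_pow_mono n (Nat.le_add_right _ _))
  | bin op e₁ e₂ h₁ h₂ => exact Op.abs_apply_le op (two_le_radix n) h₁ h₂

theorem Expr.eval_eq_exact {κ n d : ℕ} {s : State} (hs : s.Bounded (radix n ^ d)) (e : Expr)
    (he : e.deg d + 2 ≤ κ) : e.eval (wordSize κ n) s = e.exact s := by
  induction e with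
  | const z => exact wrap_eq_self (Expr.abs_exact_le hs (.const z)) he
  | var x => rfl
  | read a e ih =>
    simp only [eval, exact]
    rw [ih (by simp only [deg] at he; omega)]
  | bin op e₁ e₂ h₁ h₂ =>
    simp only [eval]
    rw [h₁ (by simp only [deg] at he; omega), h₂ (by simp only [deg] at he; omega)]
    exact wrap_eq_self (Expr.abs_exact_le hs (.bin op e₁ e₂)) he

/-- The parameters of a run: the oracle, the word length constant, the input size, the exponent in
the bound for all words that occur, and the size of all oracle calls. -/
structure Setting where
  B : SetProblem
  κ : ℕ
  n : ℕ
  d : ℕ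
  m : ℕ

/-- Started in `s`, the program halts in a state satisfying `Q` within time `T` times its size,
having made at most `q` oracle calls, all of size `S.m`; provided that all words of `s` are
bounded, and then so are those of the final state. -/
def Ter (S : Setting) (c : Prog) (s : State) (T q : ℕ) (Q : State → Prop) : Prop :=
  s.Bounded (radix S.n ^ S.d) → c.deg S.d + 2 ≤ S.κ →
    ∃ s' τ L, Exec S.B (wordSize S.κ S.n) c s s' τ L ∧ τ ≤ c.size S.B.arity * T ∧
      L.length ≤ q ∧ (∀ l ∈ L, l = S.m) ∧ s'.Bounded (radix S.n ^ S.d) ∧ Q s'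

variable {S : Setting} {c c₁ c₂ : Prog} {s : State} {T T' q q' q₁ q₂ : ℕ} {Q Q' : State → Prop}

theorem Ter.mono (h : Ter S c s T q Q) (hT : T ≤ T') (hQ : ∀ s, Q s → Q' s) :
    Ter S c s T' q Q' := by
  intro hs hc
  obtain ⟨s', τ, L, h1, h2, h3, h4, h5, h6⟩ := h hs hc
  exact ⟨s', τ, L, h1, h2.trans (Nat.mul_le_mul_left _ hT), h3, h4, h5, hQ _ h6⟩

theorem Ter.skip (hT : 1 ≤ T) (hQ : Q s) : Ter S .skip s T 0 Q := fun hs _ =>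
  ⟨s, _, [], .skip s, by simpa [Prog.size] using hT, by simp, by simp, hs, hQ⟩

theorem Ter.assign {x : ℕ} {e : Expr} (hT : 1 ≤ T) (he : |e.exact s| ≤ radix S.n ^ S.d)
    (hQ : Q (s.setReg x (e.exact s))) : Ter S (.assign x e) s T 0 Q := by
  intro hs hc
  have h := Expr.eval_eq_exact hs e hc
  refine ⟨_, _, [], .assign x e s, Nat.le_mul_of_pos_right _ hT, by simp, by simp, ?_, ?_⟩
  · rw [h]
    refine ⟨fun y => ?_, hs.2⟩
    simp only [State.setReg, Function.update_apply]
    split_ifs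
    · exact he
    · exact hs.1 y
  · rw [h]; exact hQ

theorem Ter.write {a : ℕ} {e₁ e₂ : Expr} (hT : 1 ≤ T) (he : |e₂.exact s| ≤ radix S.n ^ S.d)
    (hQ : Q (s.setMem a (e₁.exact s) (e₂.exact s))) : Ter S (.write a e₁ e₂) s T 0 Q := by
  intro hs hc
  simp only [Prog.deg] at hc
  have h₁ := Expr.eval_eq_exact (κ := S.κ) hs e₁ (by omega)
  have h₂ := Expr.eval_eq_exact (κ := S.κ) hs e₂ (by omega)
  refine ⟨_, _, [], .write a e₁ e₂ s, Nat.le_mul_of_pos_right _ hT, by simp, by simp, ?_, ?_⟩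
  · rw [h₁, h₂]
    refine ⟨hs.1, fun b i => ?_⟩
    simp only [State.setMem, Function.update_apply]
    split_ifs
    · simp only [Function.update_apply]
      split_ifs
      · exact he
      · exact hs.2 _ _
    · exact hs.2 _ _
  · rw [h₁, h₂]; exact hQ

theorem Ter.seq (h : Ter S c₁ s T q₁ fun s' => Ter S c₂ s' T q₂ Q) :
    Ter S (.seq c₁ c₂) s T (q₁ + q₂) Q := by
  intro hs hc
  simp only [Prog.deg] at hc
  obtain ⟨s₁, τ₁, L₁, h1, h2, h3, h4, h5, h6⟩ := h hs (by omega)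
  obtain ⟨s₂, τ₂, L₂, g1, g2, g3, g4, g5, g6⟩ := h6 h5 (by omega)
  refine ⟨s₂, _, _, .seq h1 g1, ?_, ?_, ?_, g5, g6⟩
  · simp only [Prog.size, add_mul]; omega
  · simp only [List.length_append]; omega
  · intro l hl
    rcases List.mem_append.1 hl with hl | hl
    · exact h4 l hl
    · exact g4 l hl

theorem Ter.seq_of_zero (h : Ter S c₁ s T 0 fun s' => Ter S c₂ s' T q Q) :
    Ter S (.seq c₁ c₂) s T q Q := by
  simpa using Ter.seq h

theorem Ter.branch {e : Expr} (hT : 1 ≤ T) (h₁ : e.exact s ≠ 0 → Ter S c₁ s T q Q)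
    (h₂ : e.exact s = 0 → Ter S c₂ s T q Q) : Ter S (.branch e c₁ c₂) s T q Q := by
  intro hs hc
  simp only [Prog.deg] at hc
  have he := Expr.eval_eq_exact (κ := S.κ) hs e (by omega)
  have hle : e.cost + 1 ≤ (e.cost + 1) * T := Nat.le_mul_of_pos_right _ hT
  by_cases h : e.exact s = 0
  · obtain ⟨s', τ, L, g1, g2, g3⟩ := h₂ h hs (by omega)
    refine ⟨s', _, L, .branch_false (he.trans h) g1, ?_, g3⟩
    simp only [Prog.size]
    rw [add_mul, add_mul]
    have := Nat.zero_le (c₁.size S.B.arity * T)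
    omega
  · obtain ⟨s', τ, L, g1, g2, g3⟩ := h₁ h hs (by omega)
    refine ⟨s', _, L, .branch_true (he ▸ h) g1, ?_, g3⟩
    simp only [Prog.size]
    rw [add_mul, add_mul]
    have := Nat.zero_le (c₂.size S.B.arity * T)
    omega

/-- Invariant rule with a known number of iterations. The budget has the factor `cnt + 1` because
the final, failing test must be paid for too. -/
theorem Ter.loop {e : Expr} (I : ℕ → State → Prop) (cnt : ℕ) (hT : 1 ≤ T) (h₀ : I 0 s)
    (hstep : ∀ i < cnt, ∀ s, I i s → e.exact s ≠ 0 ∧ Ter S c s T q (I (i + 1)))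
    (hend : ∀ s, I cnt s → e.exact s = 0) :
    Ter S (.loop e c) s ((cnt + 1) * T) (cnt * q) (I cnt) := by
  intro hs hc
  simp only [Prog.deg] at hc
  -- Induction on the number `r` of iterations still to come.
  have key : ∀ r i s, i + r = cnt → I i s → s.Bounded (radix S.n ^ S.d) →
      ∃ s' τ L, Exec S.B (wordSize S.κ S.n) (.loop e c) s s' τ L ∧
        τ ≤ r * (c.size S.B.arity * T + (e.cost + 1)) + (e.cost + 1) ∧
        L.length ≤ r * q ∧ (∀ l ∈ L, l = S.m) ∧ s'.Bounded (radix S.n ^ S.d) ∧ I cnt s' := by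
    intro r
    induction r with
    | zero =>
      intro i s hi hI hs
      obtain rfl : i = cnt := by omega
      have he := Expr.eval_eq_exact (κ := S.κ) hs e (by omega)
      exact ⟨s, _, [], .loop_false (he.trans (hend s hI)), by omega, by simp, by simp, hs, hI⟩
    | succ r ih =>
      intro i s hi hI hs
      have he := Expr.eval_eq_exact (κ := S.κ) hs e (by omega)
      obtain ⟨hne, hb⟩ := hstep i (by omega) s hI
      obtain ⟨s₁, τ₁, L₁, h1, h2, h3, h4, h5, h6⟩ := hb hs (by omega)
      obtain ⟨s₂, τ₂, L₂, g1, g2, g3, g4, g5, g6⟩ := ih (i + 1) s₁ (by omega) h6 h5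
      refine ⟨s₂, _, _, .loop_true (he ▸ hne) h1 g1, ?_, ?_, ?_, g5, g6⟩
      · rw [add_mul r 1]; omega
      · simp only [List.length_append, add_mul]; omega
      · intro l hl
        rcases List.mem_append.1 hl with hl | hl
        · exact h4 l hl
        · exact g4 l hl
  obtain ⟨s', τ, L, h1, h2, h3⟩ := key cnt 0 s (by omega) h₀ hs
  refine ⟨s', τ, L, h1, h2.trans ?_, h3⟩
  simp only [Prog.size]
  have hle : e.cost + 1 ≤ (e.cost + 1) * T := Nat.le_mul_of_pos_right _ hT
  calc cnt * (c.size S.B.arity * T + (e.cost + 1)) + (e.cost + 1)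
      ≤ cnt * (c.size S.B.arity * T + (e.cost + 1) * T) + (e.cost + 1) * T := by gcongr
    _ ≤ cnt * (c.size S.B.arity * T + (e.cost + 1) * T) +
          ((e.cost + 1) * T + c.size S.B.arity * T) := by omega
    _ = _ := by ring

theorem Ter.query {x : ℕ} {e : Expr} {a : ℕ} (hT : S.m + 1 ≤ T) (he : e.exact s = S.m)
    (hI : S.B.IsInstance S.m fun j => s.contents (a + j) S.m)
    (hy : S.B.yes (fun j => s.contents (a + j) S.m) → Q (s.setReg x 1))
    (hn : ¬ S.B.yes (fun j => s.contents (a + j) S.m) → Q (s.setReg x 0)) :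
    Ter S (.query x e a) s T 1 Q := by
  intro hs hc
  have h : e.eval (wordSize S.κ S.n) s = S.m := (Expr.eval_eq_exact hs e hc).trans he
  have hcost : e.cost + 1 + S.B.arity * S.m ≤ (Prog.query x e a).size S.B.arity * T := by
    simp only [Prog.size]
    calc e.cost + 1 + S.B.arity * S.m ≤ (e.cost + 1) * (S.m + 1) + S.B.arity * (S.m + 1) := by
          nlinarith
      _ = (e.cost + 1 + S.B.arity) * (S.m + 1) := by ring
      _ ≤ _ := Nat.mul_le_mul_left _ hT
  have hb : ∀ v : ℤ, |v| ≤ 1 → (s.setReg x v).Bounded (radix S.n ^ S.d) := fun v hv => by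
    refine ⟨fun y => ?_, hs.2⟩
    simp only [State.setReg, Function.update_apply]
    split_ifs
    · exact hv.trans (one_le_radix_pow _ _)
    · exact hs.1 y
  by_cases hyes : S.B.yes fun j => s.contents (a + j) S.m
  · exact ⟨_, _, _, .query_yes h hI hyes, hcost, by simp, by simp, hb 1 (by simp), hy hyes⟩
  · exact ⟨_, _, _, .query_no h hI hyes, hcost, by simp, by simp, hb 0 (by simp), hn hyes⟩

end WordRAM

/-! ### Solution-free sets -/

/-- A weighted variance identity, expressing the strict convexity of squaring: for nonzero
coefficients the right side vanishes only if `a 0 = a 1`. -/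
theorem mul_sum_sq_eq {β a : Fin 3 → ℤ} (hβ : ∑ i, β i = 0) (ha : ∑ i, β i * a i = 0) :
    β 2 * ∑ i, β i * a i ^ 2 = -(β 0 * β 1 * (a 0 - a 1) ^ 2) := by
  rw [Fin.sum_univ_three] at *
  have h2 : β 2 = -β 0 - β 1 := by linarith
  rw [h2] at ha ⊢
  linear_combination (-β 0 * (a 0 + a 2) - β 1 * (a 1 + a 2)) * ha

/-- A sphere contains no nontrivial solutions to a translation-invariant equation. -/
theorem eq_of_sum_sq_eq {β : Fin 3 → ℤ} (hβ : ∀ i, β i ≠ 0) (hsum : ∑ i, β i = 0) {K : ℕ}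
    {r : Fin 3 → ℕ → ℤ} (h : ∀ t < K, ∑ i, β i * r i t = 0)
    (hsq : ∑ i, β i * ∑ t ∈ Finset.range K, r i t ^ 2 = 0) : ∀ t < K, r 0 t = r 1 t := by
  have h1 : ∑ t ∈ Finset.range K, (r 0 t - r 1 t) ^ 2 = 0 := by
    have h2 : β 0 * β 1 * ∑ t ∈ Finset.range K, (r 0 t - r 1 t) ^ 2 = 0 := by
      have : ∑ t ∈ Finset.range K, β 2 * ∑ i, β i * r i t ^ 2 =
          ∑ t ∈ Finset.range K, -(β 0 * β 1 * (r 0 t - r 1 t) ^ 2) :=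
        Finset.sum_congr rfl fun t ht =>
          mul_sum_sq_eq (a := fun i => r i t) hsum (h t (Finset.mem_range.1 ht))
      rw [← Finset.mul_sum, Finset.sum_comm] at this
      simp_rw [← Finset.mul_sum] at this
      rw [hsq, Finset.sum_neg_distrib, ← Finset.mul_sum] at this
      linarith
    rcases mul_eq_zero.1 h2 with h3 | h3
    · rcases mul_eq_zero.1 h3 with h4 | h4
      · exact absurd h4 (hβ 0)
      · exact absurd h4 (hβ 1)
    · exact h3
  intro t ht
  have := (Finset.sum_eq_zero_iff_of_nonneg fun t _ => sq_nonneg (r 0 t - r 1 t)).1 h1 t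
    (Finset.mem_range.2 ht)
  have := pow_eq_zero_iff (two_ne_zero) |>.1 this
  linarith

theorem abs_sum_mul_le {β z : Fin 3 → ℤ} {b S : ℤ} (hb : ∑ i, |β i| ≤ b) (hS : 0 ≤ S)
    (hz : ∀ i, |z i| ≤ S) : |∑ i, β i * z i| ≤ b * S := by
  calc |∑ i, β i * z i| ≤ ∑ i, |β i * z i| := Finset.abs_sum_le_sum_abs _ _
    _ ≤ ∑ i, |β i| * S := Finset.sum_le_sum fun i _ => by
        rw [abs_mul]; exact mul_le_mul_of_nonneg_left (hz i) (abs_nonneg _)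
    _ = (∑ i, |β i|) * S := by rw [Finset.sum_mul]
    _ ≤ b * S := mul_le_mul_of_nonneg_right hb hS

/-- The separation of scales used throughout: a multiple of `D` below `D` in absolute value is zero,
so low and high parts vanish separately and nothing is carried. -/
theorem eq_zero_of_add_mul_eq_zero {D u v : ℤ} (h : u + D * v = 0) (hu : |u| < D) :
    u = 0 ∧ v = 0 := by
  have hv : v = 0 := by
    by_contra hv
    have h1 : 1 ≤ |v| := Int.one_le_abs hv
    have h2 : |u| = |D| * |v| := by rw [← abs_mul, ← abs_neg (D * v)]; congr 1; linarith
    nlinarith [le_abs_self D, abs_nonneg D]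
  subst hv
  exact ⟨by linarith, rfl⟩

/-! ### Digits and Behrend's solution-free sets -/

/-- The `t`-th digit of `x` in base `D`. -/
def digit (D x : ℤ) (t : ℕ) : ℤ := x / D ^ t % D

theorem digit_nonneg {D : ℤ} (hD : 0 < D) (x : ℤ) (t : ℕ) : 0 ≤ digit D x t :=
  Int.emod_nonneg _ hD.ne'

theorem digit_lt {D : ℤ} (hD : 0 < D) (x : ℤ) (t : ℕ) : digit D x t < D :=
  Int.emod_lt_of_pos _ hD

theorem div_pow_succ {D : ℤ} (hD : 0 < D) (x : ℤ) (t : ℕ) : x / D ^ (t + 1) = x / D ^ t / D := by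
  rw [pow_succ, ← Int.ediv_ediv_of_nonneg (by positivity)]

theorem div_pow_eq {D : ℤ} (hD : 0 < D) (x : ℤ) (t : ℕ) :
    x / D ^ t = digit D x t + D * (x / D ^ (t + 1)) := by
  rw [div_pow_succ hD, digit]
  exact (Int.emod_add_mul_ediv _ _).symm

theorem eq_of_digit_eq {D : ℤ} (hD : 0 < D) {K : ℕ} {x y : ℤ} (hx : 0 ≤ x) (hxK : x < D ^ K)
    (hy : 0 ≤ y) (hyK : y < D ^ K) (h : ∀ t < K, digit D x t = digit D y t) : x = y := by
  have key : ∀ r t, t + r = K → x / D ^ t = y / D ^ t := by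
    intro r
    induction r with
    | zero =>
      rintro t rfl
      rw [add_zero] at hxK hyK
      rw [Int.ediv_eq_zero_of_lt hx hxK, Int.ediv_eq_zero_of_lt hy hyK]
    | succ r ih =>
      intro t ht
      rw [div_pow_eq hD, div_pow_eq hD y, h t (by omega), ih (t + 1) (by omega)]
  simpa using key K 0 (by omega)

/-- The number formed in base `b` by the quotients of the first digits by `p`. -/
def topDigits (b p x : ℤ) : ℕ → ℤ
  | 0 => 0
  | t + 1 => topDigits b p x t * b + digit (b * p) x t / p

theorem digit_div_nonneg {b p : ℤ} (hb : 0 < b) (hp : 0 < p) (x : ℤ) (t : ℕ) :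
    0 ≤ digit (b * p) x t / p := Int.ediv_nonneg (digit_nonneg (by positivity) _ _) hp.le

theorem digit_div_lt {b p : ℤ} (hb : 0 < b) (hp : 0 < p) (x : ℤ) (t : ℕ) :
    digit (b * p) x t / p < b :=
  Int.ediv_lt_of_lt_mul hp (digit_lt (by positivity) _ _)

theorem topDigits_nonneg {b p : ℤ} (hb : 0 < b) (hp : 0 < p) (x : ℤ) (t : ℕ) :
    0 ≤ topDigits b p x t := by
  induction t with
  | zero => exact le_rfl
  | succ t ih => have := digit_div_nonneg hb hp x t; simp only [topDigits]; positivity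

theorem topDigits_lt {b p : ℤ} (hb : 0 < b) (hp : 0 < p) (x : ℤ) (t : ℕ) :
    topDigits b p x t < b ^ t := by
  induction t with
  | zero => simp [topDigits]
  | succ t ih =>
    have := digit_div_lt hb hp x t
    simp only [topDigits, pow_succ]
    nlinarith

theorem digit_div_eq_of_topDigits_eq {b p : ℤ} (hb : 0 < b) (hp : 0 < p) {x y : ℤ} {K : ℕ}
    (h : topDigits b p x K = topDigits b p y K) :
    ∀ t < K, digit (b * p) x t / p = digit (b * p) y t / p := by
  induction K with
  | zero => intro t ht; omega
  | succ K ih =>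
    simp only [topDigits] at h
    have h1 := digit_div_nonneg hb hp x K
    have h2 := digit_div_lt hb hp x K
    have h3 := digit_div_nonneg hb hp y K
    have h4 := digit_div_lt hb hp y K
    obtain ⟨h5, h6⟩ := eq_zero_of_add_mul_eq_zero (D := b)
      (u := digit (b * p) x K / p - digit (b * p) y K / p)
      (v := topDigits b p x K - topDigits b p y K) (by linear_combination h)
      (by rw [abs_lt]; constructor <;> linarith)
    intro t ht
    rcases Nat.lt_succ_iff_lt_or_eq.1 ht with ht | rfl
    · exact ih (by linarith) t ht
    · linarith

/-- The sum of the squares of the residues modulo `p` of the first `K` digits. -/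
def normSq (b p x : ℤ) (K : ℕ) : ℤ := ∑ t ∈ Finset.range K, (digit (b * p) x t % p) ^ 2

/-- Behrend's construction. -/
theorem eq_of_topDigits_eq_of_normSq_eq {β : Fin 3 → ℤ} {b p : ℤ} {K : ℕ} (hβ : ∀ i, β i ≠ 0)
    (hsum : ∑ i, β i = 0) (hb : ∑ i, |β i| ≤ b) (hb0 : 0 < b) (hp : 0 < p) {x : Fin 3 → ℤ}
    (hx0 : ∀ i, 0 ≤ x i) (hxK : ∀ i, x i < (b * p) ^ K) (hx : ∑ i, β i * x i = 0)
    (hq : ∀ i, topDigits b p (x i) K = topDigits b p (x 0) K)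
    (hρ : ∀ i, normSq b p (x i) K = normSq b p (x 0) K) : x 0 = x 1 := by
  have hD : 0 < b * p := by positivity
  have hq' := fun i => digit_div_eq_of_topDigits_eq hb0 hp (hq i)
  -- The common quotients cancel because `∑ i, β i = 0`. The residues are at most `p - 1`, so their
  -- combination stays below `b * p` in absolute value and does not carry into the next digit.
  have step : ∀ t < K, ∑ i, β i * (x i / (b * p) ^ t) = 0 →
      ∑ i, β i * (digit (b * p) (x i) t % p) = 0 ∧ ∑ i, β i * (x i / (b * p) ^ (t + 1)) = 0 := by
    intro t ht h
    apply eq_zero_of_add_mul_eq_zero (D := b * p)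
    · have : ∀ i, x i / (b * p) ^ t = digit (b * p) (x i) t % p +
          b * p * (x i / (b * p) ^ (t + 1)) + p * (digit (b * p) (x 0) t / p) := by
        intro i
        rw [div_pow_eq hD (x i) t, ← hq' i t ht]
        have := Int.emod_add_mul_ediv (digit (b * p) (x i) t) p
        linarith
      simp_rw [this, mul_add] at h
      rw [Finset.sum_add_distrib, Finset.sum_add_distrib, ← Finset.sum_mul, hsum, zero_mul,
        add_zero] at h
      rw [← h, Finset.mul_sum]
      congr 1
      exact Finset.sum_congr rfl fun i _ => by ring
    · have := abs_sum_mul_le (z := fun i => digit (b * p) (x i) t % p) hb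
        (show 0 ≤ p - 1 by linarith) fun i => by
          rw [abs_of_nonneg (Int.emod_nonneg _ hp.ne')]
          linarith [Int.emod_lt_of_pos (digit (b * p) (x i) t) hp]
      nlinarith
  have hdiv : ∀ t ≤ K, ∑ i, β i * (x i / (b * p) ^ t) = 0 := by
    intro t
    induction t with
    | zero => simpa using hx
    | succ t ih => exact fun ht => (step t ht (ih (by omega))).2
  have hr := eq_of_sum_sq_eq hβ hsum (K := K) (r := fun i t => digit (b * p) (x i) t % p)
    (fun t ht => (step t ht (hdiv t ht.le)).1) (by
      have : ∀ i, ∑ t ∈ Finset.range K, (digit (b * p) (x i) t % p) ^ 2 = normSq b p (x 0) K := hρ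
      simp_rw [this, ← Finset.sum_mul, hsum, zero_mul])
  refine eq_of_digit_eq hD (hx0 0) (hxK 0) (hx0 1) (hxK 1) fun t ht => ?_
  have h1 := Int.emod_add_mul_ediv (digit (b * p) (x 0) t) p
  have h2 := Int.emod_add_mul_ediv (digit (b * p) (x 1) t) p
  rw [hq' 1 t ht, ← hr t ht] at h2
  linarith

/-! ### Dummies: a solution-free set of integers given by a formula -/

/-- The points of a paraboloid over an `R × R` grid, as integers in base `b * R`. -/
def paraboloid (b R j : ℤ) : ℤ :=
  j % R + b * R * (j / R) + b * R * (b * R) * (j % R * (j % R) + j / R * (j / R))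

theorem grid_bounds {R j : ℤ} (hR : 0 < R) (h0 : 0 ≤ j) (h1 : j < R * R) :
    0 ≤ j % R ∧ j % R < R ∧ 0 ≤ j / R ∧ j / R < R :=
  ⟨Int.emod_nonneg _ hR.ne', Int.emod_lt_of_pos _ hR, Int.ediv_nonneg h0 hR.le,
    Int.ediv_lt_of_lt_mul hR h1⟩

/-- A parabola over `m = R * R` integers would need values of order `m ^ 3`, leaving no room for
scaling in `{-m³, …, m³}`. Folding the argument into a two-dimensional grid brings the order down to
`m ^ 2`. -/
theorem abs_paraboloid_le {b R j : ℤ} (hb : 1 ≤ b) (hR : 0 < R) (h0 : 0 ≤ j) (h1 : j < R * R) :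
    |paraboloid b R j| ≤ 4 * b ^ 2 * (R * R) ^ 2 := by
  obtain ⟨ha, ha', hc, hc'⟩ := grid_bounds hR h0 h1
  unfold paraboloid
  generalize j % R = u at *
  generalize j / R = v at *
  have e1 : u ≤ R * R * (R * R) * (b * b) := by
    have : 1 ≤ R * (R * R) * (b * b) := by
      have : 0 < R * (R * R) * (b * b) := by positivity
      linarith
    nlinarith
  have e2 : b * R * v ≤ R * R * (R * R) * (b * b) := by
    have : b * R * v ≤ b * R * R := by gcongr
    have : 1 ≤ R * R * b := by
      have : 0 < R * R * b := by positivity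
      linarith
    have : 0 ≤ b * R * R := by positivity
    nlinarith
  have e3 : u * u ≤ R * R := by nlinarith
  have e4 : v * v ≤ R * R := by nlinarith
  have e5 : b * R * (b * R) * (u * u + v * v) ≤ b * R * (b * R) * (R * R + R * R) := by
    gcongr
  rw [abs_of_nonneg (by positivity)]
  nlinarith

/-- A paraboloid contains no nontrivial solutions to a translation-invariant equation. -/
theorem eq_of_sum_paraboloid_eq_zero {β : Fin 3 → ℤ} {b R : ℤ} (hβ : ∀ i, β i ≠ 0)
    (hsum : ∑ i, β i = 0) (hb : ∑ i, |β i| ≤ b) (hb0 : 0 < b) (hR : 0 < R) {j : Fin 3 → ℤ}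
    (h0 : ∀ i, 0 ≤ j i) (h1 : ∀ i, j i < R * R) (h : ∑ i, β i * paraboloid b R (j i) = 0) :
    j 0 = j 1 := by
  have hg := fun i => grid_bounds hR (h0 i) (h1 i)
  have hlt : ∀ z : Fin 3 → ℤ, (∀ i, 0 ≤ z i) → (∀ i, z i < R) → |∑ i, β i * z i| < b * R := by
    intro z hz hz'
    have := abs_sum_mul_le (z := z) hb (show 0 ≤ R - 1 by linarith) fun i => by
      rw [abs_of_nonneg (hz i)]; linarith [hz' i]
    nlinarith
  obtain ⟨hu, h2⟩ := eq_zero_of_add_mul_eq_zero (D := b * R) (u := ∑ i, β i * (j i % R))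
    (v := ∑ i, β i * (j i / R) +
      b * R * ∑ i, β i * (j i % R * (j i % R) + j i / R * (j i / R))) (by
      rw [← h]
      simp only [paraboloid, Fin.sum_univ_three]
      ring) (hlt _ (fun i => (hg i).1) fun i => (hg i).2.1)
  obtain ⟨hv, h3⟩ := eq_zero_of_add_mul_eq_zero h2
    (hlt _ (fun i => (hg i).2.2.1) fun i => (hg i).2.2.2)
  -- The equations for the two coordinates and for the squared norm, now separated, are the
  -- hypotheses of the sphere lemma in dimension two.
  have := eq_of_sum_sq_eq hβ hsum (K := 2) (r := fun i t => if t = 0 then j i % R else j i / R)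
    (fun t ht => by interval_cases t <;> simpa) (by
      rw [← h3]
      exact Finset.sum_congr rfl fun i _ => by simp [Finset.sum_range_succ, sq])
  have e0 := this 0 (by norm_num)
  have e1 := this 1 (by norm_num)
  simp only [↓reduceIte, one_ne_zero] at e0 e1
  rw [← Int.emod_add_mul_ediv (j 0) R, ← Int.emod_add_mul_ediv (j 1) R, e0, e1]

/-! ### Separating the classes -/

/-- A rational vector space is not a finite union of proper subspaces, so some vector of `ker φ`
avoids the kernels of all `f ∈ F`. Clearing denominators makes it integral. -/
theorem exists_int_vector {ι : Type*} [Fintype ι] (φ : (ι → ℚ) →ₗ[ℚ] ℚ)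
    (F : Finset ((ι → ℚ) →ₗ[ℚ] ℚ)) (hF : ∀ f ∈ F, ∃ v, φ v = 0 ∧ f v ≠ 0) :
    ∃ w : ι → ℤ, φ (fun i => w i) = 0 ∧ ∀ f ∈ F, f (fun i => w i) ≠ 0 := by
  classical
  have h1 := Subspace.biUnion_ne_univ_of_top_notMem
    (s := F.image fun f => LinearMap.ker (f.domRestrict (LinearMap.ker φ))) (by
      intro h
      obtain ⟨f, hf, hft⟩ := Finset.mem_image.1 h
      obtain ⟨v, hv, hfv⟩ := hF f hf
      have : (⟨v, hv⟩ : LinearMap.ker φ) ∈ LinearMap.ker (f.domRestrict (LinearMap.ker φ)) := by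
        rw [hft]; trivial
      exact hfv this)
  obtain ⟨v, hv⟩ := (Set.ne_univ_iff_exists_notMem _).1 h1
  have hv' : ∀ f ∈ F, f v ≠ 0 := by
    intro f hf h0
    refine hv (Set.mem_biUnion (Finset.mem_coe.2 (Finset.mem_image_of_mem _ hf)) ?_)
    exact h0
  obtain ⟨D, hD⟩ := IsLocalization.exist_integer_multiples_of_finset (nonZeroDivisors ℤ)
    (Finset.univ.image (v : ι → ℚ))
  have hw : ∀ i, ∃ z : ℤ, (z : ℚ) = (D : ℤ) * (v : ι → ℚ) i := by
    intro i
    obtain ⟨z, hz⟩ := hD ((v : ι → ℚ) i) (Finset.mem_image_of_mem _ (Finset.mem_univ i))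
    exact ⟨z, by simpa [Algebra.smul_def] using hz⟩
  choose w hw using hw
  have hD0 : ((D : ℤ) : ℚ) ≠ 0 := by exact_mod_cast nonZeroDivisors.coe_ne_zero D
  have hwv : (fun i => (w i : ℚ)) = ((D : ℤ) : ℚ) • (v : ι → ℚ) := by
    funext i; simp [hw]
  refine ⟨w, ?_, fun f hf => ?_⟩
  · rw [hwv, map_smul, (show φ v = 0 from v.2), smul_zero]
  · rw [hwv, map_smul]
    exact smul_ne_zero hD0 (hv' f hf)

/-- The linear form that applies the coefficients `β` to the coordinates listed by `j`. -/
def combination (β : Fin 3 → ℤ) {ι : Type*} (j : Fin 3 → ι) : (ι → ℚ) →ₗ[ℚ] ℚ :=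
  ∑ i, (β i : ℚ) • LinearMap.proj (j i)

theorem combination_apply (β : Fin 3 → ℤ) {ι : Type*} (j : Fin 3 → ι) (v : ι → ℚ) :
    combination β j v = ∑ i, (β i : ℚ) * v (j i) := by
  simp [combination]

/-- A nonzero entry at `inl k` must be compensated at another `inl l`, and of the two candidates one
differs from `b`. The coordinates `inr k` are unconstrained. -/
theorem exists_separating {β : Fin 3 → ℤ} (hβ : ∀ i, β i ≠ 0) {a b : Fin 3 ⊕ Fin 3} (hab : a ≠ b) :
    ∃ v, combination β Sum.inl v = 0 ∧ v a ≠ 0 ∧ v b = 0 := by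
  classical
  rcases a with k | k
  · obtain ⟨l, hlk, hlb⟩ : ∃ l, l ≠ k ∧ Sum.inl l ≠ b := by
      rcases b with m | m
      · revert hab; revert k m; simp; decide
      · revert k; simp; decide
    refine ⟨fun x => if x = Sum.inl k then β l else if x = Sum.inl l then -β k else 0, ?_, ?_, ?_⟩
    · rw [combination_apply]
      simp only [Sum.inl.injEq]
      revert hlk
      fin_cases k <;> fin_cases l <;> (simp [Fin.sum_univ_three, mul_comm]; try ring)
    · simpa using hβ l
    · simp [hab.symm, hlb.symm]
  · refine ⟨fun x => if x = Sum.inr k then 1 else 0, ?_, ?_, ?_⟩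
    · simp [combination_apply]
    · simp
    · simp [hab.symm]

theorem sum_eq_of_pair (β : Fin 3 → ℤ) {ι : Type*} (j : Fin 3 → ι) {a b c : Fin 3} (hab : a ≠ b)
    (hac : a ≠ c) (hbc : b ≠ c) (v : ι → ℚ) :
    ∑ i, (β i : ℚ) * v (j i) = β a * v (j a) + β b * v (j b) + β c * v (j c) := by
  rw [Fin.sum_univ_three]
  fin_cases a <;> fin_cases b <;> fin_cases c <;> simp_all <;> ring

/-- The ratio of two proportional vectors with the same product of entries has cube one, and cubing
is injective on the integers. -/
theorem eq_of_forall_mul_eq {β β' : Fin 3 → ℤ} (hβ : ∀ i, β i ≠ 0) (hprod : ∏ i, β' i = ∏ i, β i)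
    (h : ∀ a b, β' a * β b = β' b * β a) : β' = β := by
  have h3 : ∀ a, β' a ^ 3 = β a ^ 3 := by
    intro a
    have hp : ∏ i, β i ≠ 0 := Finset.prod_ne_zero_iff.2 fun i _ => hβ i
    apply mul_right_cancel₀ hp
    calc β' a ^ 3 * ∏ i, β i = ∏ i, (β' a * β i) := by
          simp [Finset.prod_mul_distrib]
      _ = ∏ i, (β' i * β a) := Finset.prod_congr rfl fun i _ => h a i
      _ = β a ^ 3 * ∏ i, β i := by
          rw [Finset.prod_mul_distrib, hprod]; simp [mul_comm]
  funext a
  exact (Odd.strictMono_pow (by decide : Odd 3)).injective (h3 a)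

/-- If exactly two of the classes coincided, a vector separating them from the third would isolate a
nonzero coefficient; so `j` is constant or injective. An injective `j` avoids the unconstrained
coordinates, hence is a permutation, and the permuted coefficients are proportional to `β`. -/
theorem classes_of_combination_eq_zero {β : Fin 3 → ℤ} (hβ : ∀ i, β i ≠ 0)
    {j : Fin 3 → Fin 3 ⊕ Fin 3}
    (h : ∀ v, combination β Sum.inl v = 0 → combination β j v = 0) :
    (∑ i, β i = 0 ∧ ∀ i, j i = j 0) ∨
      ∃ σ : Equiv.Perm (Fin 3), (∀ i, j i = Sum.inl (σ i)) ∧ ∀ i, β (σ i) = β i := by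
  classical
  by_cases hc : ∀ i, j i = j 0
  · left
    refine ⟨?_, hc⟩
    -- The class `b` is arbitrary; only the nonvanishing of `v` at `j 0` is used.
    obtain ⟨b, hb⟩ : ∃ b, j 0 ≠ b := ⟨(j 0).swap, by cases j 0 <;> simp⟩
    obtain ⟨v, hv, hv1, -⟩ := exists_separating hβ hb
    have := h v hv
    rw [combination_apply] at this
    simp_rw [hc, ← Finset.sum_mul] at this
    have := (mul_eq_zero.1 this).resolve_right hv1
    exact_mod_cast this
  right
  have hinj : Function.Injective j := by
    intro a b hab
    by_contra hne
    obtain ⟨c, hac, hbc⟩ : ∃ c, a ≠ c ∧ b ≠ c :=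
      (by decide : ∀ a b : Fin 3, a ≠ b → ∃ c, a ≠ c ∧ b ≠ c) a b hne
    have hjc : j c ≠ j a := by
      intro hjc
      apply hc
      have : ∀ i, j i = j a := by
        intro i
        have : i = a ∨ i = b ∨ i = c := by
          revert hne hac hbc; clear * -; revert a b c i; decide
        rcases this with rfl | rfl | rfl
        · rfl
        · exact hab.symm
        · exact hjc
      exact fun i => (this i).trans (this 0).symm
    obtain ⟨v, hv, hv1, hv2⟩ := exists_separating hβ hjc
    have := h v hv
    rw [combination_apply, sum_eq_of_pair β j hne hac hbc, ← hab, hv2] at this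
    have hβc : (β c : ℚ) ≠ 0 := by exact_mod_cast hβ c
    have : (β c : ℚ) * v (j c) = 0 := by linarith
    exact (mul_ne_zero hβc hv1) this
  have hleft : ∀ i, ∃ k, j i = Sum.inl k := by
    intro i
    rcases hji : j i with k | k
    · exact ⟨k, rfl⟩
    · exfalso
      have := h (fun x => if x = Sum.inr k then 1 else 0) (by simp [combination_apply])
      rw [combination_apply] at this
      simp_rw [← hji, hinj.eq_iff] at this
      simp at this
      exact hβ i this
  choose σ hσ using hleft
  have hσinj : Function.Injective σ := fun a b hab => hinj (by rw [hσ, hσ, hab])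
  let e := Equiv.ofBijective σ (Finite.injective_iff_bijective.1 hσinj)
  have he : ∀ i, j i = Sum.inl (e i) := hσ
  -- Testing on vectors of the hyperplane with entries `β b` at `a` and `-β a` at `b` gives
  -- proportionality; a permutation preserves the product of the coefficients.
  have key : (fun k => β (e.symm k)) = β := by
    refine eq_of_forall_mul_eq hβ (Equiv.prod_comp e.symm β) fun a b => ?_
    have := h (fun x => β b * (if x = Sum.inl a then 1 else 0) -
      β a * (if x = Sum.inl b then 1 else 0)) (by
        simp only [combination_apply, Sum.inl.injEq, mul_sub, Finset.sum_sub_distrib]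
        simp [mul_comm])
    simp only [combination_apply, he, Sum.inl.injEq, mul_sub, Finset.sum_sub_distrib,
      ← Equiv.eq_symm_apply] at this
    simp at this
    have : (β (e.symm a) : ℚ) * β b = β (e.symm b) * β a := by linarith
    exact_mod_cast this
  refine ⟨e, he, fun i => ?_⟩
  have := congrFun key (e i)
  simpa using this.symm

/-- A generic `w` on the hyperplane is not a zero of any of the finitely many forms that do not
vanish identically there, so it satisfies forced relations only. The coordinates `inr k` are weights
for the dummies. -/
theorem exists_weights {β : Fin 3 → ℤ} (hβ : ∀ i, β i ≠ 0) :
    ∃ w : Fin 3 ⊕ Fin 3 → ℤ, (∑ i, β i * w (.inl i) = 0) ∧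
      (∀ k b, w (.inl k) = w b → b = .inl k) ∧
      ∀ j : Fin 3 → Fin 3 ⊕ Fin 3, ∑ i, β i * w (j i) = 0 →
        (∑ i, β i = 0 ∧ ∀ i, j i = j 0) ∨
          ∃ σ : Equiv.Perm (Fin 3), (∀ i, j i = Sum.inl (σ i)) ∧ ∀ i, β (σ i) = β i := by
  classical
  obtain ⟨w, hw, hwF⟩ := exists_int_vector (combination β Sum.inl)
    (((Finset.univ : Finset (Fin 3 → Fin 3 ⊕ Fin 3)).image (combination β)).filter
      fun f => ∃ v, combination β Sum.inl v = 0 ∧ f v ≠ 0)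
    fun f hf => (Finset.mem_filter.1 hf).2
  have hcast : ∀ j : Fin 3 → Fin 3 ⊕ Fin 3,
      combination β j (fun i => w i) = ((∑ i, β i * w (j i) : ℤ) : ℚ) := by
    intro j; rw [combination_apply]; push_cast; rfl
  have hw0 : ∑ i, β i * w (.inl i) = 0 := by
    have := hcast Sum.inl
    rw [hw] at this
    exact_mod_cast this.symm
  have gen : ∀ j : Fin 3 → Fin 3 ⊕ Fin 3, ∑ i, β i * w (j i) = 0 →
        (∑ i, β i = 0 ∧ ∀ i, j i = j 0) ∨
          ∃ σ : Equiv.Perm (Fin 3), (∀ i, j i = Sum.inl (σ i)) ∧ ∀ i, β (σ i) = β i := by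
    intro j hj
    apply classes_of_combination_eq_zero hβ
    by_contra! hv
    refine hwF _ (Finset.mem_filter.2 ⟨Finset.mem_image_of_mem _ (Finset.mem_univ j), hv⟩) ?_
    rw [hcast, hj, Int.cast_zero]
  refine ⟨w, hw0, fun k b hkb => ?_, gen⟩
  -- A class `b` with the weight of `k` may replace `k` in the defining relation. The two untouched
  -- classes exclude a constant `j` and are fixed by the permutation, which therefore fixes `k` as
  -- well.
  have hj : ∑ i, β i * w (if i = k then b else Sum.inl i) = 0 := by
    rw [← hw0]
    refine Finset.sum_congr rfl fun i _ => ?_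
    split_ifs with hi
    · rw [hi, hkb]
    · rfl
  obtain ⟨a, c, hak, hck, hac⟩ : ∃ a c : Fin 3, a ≠ k ∧ c ≠ k ∧ a ≠ c := by
    clear * -; revert k; decide
  rcases gen _ hj with ⟨-, h⟩ | ⟨σ, hσ, -⟩
  · have h1 := (h a).trans (h c).symm
    rw [if_neg hak, if_neg hck] at h1
    exact absurd (Sum.inl.inj h1) hac
  · have hfix : ∀ i, i ≠ k → σ i = i := fun i hi => by
      have := hσ i
      rw [if_neg hi] at this
      exact (Sum.inl.inj this).symm
    have hk : σ k = k := by
      by_contra hne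
      exact hne (σ.injective (hfix _ hne))
    have := hσ k
    rwa [if_pos rfl, hk] at this

/-! ### The affine images -/

/-- Constants of the reduction from solutions to `∑ i, α i * x i = s` to solutions to
`∑ i, β i * y i = t`. -/
structure Gadget (α β : Fin 3 → ℤ) (s t : ℤ) where
  h : ℕ
  Γ : ℤ
  c : Fin 3 → ℤ
  γ : Fin 3 → ℤ
  w : Fin 3 ⊕ Fin 3 → ℤ
  c₀ : ℤ
  η : ℤ
  μ : ℕ
  ne : ∀ i, β i ≠ 0
  one_le_h : 1 ≤ h
  abs_sum_le : ∑ i, |β i| ≤ 2 ^ h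
  lt_Γ : |t| < Γ
  dvd : ∀ k, Γ ∣ γ k
  γ_ne : ∀ k, γ k ≠ 0
  lin : ∀ x : Fin 3 → ℤ, ∑ i, β i * (c i + γ i * x i) = t ↔ ∑ i, α i * x i = s
  w_sum : ∑ i, β i * w (.inl i) = 0
  w_inj : ∀ k b, w (.inl k) = w b → b = .inl k
  w_gen : ∀ j : Fin 3 → Fin 3 ⊕ Fin 3, ∑ i, β i * w (j i) = 0 →
    (∑ i, β i = 0 ∧ ∀ i, j i = j 0) ∨
      ∃ σ : Equiv.Perm (Fin 3), (∀ i, j i = Sum.inl (σ i)) ∧ ∀ i, β (σ i) = β i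
  le_c₀ : ∀ k, |c k| + |γ k| ≤ c₀
  pad_le_c₀ : Γ * (4 * (2 ^ h) ^ 2) ≤ c₀
  lt_η : 2 ^ h * c₀ + |t| < η
  le_μ : ∀ a, η * |w a| + c₀ ≤ μ
  three_le_μ : 3 ≤ μ

/-- With `γ i = Γ * β (i + 1) * β (i + 2) * α i`, the sum `∑ β i * γ i * x i` is a multiple of `∑ α
i * x i`, and Bézout coefficients supply `c` with the right constant. The factor `Γ > |t|` serves
equations inside a single class: there the constants cancel, and a multiple of `Γ` equals `t` only
if it is zero. `η` makes the scale exceed the offsets, and `μ` makes the values fit into the cube of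
the query size. -/
theorem Gadget.exists {α β : Fin 3 → ℤ} {s t : ℤ} (hα : ∀ i, α i ≠ 0) (hβ : ∀ i, β i ≠ 0)
    (ht : t = 0 ∨ Finset.univ.gcd β ∣ t) : Nonempty (Gadget α β s t) := by
  obtain ⟨w, w_sum, w_inj, w_gen⟩ := exists_weights hβ
  set Γ : ℤ := |t| + 1 with hΓ
  have hΓ0 : 0 < Γ := by positivity
  have hdvd : Finset.univ.gcd β ∣ t := by
    rcases ht with rfl | ht
    · exact dvd_zero _
    · exact ht
  -- The right side is the value that `∑ i, β i * c i` has to take.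
  have hdvd' : Finset.univ.gcd β ∣ t - Γ * (β 0 * β 1 * β 2) * s :=
    dvd_sub hdvd (Dvd.dvd.mul_right (Dvd.dvd.mul_left
      (((Finset.gcd_dvd (Finset.mem_univ 0)).mul_right _).mul_right _) _) _)
  obtain ⟨g, hg⟩ := Finset.gcd_eq_sum_mul Finset.univ β
  obtain ⟨u, hu⟩ := hdvd'
  set h : ℕ := ∑ i, (β i).natAbs + 1 with hh
  set c : Fin 3 → ℤ := fun i => g i * u with hc
  set γ : Fin 3 → ℤ := fun i => Γ * (β (i + 1) * β (i + 2) * α i) with hγ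
  set c₀ : ℤ := ∑ k, (|c k| + |γ k|) + Γ * (4 * (2 ^ h) ^ 2) with hc₀
  have hcγ : 0 ≤ ∑ k, (|c k| + |γ k|) := Finset.sum_nonneg fun k _ => by positivity
  have hpad : 0 ≤ Γ * (4 * (2 ^ h) ^ 2) := by positivity
  set η : ℤ := 2 ^ h * c₀ + |t| + 1 with hη
  have hη0 : 0 ≤ η := by positivity
  have hle : ∀ a, η * |w a| ≤ ∑ a, η * |w a| := fun a =>
    Finset.single_le_sum (f := fun a => η * |w a|) (fun a _ => by positivity) (Finset.mem_univ a)
  refine ⟨⟨h, Γ, c, γ, w, c₀, η, (∑ a, η * |w a| + c₀ + 3).toNat, hβ, by omega, ?_, by omega,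
    fun k => Dvd.intro _ rfl, fun k => ?_, fun x => ?_, w_sum, w_inj, w_gen, fun k => ?_, by omega,
    by omega, fun a => ?_, ?_⟩⟩
  · have h1 : ∑ i, |β i| = ((∑ i, (β i).natAbs : ℕ) : ℤ) := by
      push_cast; rfl
    rw [h1]
    have h2 : ∑ i, (β i).natAbs < 2 ^ h :=
      (Nat.lt_succ_self _).trans (Nat.lt_two_pow_self (n := h))
    exact_mod_cast h2.le
  · exact mul_ne_zero hΓ0.ne' (mul_ne_zero (mul_ne_zero (hβ _) (hβ _)) (hα _))
  · have key : ∑ i, β i * (c i + γ i * x i) =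
        t + Γ * (β 0 * β 1 * β 2) * (∑ i, α i * x i - s) := by
      have h1 : ∑ i, β i * c i = t - Γ * (β 0 * β 1 * β 2) * s := by
        rw [hu, hg, Finset.sum_mul]
        exact Finset.sum_congr rfl fun i _ => by simp only [hc]; ring
      rw [Fin.sum_univ_three] at h1 ⊢
      simp only [hγ, Fin.sum_univ_three, Fin.isValue, zero_add,
        show (1 : Fin 3) + 1 = 2 from rfl, show (1 : Fin 3) + 2 = 0 from rfl,
        show (2 : Fin 3) + 1 = 0 from rfl, show (2 : Fin 3) + 2 = 1 from rfl]
      linear_combination h1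
    rw [key]
    have hne : Γ * (β 0 * β 1 * β 2) ≠ 0 :=
      mul_ne_zero hΓ0.ne' (mul_ne_zero (mul_ne_zero (hβ _) (hβ _)) (hβ _))
    constructor
    · intro h
      have : Γ * (β 0 * β 1 * β 2) * (∑ i, α i * x i - s) = 0 := by linarith
      have := (mul_eq_zero.1 this).resolve_left hne
      linarith
    · intro h
      rw [h]; ring
  · have := Finset.single_le_sum (f := fun k => |c k| + |γ k|)
      (fun k _ => by positivity) (Finset.mem_univ k)
    linarith
  · have := hle a
    have : 0 ≤ η * |w a| := by positivity
    omega
  · have := hle (.inl 0)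
    have : 0 ≤ η * |w (.inl 0)| := by positivity
    omega

theorem paraboloid_injective {b R i j : ℤ} (hb : 1 ≤ b) (hR : 0 < R) (hi : 0 ≤ i)
    (hi' : i < R * R) (hj : 0 ≤ j) (hj' : j < R * R) (h : paraboloid b R i = paraboloid b R j) :
    i = j := by
  obtain ⟨h1, h2, h3, h4⟩ := grid_bounds hR hi hi'
  obtain ⟨g1, g2, g3, g4⟩ := grid_bounds hR hj hj'
  unfold paraboloid at h
  have hbR : R ≤ b * R := by nlinarith
  obtain ⟨e1, e2⟩ := eq_zero_of_add_mul_eq_zero (D := b * R) (u := i % R - j % R)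
    (v := i / R - j / R + b * R * (i % R * (i % R) + i / R * (i / R)
      - (j % R * (j % R) + j / R * (j / R)))) (by linear_combination h)
    (by rw [abs_lt]; constructor <;> linarith)
  obtain ⟨e3, -⟩ := eq_zero_of_add_mul_eq_zero e2 (by rw [abs_lt]; constructor <;> linarith)
  rw [← Int.emod_add_mul_ediv i R, ← Int.emod_add_mul_ediv j R, sub_eq_zero.1 e1, sub_eq_zero.1 e3]

namespace Gadget

variable {α β : Fin 3 → ℤ} {s t : ℤ} (G : Gadget α β s t) {n : ℕ} {R : ℤ}

/-- The lower-order part of a value. -/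
def offset (R : ℤ) : Fin 3 ⊕ Fin 3 → ℤ → ℤ
  | .inl k, x => G.c k + G.γ k * x
  | .inr _, j => G.Γ * paraboloid (2 ^ G.h) R j

/-- The scale that separates the classes. -/
def scale (n : ℕ) (R : ℤ) : ℤ := G.η * ((n + 1) * (R * R) ^ 2)

/-- The image of an element of the `k`-th set (class `inl k`), or a dummy (class `inr k`). -/
def value (n : ℕ) (R : ℤ) (a : Fin 3 ⊕ Fin 3) (z : ℤ) : ℤ := G.scale n R * G.w a + G.offset R a z

/-- The admissible arguments of `value`. -/
def Admissible (n : ℕ) (R : ℤ) : Fin 3 ⊕ Fin 3 → ℤ → Prop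
  | .inl _, x => |x| ≤ n ^ 3
  | .inr _, j => 0 ≤ j ∧ j < R * R

theorem two_le_base : (2 : ℤ) ≤ 2 ^ G.h := by
  calc (2 : ℤ) = 2 ^ 1 := by norm_num
    _ ≤ _ := pow_le_pow_right₀ (by norm_num) G.one_le_h

theorem c₀_nonneg : 0 ≤ G.c₀ := le_trans (by positivity) (G.le_c₀ 0)

theorem Γ_pos : 0 < G.Γ := (abs_nonneg t).trans_lt G.lt_Γ

theorem η_pos : 0 < G.η := by
  have := G.lt_η
  have := G.c₀_nonneg
  have := abs_nonneg t
  have : 0 ≤ 2 ^ G.h * G.c₀ := by positivity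
  linarith

/-- For elements this uses that `n ^ 3` is at most `(n + 1) * m ^ 2` with `m = R * R`; for dummies,
that the paraboloid is quadratic in `m`. -/
theorem abs_offset_le (hR : 0 < R) (hn : G.μ * (n + 1) ≤ R * R) {a : Fin 3 ⊕ Fin 3} {z : ℤ}
    (hz : Admissible n R a z) : |G.offset R a z| ≤ G.c₀ * ((n + 1) * (R * R) ^ 2) := by
  have hμ : (3 : ℤ) ≤ G.μ := by exact_mod_cast G.three_le_μ
  have hn1 : (n : ℤ) + 1 ≤ R * R := by nlinarith
  have hU : (1 : ℤ) ≤ (n + 1) * (R * R) ^ 2 := by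
    have : (0 : ℤ) < (n + 1) * (R * R) ^ 2 := by positivity
    linarith
  rcases a with k | k
  · have hz : |z| ≤ (n : ℤ) ^ 3 := hz
    have hzU : |z| ≤ (n + 1) * (R * R) ^ 2 := by
      calc |z| ≤ (n : ℤ) ^ 3 := hz
        _ ≤ (n + 1 : ℤ) ^ 3 := by gcongr; linarith
        _ = (n + 1) * (n + 1 : ℤ) ^ 2 := by ring
        _ ≤ _ := by gcongr
    have := G.le_c₀ k
    calc |G.c k + G.γ k * z| ≤ |G.c k| + |G.γ k| * |z| := by
          rw [← abs_mul]; exact abs_add_le _ _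
      _ ≤ |G.c k| * ((n + 1) * (R * R) ^ 2) + |G.γ k| * ((n + 1) * (R * R) ^ 2) := by
          apply add_le_add
          · exact le_mul_of_one_le_right (abs_nonneg _) hU
          · gcongr
      _ = (|G.c k| + |G.γ k|) * ((n + 1) * (R * R) ^ 2) := by ring
      _ ≤ _ := by gcongr
  · have hp := abs_paraboloid_le (b := 2 ^ G.h) (by linarith [G.two_le_base]) hR hz.1 hz.2
    have := G.pad_le_c₀
    have := G.Γ_pos
    calc |G.Γ * paraboloid (2 ^ G.h) R z| = G.Γ * |paraboloid (2 ^ G.h) R z| := by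
          rw [abs_mul, abs_of_pos G.Γ_pos]
      _ ≤ G.Γ * (4 * (2 ^ G.h) ^ 2 * (R * R) ^ 2) := by gcongr
      _ = G.Γ * (4 * (2 ^ G.h) ^ 2) * (R * R) ^ 2 := by ring
      _ ≤ G.c₀ * (R * R) ^ 2 := by gcongr
      _ ≤ _ := by
          have := G.c₀_nonneg
          gcongr
          exact le_mul_of_one_le_left (by positivity) (by linarith)

/-- All constants are collected in `μ`, and `μ * (n + 1) ≤ m` trades them for a third factor `m`.
This puts the queries into `{-m³, …, m³}`. -/
theorem abs_value_le (hR : 0 < R) (hn : G.μ * (n + 1) ≤ R * R) {a : Fin 3 ⊕ Fin 3} {z : ℤ}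
    (hz : Admissible n R a z) : |G.value n R a z| ≤ (R * R) ^ 3 := by
  have h1 := G.abs_offset_le hR hn hz
  have h2 : |G.scale n R * G.w a| = G.η * |G.w a| * ((n + 1) * (R * R) ^ 2) := by
    have := G.η_pos
    rw [abs_mul, abs_of_nonneg (by unfold scale; positivity), scale]; ring
  calc |G.value n R a z| ≤ |G.scale n R * G.w a| + |G.offset R a z| := abs_add_le _ _
    _ ≤ (G.η * |G.w a| + G.c₀) * ((n + 1) * (R * R) ^ 2) := by rw [h2]; linarith
    _ ≤ G.μ * ((n + 1) * (R * R) ^ 2) := by have := G.le_μ a; gcongr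
    _ = G.μ * (n + 1) * (R * R) ^ 2 := by ring
    _ ≤ R * R * (R * R) ^ 2 := by gcongr
    _ = _ := by ring

theorem offset_lt_scale (hR : 0 < R) : 2 ^ G.h * (G.c₀ * ((n + 1) * (R * R) ^ 2)) + |t| <
    G.scale n R := by
  have hU : (1 : ℤ) ≤ (n + 1) * (R * R) ^ 2 := by
    have : (0 : ℤ) < (n + 1) * (R * R) ^ 2 := by positivity
    linarith
  have h1 := G.lt_η
  have h2 := abs_nonneg t
  unfold scale
  nlinarith

/-- Weights and offsets can be compared separately. The weights of two classes of dummies are not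
known to differ, hence the condition `ha`. -/
theorem value_injective (hR : 0 < R) (hn : G.μ * (n + 1) ≤ R * R) {a a' : Fin 3 ⊕ Fin 3} {z z' : ℤ}
    (hz : Admissible n R a z) (hz' : Admissible n R a' z') (ha : a' = a ∨ ∃ k, a = .inl k)
    (h : G.value n R a z = G.value n R a' z') : a' = a ∧ z = z' := by
  have h1 := abs_le.1 (G.abs_offset_le hR hn hz)
  have h2 := abs_le.1 (G.abs_offset_le hR hn hz')
  have h3 := G.offset_lt_scale (n := n) hR
  have hb := G.two_le_base
  have hC : 0 ≤ G.c₀ * ((n + 1) * (R * R) ^ 2) := mul_nonneg G.c₀_nonneg (by positivity)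
  have ht := abs_nonneg t
  have h4 : 2 * (G.c₀ * ((n + 1) * (R * R) ^ 2)) ≤ 2 ^ G.h * (G.c₀ * ((n + 1) * (R * R) ^ 2)) := by
    gcongr
  obtain ⟨e1, e2⟩ := eq_zero_of_add_mul_eq_zero (D := G.scale n R)
    (u := G.offset R a z - G.offset R a' z') (v := G.w a - G.w a')
    (by unfold value at h; linear_combination h) (by rw [abs_lt]; constructor <;> linarith)
  have haa : a' = a := by
    rcases ha with ha | ⟨k, rfl⟩
    · exact ha
    · exact G.w_inj k a' (by linarith)
  subst haa
  refine ⟨rfl, ?_⟩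
  have e3 := sub_eq_zero.1 e1
  rcases a' with k | k
  · simp only [offset, add_right_inj] at e3
    exact mul_left_cancel₀ (G.γ_ne k) e3
  · simp only [offset] at e3
    exact paraboloid_injective (by linarith) hR hz.1 hz.2 hz'.1 hz'.2
      (mul_left_cancel₀ G.Γ_pos.ne' e3)

theorem sum_value_eq (j : Fin 3 → Fin 3 ⊕ Fin 3) (z : Fin 3 → ℤ) :
    ∑ i, β i * G.value n R (j i) (z i) =
      G.scale n R * ∑ i, β i * G.w (j i) + ∑ i, β i * G.offset R (j i) (z i) := by
  simp only [value, Fin.sum_univ_three]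
  ring

theorem sum_value_inl_iff (x : Fin 3 → ℤ) :
    ∑ i, β i * G.value n R (.inl i) (x i) = t ↔ ∑ i, α i * x i = s := by
  rw [← G.lin, sum_value_eq (j := Sum.inl), G.w_sum, mul_zero, zero_add]
  rfl

/-- The heart of the reduction. The offsets stay below the scale, so the weights satisfy their own
equation and genericity leaves two cases. A single class contradicts `hne`, by `hfree` for elements
and by the paraboloid for dummies; a permutation gives a genuine solution. -/
theorem exists_perm_of_sum_value_eq (hR : 0 < R) (hn : G.μ * (n + 1) ≤ R * R)
    {j : Fin 3 → Fin 3 ⊕ Fin 3} {z : Fin 3 → ℤ} (hz : ∀ i, Admissible n R (j i) (z i))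
    (hsum : ∑ i, β i * G.value n R (j i) (z i) = t) (hne : (∀ i, j i = j 0) → z 0 ≠ z 1)
    (hfree : ∀ k, (∀ i, j i = .inl k) → ∑ i, β i = 0 → ∑ i, β i * z i = 0 → z 0 = z 1) :
    ∃ σ : Equiv.Perm (Fin 3), (∀ i, j i = .inl (σ i)) ∧ ∑ i, α i * z (σ.symm i) = s := by
  rw [sum_value_eq] at hsum
  have h1 := abs_sum_mul_le (z := fun i => G.offset R (j i) (z i)) G.abs_sum_le
    (mul_nonneg G.c₀_nonneg (by positivity)) fun i => G.abs_offset_le hR hn (hz i)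
  have h2 := G.offset_lt_scale (n := n) hR
  obtain ⟨e1, e2⟩ := eq_zero_of_add_mul_eq_zero (D := G.scale n R)
    (u := ∑ i, β i * G.offset R (j i) (z i) - t) (v := ∑ i, β i * G.w (j i))
    (by linarith) ((abs_sub _ _).trans_lt (by linarith))
  rcases G.w_gen j e2 with ⟨h0, hj⟩ | ⟨σ, hσ, hβσ⟩
  · exfalso
    -- This is where `|t| < Γ` enters: the equation inside one class becomes homogeneous.
    have small : ∀ u : ℤ, G.Γ * u = t → u = 0 := by
      intro u hu
      by_contra hu0
      have h3 := Int.one_le_abs hu0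
      have h4 : |t| = G.Γ * |u| :=
        (congrArg abs hu).symm.trans (by rw [abs_mul, abs_of_pos G.Γ_pos])
      have := G.lt_Γ
      have := G.Γ_pos
      nlinarith
    refine hne hj ?_
    rcases h00 : j 0 with k | k
    · refine hfree k (fun i => (hj i).trans h00) h0 ?_
      obtain ⟨g, hg⟩ := G.dvd k
      have : G.Γ * (g * ∑ i, β i * z i) = t := by
        refine Eq.trans ?_ (sub_eq_zero.1 e1)
        simp only [hj, h00, offset, hg]
        have : ∑ i, β i * (G.c k + G.Γ * g * z i) =
            (∑ i, β i) * G.c k + G.Γ * (g * ∑ i, β i * z i) := by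
          simp only [Fin.sum_univ_three]; ring
        rw [this, h0]; ring
      have hg0 : g ≠ 0 := fun h => G.γ_ne k (by rw [hg, h, mul_zero])
      exact (mul_eq_zero.1 (small _ this)).resolve_left hg0
    · have hz' : ∀ i, 0 ≤ z i ∧ z i < R * R := fun i => by
        have := hz i
        rw [hj i, h00] at this
        exact this
      have hb := G.two_le_base
      refine eq_of_sum_paraboloid_eq_zero G.ne h0 G.abs_sum_le (by linarith) hR
        (fun i => (hz' i).1) (fun i => (hz' i).2) (small _ ?_)
      refine Eq.trans ?_ (sub_eq_zero.1 e1)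
      simp only [hj, h00, offset, Finset.mul_sum]
      exact Finset.sum_congr rfl fun i _ => by ring
  · refine ⟨σ, hσ, ?_⟩
    -- As `β` is invariant under `σ`, the summation index may be permuted without changing the
    -- coefficients.
    rw [← G.sum_value_inl_iff (n := n) (R := R), ← Equiv.sum_comp σ]
    rw [← sum_value_eq] at hsum
    refine Eq.trans ?_ hsum
    exact Finset.sum_congr rfl fun i _ => by rw [hβσ, hσ, Equiv.symm_apply_apply]

end Gadget

/-! ### Labels -/

/-- Two digits of `x`, at the positions `a` and `a'`, as a two-digit number. -/
def twoDigits (D x a a' : ℤ) (K : ℕ) : ℤ :=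
  ∑ t ∈ Finset.range K,
    ((if (t : ℤ) = a then digit D x t else 0) + (if (t : ℤ) = a' then digit D x t * D else 0))

theorem twoDigits_eq (D x : ℤ) {a a' K : ℕ} (ha : a < K) (ha' : a' < K) :
    twoDigits D x a a' K = digit D x a + D * digit D x a' := by
  unfold twoDigits
  simp only [Nat.cast_inj, Finset.sum_add_distrib, Finset.sum_ite_eq', Finset.mem_range, ha, ha',
    if_true]
  ring

theorem sum_ite_cast_eq_bounds {f : ℕ → ℤ} {C : ℤ} (hC : 0 ≤ C) (hf : ∀ t, 0 ≤ f t)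
    (hf' : ∀ t, f t ≤ C) (a : ℤ) (K : ℕ) :
    0 ≤ ∑ t ∈ Finset.range K, (if (t : ℤ) = a then f t else 0) ∧
      ∑ t ∈ Finset.range K, (if (t : ℤ) = a then f t else 0) ≤ C := by
  refine ⟨Finset.sum_nonneg fun t _ => by split_ifs <;> simp [hf], ?_⟩
  by_cases h : ∃ u : ℕ, (u : ℤ) = a
  · obtain ⟨u, rfl⟩ := h
    simp only [Nat.cast_inj, Finset.sum_ite_eq']
    split_ifs
    · exact hf' u
    · exact hC
  · push Not at h
    simp [h, hC]

theorem twoDigits_bounds {D : ℤ} (hD : 0 < D) (x a a' : ℤ) (K : ℕ) :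
    0 ≤ twoDigits D x a a' K ∧ twoDigits D x a a' K < D ^ 2 := by
  have h1 := sum_ite_cast_eq_bounds (f := digit D x) (C := D - 1) (by linarith)
    (digit_nonneg hD x) (fun t => by linarith [digit_lt hD x t]) a K
  have h2 := sum_ite_cast_eq_bounds (f := fun t => digit D x t * D) (C := (D - 1) * D)
    (mul_nonneg (by linarith) hD.le) (fun t => mul_nonneg (digit_nonneg hD x t) hD.le)
    (fun t => mul_le_mul_of_nonneg_right (by linarith [digit_lt hD x t]) hD.le) a' K
  unfold twoDigits
  rw [Finset.sum_add_distrib]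
  exact ⟨add_nonneg h1.1 h2.1, by nlinarith⟩

/-- Three distinct numbers are told apart by their digits at two suitable positions. -/
theorem exists_twoDigits_injective {D : ℤ} (hD : 0 < D) {K : ℕ} {x : Fin 3 → ℤ}
    (hx0 : ∀ i, 0 ≤ x i) (hxK : ∀ i, x i < D ^ K) (hx : Function.Injective x) :
    ∃ a a' : ℕ, a < K ∧ a' < K ∧ Function.Injective fun i => twoDigits D (x i) a a' K := by
  have sep : ∀ i j, i ≠ j → ∃ a < K, digit D (x i) a ≠ digit D (x j) a := by
    intro i j hij
    by_contra! h
    exact hij (hx (eq_of_digit_eq hD (hx0 i) (hxK i) (hx0 j) (hxK j) h))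
  -- If the position `a` separates `i` from `j` only, then it also separates `k` from `j`, and it
  -- remains to add a position separating `i` from `k`.
  have main : ∀ i j k : Fin 3, i ≠ j → i ≠ k → j ≠ k → ∀ a < K,
      digit D (x i) a ≠ digit D (x j) a → digit D (x i) a = digit D (x k) a →
      ∃ a a' : ℕ, a < K ∧ a' < K ∧ Function.Injective fun i => twoDigits D (x i) a a' K := by
    intro i j k hij hik hjk a ha h1 h2
    obtain ⟨a', ha', h3⟩ := sep i k hik
    refine ⟨a, a', ha, ha', ?_⟩
    have key : ∀ u v, twoDigits D (x u) a a' K = twoDigits D (x v) a a' K →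
        digit D (x u) a = digit D (x v) a ∧ digit D (x u) a' = digit D (x v) a' := by
      intro u v h
      rw [twoDigits_eq _ _ ha ha', twoDigits_eq _ _ ha ha'] at h
      have b1 := digit_nonneg hD (x u) a
      have b2 := digit_lt hD (x u) a
      have b3 := digit_nonneg hD (x v) a
      have b4 := digit_lt hD (x v) a
      obtain ⟨e1, e2⟩ := eq_zero_of_add_mul_eq_zero (D := D)
        (u := digit D (x u) a - digit D (x v) a) (v := digit D (x u) a' - digit D (x v) a')
        (by linear_combination h) (by rw [abs_lt]; constructor <;> linarith)
      exact ⟨by linarith, by linarith⟩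
    have hcases : ∀ u : Fin 3, u = i ∨ u = j ∨ u = k := by
      clear * - hij hik hjk; revert i j k; decide
    intro u v huv
    obtain ⟨g1, g2⟩ := key u v huv
    rcases hcases u with rfl | rfl | rfl <;> rcases hcases v with rfl | rfl | rfl <;>
      first
        | rfl
        | exact absurd g1 h1
        | exact absurd g1.symm h1
        | exact absurd g2 h3
        | exact absurd g2.symm h3
        | exact absurd (h2.trans g1) h1
        | exact absurd (h2.trans g1.symm) h1
  obtain ⟨a, ha, h01⟩ := sep 0 1 (by decide)
  by_cases h02 : digit D (x 0) a = digit D (x 2) a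
  · exact main 0 1 2 (by decide) (by decide) (by decide) a ha h01 h02
  by_cases h12 : digit D (x 1) a = digit D (x 2) a
  · exact main 1 0 2 (by decide) (by decide) (by decide) a ha h01.symm h12
  -- All three digits at `a` are different, so this position is used twice.
  · refine ⟨a, a, ha, ha, fun u v huv => ?_⟩
    simp only [twoDigits_eq _ _ ha ha] at huv
    have : digit D (x u) a * (1 + D) = digit D (x v) a * (1 + D) := by linear_combination huv
    have := mul_right_cancel₀ (by linarith) this
    fin_cases u <;> fin_cases v <;> simp_all

/-! ### A block size of order `2 ^ √(log n)` -/

theorem exists_lt_two_pow_sq (n : ℕ) : ∃ i, n < 2 ^ (i + 1) ^ 2 :=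
  ⟨n, Nat.lt_two_pow_self.trans_le (Nat.pow_le_pow_right (by norm_num) (by nlinarith))⟩

/-- The least `k ≥ 1` with `n < 2 ^ k ^ 2`. -/
def sqrtLog (n : ℕ) : ℕ := Nat.find (exists_lt_two_pow_sq n) + 1

theorem lt_two_pow_sqrtLog_sq (n : ℕ) : n < 2 ^ sqrtLog n ^ 2 := Nat.find_spec (exists_lt_two_pow_sq n)

theorem one_le_sqrtLog (n : ℕ) : 1 ≤ sqrtLog n := Nat.le_add_left _ _

theorem two_pow_sq_le (n : ℕ) : 2 ^ (sqrtLog n - 1) ^ 2 ≤ n + 1 := by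
  unfold sqrtLog
  rcases hi : Nat.find (exists_lt_two_pow_sq n) with _ | i
  · simp
  · have := Nat.find_min (exists_lt_two_pow_sq n) (m := i) (by omega)
    simp only [Nat.add_sub_cancel]
    omega

/-- The digits are below `2 ^ h * blockSize n`. -/
def blockSize (n : ℕ) : ℤ := 2 ^ sqrtLog n

theorem two_le_blockSize (n : ℕ) : 2 ≤ blockSize n := by
  calc (2 : ℤ) = 2 ^ 1 := by norm_num
    _ ≤ _ := pow_le_pow_right₀ (by norm_num) (one_le_sqrtLog n)

theorem sqrtLog_lt_blockSize (n : ℕ) : (sqrtLog n : ℤ) < blockSize n := by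
  unfold blockSize
  exact_mod_cast Nat.lt_two_pow_self

theorem blockSize_pow_mono (n : ℕ) {a b : ℕ} (h : a ≤ b) : blockSize n ^ a ≤ blockSize n ^ b :=
  pow_le_pow_right₀ (by linarith [two_le_blockSize n]) h

theorem lt_blockSize_pow (n : ℕ) : (n : ℤ) < blockSize n ^ sqrtLog n := by
  have := lt_two_pow_sqrtLog_sq n
  rw [blockSize, ← pow_mul, ← sq]
  exact_mod_cast this

theorem two_pow_le_blockSize_pow (n h : ℕ) : 2 ^ h ≤ blockSize n ^ h :=
  pow_le_pow_left₀ (by norm_num) (two_le_blockSize n) h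

theorem blockSize_le (n : ℕ) : blockSize n ≤ 2 * (n + 1) := by
  have h1 := two_pow_sq_le n
  have h2 : sqrtLog n ≤ (sqrtLog n - 1) ^ 2 + 1 := by
    obtain ⟨j, hj⟩ := Nat.exists_eq_add_of_le' (one_le_sqrtLog n)
    rw [hj, Nat.add_sub_cancel]
    nlinarith [Nat.le_self_pow (two_ne_zero) j]
  have h3 : 2 ^ sqrtLog n ≤ 2 * (n + 1) := by
    calc 2 ^ sqrtLog n ≤ 2 ^ ((sqrtLog n - 1) ^ 2 + 1) := Nat.pow_le_pow_right (by norm_num) h2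
      _ = 2 * 2 ^ (sqrtLog n - 1) ^ 2 := by ring
      _ ≤ _ := by omega
  unfold blockSize
  exact_mod_cast h3

/-! ### Labels with subpolynomially many values -/

/-- A bound for each component of a label. -/
def labelBase (h n : ℕ) : ℤ := blockSize n ^ (4 * h + 6)

/-- The label of the element `x` of a set in `{-n³, …, n³}`. -/
def label (h n : ℕ) (a a' x : ℤ) : ℤ :=
  topDigits (2 ^ h) (blockSize n) (x + n ^ 3) (4 * sqrtLog n) +
    labelBase h n * normSq (2 ^ h) (blockSize n) (x + n ^ 3) (4 * sqrtLog n) +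
    labelBase h n ^ 2 * twoDigits (2 ^ h * blockSize n) (x + n ^ 3) a a' (4 * sqrtLog n)

section

variable (h n : ℕ)

theorem blockSize_pos : 0 < blockSize n := by linarith [two_le_blockSize n]

theorem base_pos : 0 < 2 ^ h * blockSize n := by have := blockSize_pos n; positivity

theorem labelBase_pos : 0 < labelBase h n := pow_pos (blockSize_pos n) _

/-- With `k = sqrtLog n`, interchanging exponents gives `(2 ^ h) ^ (4 * k) = (2 ^ k) ^ (4 * h)`.
This balance between the number of digits and their size makes the number of labels a fixed power of
the block size. -/
theorem topDigits_lt_labelBase (x : ℤ) {K : ℕ} (hK : K ≤ 4 * sqrtLog n) :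
    topDigits (2 ^ h) (blockSize n) x K < labelBase h n := by
  refine (topDigits_lt (by positivity) (blockSize_pos n) x _).trans_le ?_
  calc ((2 : ℤ) ^ h) ^ K ≤ (2 ^ h) ^ (4 * sqrtLog n) :=
        pow_le_pow_right₀ (one_le_pow₀ (by norm_num)) hK
    _ = blockSize n ^ (4 * h) := by
        unfold blockSize; rw [← pow_mul, ← pow_mul]; congr 1; ring
    _ ≤ _ := blockSize_pow_mono n (by omega)

theorem normSq_nonneg (x : ℤ) (K : ℕ) : 0 ≤ normSq (2 ^ h) (blockSize n) x K :=
  Finset.sum_nonneg fun _ _ => sq_nonneg _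

theorem normSq_le (x : ℤ) (K : ℕ) :
    normSq (2 ^ h) (blockSize n) x K ≤ K * blockSize n ^ 2 := by
  have := Finset.sum_le_card_nsmul (Finset.range K)
    (fun t => (digit (2 ^ h * blockSize n) x t % blockSize n) ^ 2) (blockSize n ^ 2) fun t _ =>
      pow_le_pow_left₀ (Int.emod_nonneg _ (blockSize_pos n).ne')
        (Int.emod_lt_of_pos _ (blockSize_pos n)).le 2
  simpa [normSq] using this

theorem four_mul_sqrtLog_le : (4 * sqrtLog n : ℤ) ≤ blockSize n ^ 3 := by
  have h1 := two_le_blockSize n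
  have h2 := sqrtLog_lt_blockSize n
  have h3 : 4 ≤ blockSize n ^ 2 := by nlinarith
  nlinarith

theorem normSq_lt_labelBase {x : ℤ} {K : ℕ} (hK : K ≤ 4 * sqrtLog n) :
    normSq (2 ^ h) (blockSize n) x K < labelBase h n := by
  refine (normSq_le h n x _).trans_lt ?_
  have h1 := two_le_blockSize n
  have h2 := four_mul_sqrtLog_le n
  have hK' : (K : ℤ) ≤ 4 * sqrtLog n := by exact_mod_cast hK
  calc (K : ℤ) * blockSize n ^ 2 ≤ blockSize n ^ 3 * blockSize n ^ 2 := by gcongr; linarith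
    _ = blockSize n ^ 5 := by ring
    _ < _ := pow_lt_pow_right₀ (by linarith) (by omega)

theorem base_sq_le_labelBase : (2 ^ h * blockSize n) ^ 2 ≤ labelBase h n := by
  have := two_pow_le_blockSize_pow n h
  have := blockSize_pos n
  calc (2 ^ h * blockSize n) ^ 2 ≤ (blockSize n ^ h * blockSize n) ^ 2 := by gcongr
    _ = blockSize n ^ (2 * h + 2) := by ring
    _ ≤ _ := blockSize_pow_mono n (by omega)

theorem label_bounds (a a' x : ℤ) : 0 ≤ label h n a a' x ∧ label h n a a' x < labelBase h n ^ 3 := by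
  have hM := labelBase_pos h n
  have h1 := topDigits_nonneg (b := 2 ^ h) (by positivity) (blockSize_pos n) (x + n ^ 3)
    (4 * sqrtLog n)
  have h2 := topDigits_lt_labelBase h n (x + n ^ 3) le_rfl
  have h3 := normSq_nonneg h n (x + n ^ 3) (4 * sqrtLog n)
  have h4 := normSq_lt_labelBase h n (x := x + n ^ 3) le_rfl
  have h5 := twoDigits_bounds (base_pos h n) (x + n ^ 3) a a' (4 * sqrtLog n)
  have h6 := h5.2.trans_le (base_sq_le_labelBase h n)
  have h7 := h5.1
  unfold label
  refine ⟨by positivity, ?_⟩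
  generalize topDigits (2 ^ h) (blockSize n) (x + n ^ 3) (4 * sqrtLog n) = u at *
  generalize normSq (2 ^ h) (blockSize n) (x + n ^ 3) (4 * sqrtLog n) = v at *
  generalize twoDigits (2 ^ h * blockSize n) (x + n ^ 3) a a' (4 * sqrtLog n) = w at *
  generalize labelBase h n = M at *
  have e1 : M * v ≤ M * (M - 1) := by gcongr; linarith
  have e2 : M ^ 2 * w ≤ M ^ 2 * (M - 1) := by gcongr; linarith
  nlinarith

/-- The components are digits in base `labelBase h n`; the leading one needs no bound here. -/
theorem label_eq {a a' x y : ℤ} (hxy : label h n a a' x = label h n a a' y) :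
    topDigits (2 ^ h) (blockSize n) (x + n ^ 3) (4 * sqrtLog n) =
        topDigits (2 ^ h) (blockSize n) (y + n ^ 3) (4 * sqrtLog n) ∧
      normSq (2 ^ h) (blockSize n) (x + n ^ 3) (4 * sqrtLog n) =
        normSq (2 ^ h) (blockSize n) (y + n ^ 3) (4 * sqrtLog n) ∧
      twoDigits (2 ^ h * blockSize n) (x + n ^ 3) a a' (4 * sqrtLog n) =
        twoDigits (2 ^ h * blockSize n) (y + n ^ 3) a a' (4 * sqrtLog n) := by
  have h1 := fun x : ℤ => topDigits_nonneg (b := 2 ^ h) (by positivity) (blockSize_pos n) (x + n ^ 3)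
    (4 * sqrtLog n)
  have h2 := fun x : ℤ => topDigits_lt_labelBase h n (x + n ^ 3) le_rfl
  have h3 := fun x : ℤ => normSq_nonneg h n (x + n ^ 3) (4 * sqrtLog n)
  have h4 := fun x : ℤ => normSq_lt_labelBase h n (x := x + n ^ 3) le_rfl
  have hM := labelBase_pos h n
  unfold label at hxy
  have e : ∀ {u v w : ℤ}, 0 ≤ u → u < w → 0 ≤ v → v < w → |u - v| < w := by
    intro u v w _ _ _ _; rw [abs_lt]; constructor <;> linarith
  obtain ⟨e1, e2⟩ := eq_zero_of_add_mul_eq_zero (D := labelBase h n)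
    (v := normSq (2 ^ h) (blockSize n) (x + n ^ 3) (4 * sqrtLog n) -
      normSq (2 ^ h) (blockSize n) (y + n ^ 3) (4 * sqrtLog n) + labelBase h n *
      (twoDigits (2 ^ h * blockSize n) (x + n ^ 3) a a' (4 * sqrtLog n) -
        twoDigits (2 ^ h * blockSize n) (y + n ^ 3) a a' (4 * sqrtLog n)))
    (by linear_combination hxy) (e (h1 x) (h2 x) (h1 y) (h2 y))
  obtain ⟨e3, e4⟩ := eq_zero_of_add_mul_eq_zero e2 (e (h3 x) (h4 x) (h3 y) (h4 y))
  exact ⟨sub_eq_zero.1 e1, sub_eq_zero.1 e3, sub_eq_zero.1 e4⟩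

variable {h n}

/-- With `n < p ^ k`, where `p = blockSize n` and `k = sqrtLog n`, three blocks of `k` digits cover
`n ^ 3`; the fourth absorbs the factor `2` caused by the shift. -/
theorem shift_bounds {x : ℤ} (hx : |x| ≤ (n : ℤ) ^ 3) :
    0 ≤ x + n ^ 3 ∧ x + n ^ 3 < (2 ^ h * blockSize n) ^ (4 * sqrtLog n) := by
  obtain ⟨h1, h2⟩ := abs_le.1 hx
  refine ⟨by linarith, ?_⟩
  have h3 := two_le_blockSize n
  have hb : (1 : ℤ) ≤ 2 ^ h := one_le_pow₀ (by norm_num)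
  have h4 := lt_blockSize_pow n
  have h5 : (n : ℤ) ^ 3 < (blockSize n ^ sqrtLog n) ^ 3 := by gcongr
  have h6 : 2 ≤ blockSize n ^ sqrtLog n :=
    h3.trans (le_self_pow₀ (by linarith) (by have := one_le_sqrtLog n; omega))
  calc x + n ^ 3 < 2 * (blockSize n ^ sqrtLog n) ^ 3 := by linarith
    _ ≤ blockSize n ^ sqrtLog n * (blockSize n ^ sqrtLog n) ^ 3 := by gcongr
    _ = blockSize n ^ (4 * sqrtLog n) := by ring
    _ ≤ _ := by gcongr; exact le_mul_of_one_le_left (by linarith) hb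

/-- The shift by `n ^ 3` is harmless, as the equation is translation-invariant. Only the first two
components of the label matter. -/
theorem eq_of_label_eq {β : Fin 3 → ℤ} (hβ : ∀ i, β i ≠ 0) (hsum : ∑ i, β i = 0)
    (hb : ∑ i, |β i| ≤ 2 ^ h) {a a' : ℤ} {x : Fin 3 → ℤ} (hx : ∀ i, |x i| ≤ (n : ℤ) ^ 3)
    (hx0 : ∑ i, β i * x i = 0) (hl : ∀ i, label h n a a' (x i) = label h n a a' (x 0)) :
    x 0 = x 1 := by
  have := eq_of_topDigits_eq_of_normSq_eq hβ hsum hb (by positivity) (blockSize_pos n)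
    (x := fun i => x i + n ^ 3) (fun i => (shift_bounds (h := h) (hx i)).1)
    (fun i => (shift_bounds (hx i)).2)
    (by simp only [mul_add, Finset.sum_add_distrib, ← Finset.sum_mul, hsum, hx0]; ring)
    (fun i => (label_eq h n (hl i)).1) (fun i => (label_eq h n (hl i)).2.1)
  simpa using this

theorem exists_label_injective {x : Fin 3 → ℤ} (hx : ∀ i, |x i| ≤ (n : ℤ) ^ 3)
    (hinj : Function.Injective x) : ∃ a a' : ℤ, 0 ≤ a ∧ a < labelBase h n ∧ 0 ≤ a' ∧
      a' < labelBase h n ∧ Function.Injective fun i => label h n a a' (x i) := by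
  obtain ⟨a, a', ha, ha', hi⟩ := exists_twoDigits_injective (base_pos h n)
    (x := fun i => x i + n ^ 3) (fun i => (shift_bounds (h := h) (hx i)).1)
    (fun i => (shift_bounds (hx i)).2) (fun i j hij => hinj (by simpa using hij))
  have hlt : ∀ u : ℕ, u < 4 * sqrtLog n → (u : ℤ) < labelBase h n := by
    intro u hu
    have h1 : (u : ℤ) < 4 * sqrtLog n := by exact_mod_cast hu
    exact h1.trans_le ((four_mul_sqrtLog_le n).trans (blockSize_pow_mono n (by omega)))
  exact ⟨a, a', by positivity, hlt a ha, by positivity, hlt a' ha',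
    fun i j hij => hi (label_eq h n hij).2.2⟩

end

/-! ### Codes: two positions and three labels in one number -/

/-- The codes that the iterations of the main loop run through. -/
structure Code where
  a : ℤ
  a' : ℤ
  l : Fin 3 → ℤ

def Code.decode (M c : ℤ) : Code where
  a := c % M
  a' := c / M % M
  l := ![c / M / M % M ^ 3, c / M / M / M ^ 3 % M ^ 3, c / M / M / M ^ 3 / M ^ 3 % M ^ 3]

/-- Mixed radix; the exponent is `11 = 1 + 1 + 3 * 3`, for two positions below `M` and three labels
below `M ^ 3`. -/
theorem Code.exists_decode_eq {M : ℤ} {C : Code} (ha : 0 ≤ C.a) (ha1 : C.a < M) (ha' : 0 ≤ C.a')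
    (ha1' : C.a' < M) (hl : ∀ k, 0 ≤ C.l k ∧ C.l k < M ^ 3) :
    ∃ c : ℕ, (c : ℤ) < M ^ 11 ∧ Code.decode M c = C := by
  have hM : 0 < M := by linarith
  have hM3 : 0 < M ^ 3 := by positivity
  have step : ∀ {N u v V : ℤ}, 0 < N → 0 ≤ u → u < N → 0 ≤ v → v < V →
      0 ≤ u + N * v ∧ u + N * v < N * V ∧ (u + N * v) % N = u ∧ (u + N * v) / N = v := by
    intro N u v V hN hu huN hv hvV
    refine ⟨by positivity, ?_, ?_, ?_⟩
    · have : N * v ≤ N * (V - 1) := by gcongr; linarith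
      linarith
    · rw [Int.add_mul_emod_self_left, Int.emod_eq_of_lt hu huN]
    · rw [Int.add_mul_ediv_left _ _ hN.ne', Int.ediv_eq_zero_of_lt hu huN, zero_add]
  obtain ⟨p1, p2, p3, p4⟩ := step hM3 (hl 1).1 (hl 1).2 (hl 2).1 (hl 2).2
  obtain ⟨q1, q2, q3, q4⟩ := step hM3 (hl 0).1 (hl 0).2 p1 p2
  obtain ⟨r1, r2, r3, r4⟩ := step hM ha' ha1' q1 q2
  obtain ⟨s1, s2, s3, s4⟩ := step hM ha ha1 r1 r2
  obtain ⟨c, hc⟩ := Int.eq_ofNat_of_zero_le s1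
  refine ⟨c, ?_, ?_⟩
  · rw [← hc]
    calc _ < _ := s2
      _ = _ := by ring
  · obtain ⟨a, a', l⟩ := C
    simp only at *
    rw [← hc]
    simp only [decode, s3, s4, r3, r4, q3, q4, p3, p4, Code.mk.injEq, true_and]
    funext k
    have := Int.emod_eq_of_lt (hl 2).1 (hl 2).2
    fin_cases k <;> simp [this]

/-! ### A grid side of order `√n` -/

theorem exists_lt_two_pow_pow_two (n : ℕ) : ∃ i, n < 2 ^ i * 2 ^ i :=
  ⟨n, Nat.lt_two_pow_self.trans_le (Nat.le_mul_of_pos_right _ (by positivity))⟩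

/-- The least power of two whose square exceeds `n` is `2 ^ rootLog n`. -/
def rootLog (n : ℕ) : ℕ := Nat.find (exists_lt_two_pow_pow_two n)

theorem lt_root_sq (n : ℕ) : n + 1 ≤ 2 ^ rootLog n * 2 ^ rootLog n :=
  Nat.find_spec (exists_lt_two_pow_pow_two n)

theorem root_sq_le (n : ℕ) : 2 ^ rootLog n * 2 ^ rootLog n ≤ 4 * (n + 1) := by
  unfold rootLog
  rcases hi : Nat.find (exists_lt_two_pow_pow_two n) with _ | i
  · simp; omega
  · have := Nat.find_min (exists_lt_two_pow_pow_two n) (m := i) (by omega)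
    rw [pow_succ]
    nlinarith

namespace WordRAM

/-! ### The program -/

instance : Add Expr := ⟨.bin .add⟩
instance : Sub Expr := ⟨.bin .sub⟩
instance : Mul Expr := ⟨.bin .mul⟩
instance : Div Expr := ⟨.bin .div⟩
instance : Mod Expr := ⟨.bin .mod⟩
instance : Zero Expr := ⟨.const 0⟩
instance : One Expr := ⟨.const 1⟩

/-- A power with a fixed exponent. -/
def Expr.power (e : Expr) : ℕ → Expr
  | 0 => 1
  | i + 1 => e.power i * e

section

variable (s : State) (e₁ e₂ : Expr)

@[simp] theorem Expr.exact_add : (e₁ + e₂).exact s = e₁.exact s + e₂.exact s := rfl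
@[simp] theorem Expr.exact_sub : (e₁ - e₂).exact s = e₁.exact s - e₂.exact s := rfl
@[simp] theorem Expr.exact_mul : (e₁ * e₂).exact s = e₁.exact s * e₂.exact s := rfl
@[simp] theorem Expr.exact_div : (e₁ / e₂).exact s = e₁.exact s / e₂.exact s := rfl
@[simp] theorem Expr.exact_mod : (e₁ % e₂).exact s = e₁.exact s % e₂.exact s := rfl
@[simp] theorem Expr.exact_zero : (0 : Expr).exact s = 0 := rfl
@[simp] theorem Expr.exact_one : (1 : Expr).exact s = 1 := rfl
@[simp] theorem Expr.exact_const (z : ℤ) : (Expr.const z).exact s = z := rfl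
@[simp] theorem Expr.exact_var (x : ℕ) : (Expr.var x).exact s = s.reg x := rfl
@[simp] theorem Expr.exact_read (a : ℕ) : (Expr.read a e₁).exact s = s.mem a (e₁.exact s) := rfl
@[simp] theorem Expr.exact_lt : (Expr.bin .lt e₁ e₂).exact s =
    if e₁.exact s < e₂.exact s then 1 else 0 := rfl
@[simp] theorem Expr.exact_eq : (Expr.bin .eq e₁ e₂).exact s =
    if e₁.exact s = e₂.exact s then 1 else 0 := rfl

@[simp] theorem Expr.exact_power (i : ℕ) : (e₁.power i).exact s = e₁.exact s ^ i := by
  induction i with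
  | zero => rw [pow_zero]; rfl
  | succ i ih => rw [pow_succ, ← ih]; rfl

@[simp] theorem State.reg_setReg (x y : ℕ) (v : ℤ) :
    (s.setReg x v).reg y = if y = x then v else s.reg y := Function.update_apply ..

@[simp] theorem State.mem_setReg (x : ℕ) (v : ℤ) : (s.setReg x v).mem = s.mem := rfl

@[simp] theorem State.reg_setMem (a : ℕ) (i v : ℤ) : (s.setMem a i v).reg = s.reg := rfl

theorem State.mem_setMem (a b : ℕ) (i j v : ℤ) :
    (s.setMem a i v).mem b j = if b = a ∧ j = i then v else s.mem b j := by
  simp only [State.setMem, Function.update_apply]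
  by_cases h : b = a
  · subst h; simp [Function.update_apply]
  · simp [h]

end

theorem Ter.assign_eq {S : Setting} {s : State} {T : ℕ} {Q : State → Prop} {x : ℕ} {e : Expr}
    (v : ℤ) (hT : 1 ≤ T) (hv : e.exact s = v) (hb : |v| ≤ radix S.n ^ S.d)
    (hQ : Q (s.setReg x v)) : Ter S (.assign x e) s T 0 Q := by
  subst hv; exact Ter.assign hT hb hQ

theorem Ter.write_eq {S : Setting} {s : State} {T : ℕ} {Q : State → Prop} {a : ℕ} {e₁ e₂ : Expr}
    (i v : ℤ) (hT : 1 ≤ T) (hi : e₁.exact s = i) (hv : e₂.exact s = v)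
    (hb : |v| ≤ radix S.n ^ S.d) (hQ : Q (s.setMem a i v)) : Ter S (.write a e₁ e₂) s T 0 Q := by
  subst hi hv; exact Ter.write hT hb hQ

infixr:60 " ;; " => Prog.seq

/-- Registers: `0` the input size, `1` the block size, `2` the number `sqrtLog n`, `3` auxiliary,
`4` the grid side, `5` the query size, `6` the label base, `7` the scale, `8` the code, `9` the
result. -/
def setupBlock : Prog :=
  .assign 1 (.const 2) ;; .assign 2 1 ;; .assign 3 (.const 2) ;;
    .loop (.bin .lt (.var 3) (.var 0 + 1))
      (.assign 3 (.var 3 * .var 1 * .var 1 * .const 2) ;; .assign 1 (.var 1 * .const 2) ;;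
        .assign 2 (.var 2 + 1))

def setupRoot : Prog :=
  .assign 4 1 ;; .loop (.bin .lt (.var 4 * .var 4) (.var 0 + 1)) (.assign 4 (.var 4 * .const 2))

/-- Computes in register `36` the label of the entry of the array `src` listed in register `20`; the
registers `10` and `11` hold the positions of the two digits. -/
def labelProg (h src : ℕ) : Prog :=
  .assign 30 (.read src (.var 20) + .var 0 * .var 0 * .var 0) ;;
  .assign 32 0 ;; .assign 33 0 ;; .assign 34 0 ;; .assign 35 0 ;;
  .loop (.bin .lt (.var 35) (.const 4 * .var 2))
    (.assign 31 (.var 30 % (.const (2 ^ h) * .var 1)) ;;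
     .assign 30 (.var 30 / (.const (2 ^ h) * .var 1)) ;;
     .assign 32 (.var 32 * .const (2 ^ h) + .var 31 / .var 1) ;;
     .assign 33 (.var 33 + (.var 31 % .var 1) * (.var 31 % .var 1)) ;;
     .assign 34 (.var 34 + (.bin .eq (.var 35) (.var 10) * .var 31 +
        .bin .eq (.var 35) (.var 11) * (.var 31 * (.const (2 ^ h) * .var 1)))) ;;
     .assign 35 (.var 35 + 1)) ;;
  .assign 36 (.var 32 + .var 6 * .var 33 + .var 6 * .var 6 * .var 34)

/-- The number of the array for the `k`-th set, if the arrays start at `base`. -/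
def arrayOf : Partity → ℕ → Fin 3 → ℕ
  | .one, base, _ => base
  | .three, base, k => base + k

/-- The `k`-th images are listed from cell `offsetCoeff q k * n` on. -/
def offsetCoeff : Partity → Fin 3 → ℕ
  | .one, k => k
  | .three, _ => 0

/-- The class of dummies used in the `k`-th array. -/
def padClass : Partity → Fin 3 → Fin 3 ⊕ Fin 3
  | .one, _ => .inr 0
  | .three, k => .inr k

variable {α β : Fin 3 → ℤ} {s₀ t₀ : ℤ} (G : Gadget α β s₀ t₀)

def paraboloidExpr (h : ℕ) : Expr :=
  .var 20 % .var 4 + .const (2 ^ h) * .var 4 * (.var 20 / .var 4) +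
    .const (2 ^ h) * .var 4 * (.const (2 ^ h) * .var 4) *
      (.var 20 % .var 4 * (.var 20 % .var 4) + .var 20 / .var 4 * (.var 20 / .var 4))

def padWrite (q : Partity) (k : Fin 3) : Prog :=
  .write (arrayOf q 10 k) (.var 20)
    (.var 7 * .const (G.w (padClass q k)) + .const G.Γ * paraboloidExpr G.h)

/-- Every cell of the query gets a dummy first; images of selected elements overwrite some of them
later. So the size of the query does not depend on how many elements are selected. -/
def padProg (q : Partity) : Prog :=
  .assign 20 0 ;; .loop (.bin .lt (.var 20) (.var 5))
    (padWrite G q 0 ;; padWrite G q 1 ;; padWrite G q 2 ;; .assign 20 (.var 20 + 1))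

/-- Writes the images of the elements of the `k`-th set with the right label. -/
def fillProg (p q : Partity) (k : Fin 3) : Prog :=
  .assign 20 0 ;; .loop (.bin .lt (.var 20) (.var 0))
    (labelProg G.h (arrayOf p 0 k) ;;
     .branch (.var 15 * .bin .eq (.var 36) (.var (12 + k)))
      (.write (arrayOf q 10 k) (.const (offsetCoeff q k) * .var 0 + .var 20)
        (.var 7 * .const (G.w (.inl k)) +
          (.const (G.c k) + .const (G.γ k) * .read (arrayOf p 0 k) (.var 20)))) .skip ;;
     .assign 20 (.var 20 + 1))

/-- Whether a triple of labels may be looked at: for one set, the labels have to be distinct. -/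
def flagExpr : Partity → Expr
  | .one => (1 - .bin .eq (.var 12) (.var 13)) * (1 - .bin .eq (.var 12) (.var 14)) *
      (1 - .bin .eq (.var 13) (.var 14))
  | .three => 1

def decodeProg (p : Partity) : Prog :=
  .assign 10 (.var 8 % .var 6) ;; .assign 11 (.var 8 / .var 6 % .var 6) ;;
  .assign 12 (.var 8 / .var 6 / .var 6 % Expr.power (.var 6) 3) ;;
  .assign 13 (.var 8 / .var 6 / .var 6 / Expr.power (.var 6) 3 % Expr.power (.var 6) 3) ;;
  .assign 14 (.var 8 / .var 6 / .var 6 / Expr.power (.var 6) 3 / Expr.power (.var 6) 3 %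
    Expr.power (.var 6) 3) ;;
  .assign 15 (flagExpr p)

/-- The comparison `0 < reg 9 + reg 16` accumulates the disjunction of the oracle's answers in
register `9`. -/
def bodyProg (p q : Partity) : Prog :=
  decodeProg p ;; padProg G q ;; fillProg G p q 0 ;; fillProg G p q 1 ;; fillProg G p q 2 ;;
    (.query 16 (.var 5) 10 ;; .assign 9 (.bin .lt 0 (.var 9 + .var 16)) ;;
      .assign 8 (.var 8 + 1))

def mainProg (p q : Partity) : Prog :=
  setupBlock ;; setupRoot ;;
  .assign 4 (.const G.μ * .var 4) ;; .assign 5 (.var 4 * .var 4) ;;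
  .assign 6 (Expr.power (.var 1) (4 * G.h + 6)) ;;
  .assign 7 (.const G.η * ((.var 0 + 1) * (.var 5 * .var 5))) ;;
  .assign 8 0 ;; .assign 9 0 ;;
  (.loop (.bin .lt (.var 8) (Expr.power (.var 6) 11)) (bodyProg G p q) ;; .assign 0 (.var 9))

end WordRAM

/-! ### Sizes of the queries and of all words -/

namespace Gadget

variable {α β : Fin 3 → ℤ} {s t : ℤ} (G : Gadget α β s t) (n : ℕ)

/-- The side of the grid of dummies. -/
def side : ℕ := G.μ * 2 ^ rootLog n

/-- The size of the oracle calls. -/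
def querySize : ℕ := G.side n * G.side n

theorem side_pos : 0 < G.side n :=
  Nat.mul_pos (by have := G.three_le_μ; omega) (by positivity)

theorem mul_succ_le_querySize : G.μ * (n + 1) ≤ G.querySize n := by
  have h1 := lt_root_sq n
  have h2 := G.three_le_μ
  unfold querySize side
  calc G.μ * (n + 1) ≤ G.μ * (2 ^ rootLog n * 2 ^ rootLog n) := by gcongr
    _ ≤ G.μ * G.μ * (2 ^ rootLog n * 2 ^ rootLog n) := by gcongr; nlinarith
    _ = _ := by ring

theorem querySize_le : G.querySize n ≤ 4 * G.μ ^ 2 * (n + 1) := by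
  have h1 := root_sq_le n
  unfold querySize side
  calc G.μ * 2 ^ rootLog n * (G.μ * 2 ^ rootLog n) = G.μ ^ 2 * (2 ^ rootLog n * 2 ^ rootLog n) := by
        ring
    _ ≤ G.μ ^ 2 * (4 * (n + 1)) := by gcongr
    _ = _ := by ring

/-- All words of a run are at most `radix n ^ d` in absolute value. -/
structure Fits (d : ℕ) : Prop where
  querySize_pow : (G.querySize n : ℤ) ^ 3 ≤ WordRAM.radix n ^ d
  labelBase_pow : labelBase G.h n ^ 11 ≤ WordRAM.radix n ^ d
  scale_le : G.scale n (G.side n) ≤ WordRAM.radix n ^ d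
  two_pow_le : (2 : ℤ) ^ sqrtLog n ^ 2 ≤ WordRAM.radix n ^ d

/-- A number of words per integer that suffices for all runs. -/
def degree : ℕ := 22 * (4 * G.h + 6) + 12 * G.μ + 2 * G.η.natAbs + 20

/-- Everything is polynomial in `n`, with constants depending on the gadget only; these are turned
into exponents by `a ≤ radix n ^ a`. -/
theorem fits : G.Fits n G.degree := by
  have hX := WordRAM.two_le_radix n
  have hn := WordRAM.succ_le_radix n
  have hX1 : (1 : ℤ) ≤ WordRAM.radix n := by linarith
  have hp : blockSize n ≤ WordRAM.radix n ^ 2 := by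
    have := blockSize_le n
    nlinarith
  have hp0 := blockSize_pos n
  have hμ := WordRAM.nat_le_radix_pow n G.μ
  have hm : (G.querySize n : ℤ) ≤ WordRAM.radix n ^ (2 * G.μ + 3) := by
    have : (G.querySize n : ℤ) ≤ 4 * G.μ ^ 2 * (n + 1) := by exact_mod_cast G.querySize_le n
    calc (G.querySize n : ℤ) ≤ 2 * 2 * G.μ ^ 2 * (n + 1) := by linarith
      _ ≤ WordRAM.radix n * WordRAM.radix n * (WordRAM.radix n ^ G.μ) ^ 2 * WordRAM.radix n := by
          gcongr
      _ = _ := by ring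
  have mono : ∀ {a b : ℕ}, a ≤ b → WordRAM.radix n ^ a ≤ WordRAM.radix n ^ b :=
    fun h => WordRAM.radix_pow_mono n h
  constructor
  · calc (G.querySize n : ℤ) ^ 3 ≤ (WordRAM.radix n ^ (2 * G.μ + 3)) ^ 3 := by gcongr
      _ = WordRAM.radix n ^ (6 * G.μ + 9) := by ring
      _ ≤ _ := mono (by unfold degree; omega)
  · calc labelBase G.h n ^ 11 = blockSize n ^ (11 * (4 * G.h + 6)) := by unfold labelBase; ring
      _ ≤ (WordRAM.radix n ^ 2) ^ (11 * (4 * G.h + 6)) := by gcongr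
      _ = WordRAM.radix n ^ (22 * (4 * G.h + 6)) := by ring
      _ ≤ _ := mono (by unfold degree; omega)
  · have hη : G.η ≤ WordRAM.radix n ^ G.η.natAbs := by
      have := WordRAM.nat_le_radix_pow n G.η.natAbs
      have := Int.le_natAbs (a := G.η)
      linarith
    have := G.η_pos
    have e : G.scale n (G.side n) = G.η * ((n + 1) * (G.querySize n : ℤ) ^ 2) := by
      unfold scale querySize; push_cast; rfl
    rw [e]
    calc G.η * ((n + 1) * (G.querySize n : ℤ) ^ 2) ≤ WordRAM.radix n ^ G.η.natAbs *
          (WordRAM.radix n * (WordRAM.radix n ^ (2 * G.μ + 3)) ^ 2) := by gcongr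
      _ = WordRAM.radix n ^ (G.η.natAbs + 4 * G.μ + 7) := by ring
      _ ≤ _ := mono (by unfold degree; omega)
  · have h1 : (2 : ℤ) ^ (sqrtLog n - 1) ^ 2 ≤ n + 1 := by exact_mod_cast two_pow_sq_le n
    obtain ⟨j, hj⟩ := Nat.exists_eq_add_of_le' (one_le_sqrtLog n)
    have hjp : (2 : ℤ) ^ j ≤ blockSize n :=
      pow_le_pow_right₀ (by norm_num) (by omega)
    rw [hj, Nat.add_sub_cancel] at h1
    rw [hj]
    calc (2 : ℤ) ^ (j + 1) ^ 2 = 2 ^ j ^ 2 * (2 ^ j) ^ 2 * 2 := by ring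
      _ ≤ WordRAM.radix n * (WordRAM.radix n ^ 2) ^ 2 * WordRAM.radix n := by
          gcongr
          · linarith
          · linarith
      _ = WordRAM.radix n ^ 6 := by ring
      _ ≤ _ := mono (by unfold degree; omega)

end Gadget

/-! ### Computing a label -/

namespace WordRAM

variable {α β : Fin 3 → ℤ} {s₀ t₀ : ℤ} {G : Gadget α β s₀ t₀} {S : Setting} {s s' : State}

/-- The setting of a run on an input of size `n`. -/
def setting (B : SetProblem) (κ : ℕ) (G : Gadget α β s₀ t₀) (n : ℕ) : Setting :=
  ⟨B, κ, n, G.degree, G.querySize n⟩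

/-- The registers set up before the main loop have the right values. -/
structure Ready (G : Gadget α β s₀ t₀) (n : ℕ) (s : State) : Prop where
  size : s.reg 0 = n
  block : s.reg 1 = blockSize n
  log : s.reg 2 = sqrtLog n
  side : s.reg 4 = G.side n
  query : s.reg 5 = G.querySize n
  base : s.reg 6 = labelBase G.h n
  scale : s.reg 7 = G.scale n (G.side n)

theorem Ready.congr {n : ℕ} (h : Ready G n s) (hs : ∀ x < 8, s'.reg x = s.reg x) : Ready G n s' :=
  ⟨by rw [hs 0 (by omega), h.size], by rw [hs 1 (by omega), h.block], by rw [hs 2 (by omega), h.log],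
    by rw [hs 4 (by omega), h.side], by rw [hs 5 (by omega), h.query],
    by rw [hs 6 (by omega), h.base], by rw [hs 7 (by omega), h.scale]⟩

section

variable (G) (n : ℕ)

theorem one_le_labelBase : 1 ≤ labelBase G.h n := labelBase_pos G.h n

theorem labelBase_pow_le {i : ℕ} (hi : i ≤ 11) : labelBase G.h n ^ i ≤ radix n ^ G.degree :=
  (pow_le_pow_right₀ (one_le_labelBase G n) hi).trans (G.fits n).labelBase_pow

theorem labelBase_le : labelBase G.h n ≤ radix n ^ G.degree := by
  simpa using labelBase_pow_le G n (i := 1) (by omega)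

theorem base_le_labelBase : 2 ^ G.h * blockSize n ≤ labelBase G.h n := by
  have := base_sq_le_labelBase G.h n
  have := base_pos G.h n
  nlinarith

theorem three_mul_succ_le : 3 * ((n : ℤ) + 1) ≤ G.querySize n := by
  have h1 := G.mul_succ_le_querySize n
  have h2 := Nat.mul_le_mul_right (n + 1) G.three_le_μ
  exact_mod_cast h2.trans h1

theorem querySize_le_degree : (G.querySize n : ℤ) ≤ radix n ^ G.degree := by
  have := three_mul_succ_le G n
  exact (le_self_pow₀ (by linarith) (by norm_num)).trans (G.fits n).querySize_pow

theorem two_mul_cube_le : 2 * (n : ℤ) ^ 3 ≤ radix n ^ G.degree := by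
  refine le_trans ?_ (G.fits n).querySize_pow
  have := three_mul_succ_le G n
  calc 2 * (n : ℤ) ^ 3 ≤ (3 * (n + 1)) ^ 3 := by
        have : (0 : ℤ) ≤ n := by positivity
        nlinarith [pow_nonneg this 3, pow_nonneg this 2]
    _ ≤ _ := by gcongr

end

/-- The loop strips off the digits from the lowest one up. After `t` rounds the registers hold
`topDigits`, `normSq` and `twoDigits` for the first `t` digits. -/
theorem ter_label {B : SetProblem} {κ n : ℕ} {src : ℕ} (hs : Ready G n s)
    (hx : |s.mem src (s.reg 20)| ≤ (n : ℤ) ^ 3) :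
    Ter (setting B κ G n) (labelProg G.h src) s (4 * sqrtLog n + 1) 0 fun s' =>
      s'.mem = s.mem ∧ (∀ x < 30, s'.reg x = s.reg x) ∧
        s'.reg 36 = label G.h n (s.reg 10) (s.reg 11) (s.mem src (s.reg 20)) := by
  have hT : 1 ≤ 4 * sqrtLog n + 1 := by omega
  set x := s.mem src (s.reg 20) with hxdef
  obtain ⟨hsh, -⟩ := shift_bounds (h := G.h) hx
  have hxle : x + (n : ℤ) ^ 3 ≤ radix n ^ G.degree := by
    have := (abs_le.1 hx).2
    have := two_mul_cube_le G n
    linarith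
  have hD := base_pos G.h n
  have hp := blockSize_pos n
  have hM := labelBase_le G n
  have hMp := labelBase_pos G.h n
  have hY : (1 : ℤ) ≤ radix n ^ G.degree := one_le_radix_pow _ _
  have hbd : ∀ {z : ℤ}, 0 ≤ z → z ≤ labelBase G.h n → |z| ≤ radix n ^ G.degree := fun h0 h1 => by
    rw [abs_of_nonneg h0]; linarith
  have hz : |(0 : ℤ)| ≤ radix n ^ G.degree := hbd le_rfl hMp.le
  unfold labelProg
  refine Ter.seq_of_zero (Ter.assign_eq (x + (n : ℤ) ^ 3) hT ?_ ?_ ?_)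
  · simp [hs.size, ← hxdef]; ring
  · rwa [abs_of_nonneg hsh]
  refine Ter.seq_of_zero (Ter.assign_eq 0 hT (by simp) hz ?_)
  refine Ter.seq_of_zero (Ter.assign_eq 0 hT (by simp) hz ?_)
  refine Ter.seq_of_zero (Ter.assign_eq 0 hT (by simp) hz ?_)
  refine Ter.seq_of_zero (Ter.assign_eq 0 hT (by simp) hz ?_)
  have hloop := Ter.loop (S := setting B κ G n) (e := .bin .lt (.var 35) (.const 4 * .var 2))
    (c := .assign 31 (.var 30 % (.const (2 ^ G.h) * .var 1)) ;;
     .assign 30 (.var 30 / (.const (2 ^ G.h) * .var 1)) ;;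
     .assign 32 (.var 32 * .const (2 ^ G.h) + .var 31 / .var 1) ;;
     .assign 33 (.var 33 + (.var 31 % .var 1) * (.var 31 % .var 1)) ;;
     .assign 34 (.var 34 + (.bin .eq (.var 35) (.var 10) * .var 31 +
        .bin .eq (.var 35) (.var 11) * (.var 31 * (.const (2 ^ G.h) * .var 1)))) ;;
     .assign 35 (.var 35 + 1))
    (s := ((((s.setReg 30 (x + (n : ℤ) ^ 3)).setReg 32 0).setReg 33 0).setReg 34 0).setReg 35 0)
    (T := 1) (q := 0)
    (fun t s' => s'.mem = s.mem ∧ (∀ x < 30, s'.reg x = s.reg x) ∧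
      s'.reg 30 = (x + (n : ℤ) ^ 3) / (2 ^ G.h * blockSize n) ^ t ∧
      s'.reg 32 = topDigits (2 ^ G.h) (blockSize n) (x + n ^ 3) t ∧
      s'.reg 33 = normSq (2 ^ G.h) (blockSize n) (x + n ^ 3) t ∧
      s'.reg 34 = twoDigits (2 ^ G.h * blockSize n) (x + n ^ 3) (s.reg 10) (s.reg 11) t ∧
      s'.reg 35 = t) (4 * sqrtLog n) le_rfl ?init ?step ?fin
  case init =>
    refine ⟨rfl, fun y hy => ?_, ?_, ?_, ?_, ?_, ?_⟩
    · simp only [State.reg_setReg]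
      rw [if_neg (by omega), if_neg (by omega), if_neg (by omega), if_neg (by omega),
        if_neg (by omega)]
    all_goals simp [topDigits, normSq, twoDigits]
  case fin =>
    rintro s' ⟨-, h1, -, -, -, -, h2⟩
    simp [h2, h1, hs.log]
  case step =>
    rintro t ht s' ⟨hm, hr, h30, h32, h33, h34, h35⟩
    have r1 : s'.reg 1 = blockSize n := by rw [hr 1 (by omega), hs.block]
    have r10 : s'.reg 10 = s.reg 10 := hr 10 (by omega)
    have r11 : s'.reg 11 = s.reg 11 := hr 11 (by omega)
    refine ⟨?_, ?_⟩
    · simp [h35, hr, hs.log]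
      exact_mod_cast ht
    generalize hy : x + (n : ℤ) ^ 3 = y at *
    refine Ter.seq_of_zero (Ter.assign_eq (digit (2 ^ G.h * blockSize n) y t) le_rfl
      (by simp [r1, h30, digit]) (hbd (digit_nonneg hD _ _)
        ((digit_lt hD _ _).le.trans (base_le_labelBase G n))) ?_)
    refine Ter.seq_of_zero (Ter.assign_eq (y / (2 ^ G.h * blockSize n) ^ (t + 1)) le_rfl
      (by simp [r1, h30, div_pow_succ hD]) ?_ ?_)
    · have h1 : 0 ≤ y / (2 ^ G.h * blockSize n) ^ (t + 1) := Int.ediv_nonneg hsh (by positivity)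
      have h2 : y / (2 ^ G.h * blockSize n) ^ (t + 1) ≤ y := Int.ediv_le_self _ hsh
      rw [abs_of_nonneg h1]
      exact h2.trans hxle
    refine Ter.seq_of_zero (Ter.assign_eq (topDigits (2 ^ G.h) (blockSize n) y (t + 1)) le_rfl
      (by simp [r1, h32, topDigits]) (hbd (topDigits_nonneg (by positivity) hp _ _)
        (topDigits_lt_labelBase G.h n y (by omega)).le) ?_)
    refine Ter.seq_of_zero (Ter.assign_eq (normSq (2 ^ G.h) (blockSize n) y (t + 1)) le_rfl
      (by simp [r1, h33, normSq, Finset.sum_range_succ, sq]) (hbd (normSq_nonneg G.h n _ _)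
        (normSq_lt_labelBase G.h n (by omega)).le) ?_)
    refine Ter.seq_of_zero (Ter.assign_eq
      (twoDigits (2 ^ G.h * blockSize n) y (s.reg 10) (s.reg 11) (t + 1)) le_rfl
      (by simp [r1, r10, r11, h34, h35, twoDigits, Finset.sum_range_succ])
      (hbd (twoDigits_bounds hD _ _ _ _).1
        ((twoDigits_bounds hD _ _ _ _).2.le.trans (base_sq_le_labelBase G.h n))) ?_)
    refine Ter.assign_eq ((t : ℤ) + 1) le_rfl (by simp [h35]) (hbd (by positivity) ?_) ?_
    · have h1 : (t : ℤ) + 1 ≤ 4 * sqrtLog n := by exact_mod_cast ht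
      exact h1.trans ((four_mul_sqrtLog_le n).trans (blockSize_pow_mono n (by omega)))
    refine ⟨hm, fun y hy => ?_, ?_, ?_, ?_, ?_, ?_⟩
    · simp only [State.reg_setReg]
      rw [if_neg (by omega), if_neg (by omega), if_neg (by omega), if_neg (by omega),
        if_neg (by omega), if_neg (by omega), hr y hy]
    all_goals simp
  refine Ter.seq_of_zero (Ter.mono (T := (4 * sqrtLog n + 1) * 1) hloop (by omega) ?_)
  rintro s' ⟨hm, hr, h30, h32, h33, h34, h35⟩
  have r6 : s'.reg 6 = labelBase G.h n := by rw [hr 6 (by omega), hs.base]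
  refine Ter.assign_eq (label G.h n (s.reg 10) (s.reg 11) x) hT ?_ ?_ ?_
  · simp only [Expr.exact_add, Expr.exact_mul, Expr.exact_var, r6, h32, h33, h34, label]; ring
  · have := label_bounds G.h n (s.reg 10) (s.reg 11) x
    rw [abs_of_nonneg this.1]
    exact this.2.le.trans (labelBase_pow_le G n (by omega))
  · refine ⟨hm, fun y hy => ?_, by simp⟩
    simp only [State.reg_setReg]
    rw [if_neg (by omega), hr y hy]

/-! ### Correctness of one oracle call -/

/-- Treats both partities uniformly through an index `k : Fin 3`; in the 1-partite case the three
arrays are the same one. -/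
theorem isInstance_ldt_iff (q : Partity) (β : Fin 3 → ℤ) (t : ℤ) (m base : ℕ) (f : ℕ → Finset ℤ) :
    ((ldt q β t).IsInstance m fun j => f (base + j)) ↔ ∀ k, (f (arrayOf q base k)).card = m ∧
      f (arrayOf q base k) ⊆ Finset.Icc (-(m : ℤ) ^ 3) ((m : ℤ) ^ 3) := by
  cases q with
  | one =>
    constructor
    · intro h _; exact h (0 : Fin 1)
    · intro h j
      obtain rfl : j = (0 : Fin 1) := Subsingleton.elim (α := Fin 1) j 0
      exact h 0
  | three => exact Iff.rfl

theorem yes_ldt_iff (q : Partity) (β : Fin 3 → ℤ) (t : ℤ) (base : ℕ) (f : ℕ → Finset ℤ) :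
    ((ldt q β t).yes fun j => f (base + j)) ↔ ∃ y : Fin 3 → ℤ,
      (q = .one → Function.Injective y) ∧ (∀ i, y i ∈ f (arrayOf q base i)) ∧
        ∑ i, β i * y i = t := by
  cases q with
  | one =>
    constructor
    · rintro ⟨y, h1, h2, h3⟩; exact ⟨y, fun _ => h1, h2, h3⟩
    · rintro ⟨y, h1, h2, h3⟩; exact ⟨y, h1 rfl, h2, h3⟩
  | three =>
    constructor
    · rintro ⟨y, h2, h3⟩; exact ⟨y, (fun h => nomatch h), h2, h3⟩
    · rintro ⟨y, -, h2, h3⟩; exact ⟨y, h2, h3⟩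

theorem arrayOf_le (q : Partity) (base : ℕ) (k : Fin 3) : arrayOf q base k ≤ base + 2 := by
  cases q <;> simp only [arrayOf] <;> omega

theorem le_arrayOf (q : Partity) (base : ℕ) (k : Fin 3) : base ≤ arrayOf q base k := by
  cases q <;> simp only [arrayOf] <;> omega

/-- The places reserved for the images of elements do not overlap. -/
theorem place_injective {q : Partity} {n i i' : ℕ} {k k' : Fin 3} (hi : i < n) (hi' : i' < n)
    (hk : arrayOf q 10 k = arrayOf q 10 k')
    (h : offsetCoeff q k * n + i = offsetCoeff q k' * n + i') : k = k' ∧ i = i' := by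
  cases q with
  | one =>
    simp only [offsetCoeff] at h
    have hkk : k = k' := by
      rcases lt_trichotomy k k' with hlt | h | hlt
      · have : ((k : ℕ) + 1) * n ≤ k' * n := Nat.mul_le_mul_right _ hlt
        rw [add_mul] at this; omega
      · exact h
      · have : ((k' : ℕ) + 1) * n ≤ k * n := Nat.mul_le_mul_right _ hlt
        rw [add_mul] at this; omega
    subst hkk
    exact ⟨rfl, by omega⟩
  | three =>
    simp only [offsetCoeff, arrayOf] at h hk
    exact ⟨Fin.ext (by omega), by omega⟩

theorem padClass_eq {q : Partity} {u v : Fin 3} (h : arrayOf q 10 u = arrayOf q 10 v) :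
    padClass q u = padClass q v := by
  cases q with
  | one => rfl
  | three =>
    simp only [arrayOf] at h
    have : u = v := Fin.ext (by omega)
    rw [this]

theorem admissible_padClass {q : Partity} {u : Fin 3} {n : ℕ} {R z : ℤ} (h0 : 0 ≤ z)
    (h1 : z < R * R) : Gadget.Admissible n R (padClass q u) z := by
  cases q <;> exact ⟨h0, h1⟩

theorem padClass_eq_inr (q : Partity) (u : Fin 3) : ∃ v, padClass q u = .inr v := by
  cases q <;> exact ⟨_, rfl⟩

/-- The labels prescribed by the code can belong to a solution. -/
def _root_.Code.Allowed (p : Partity) (C : Code) : Prop :=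
  p = .one → C.l 0 ≠ C.l 1 ∧ C.l 0 ≠ C.l 2 ∧ C.l 1 ≠ C.l 2

/-- The elements of the `k`-th set that the code selects. -/
def _root_.Code.Selects (p : Partity) (h n : ℕ) (C : Code) (k : Fin 3) (x : ℤ) : Prop :=
  C.Allowed p ∧ label h n C.a C.a' x = C.l k

variable {α β : Fin 3 → ℤ} {s t : ℤ} (G : Gadget α β s t)

/-- The first cells of the arrays for a query hold the images of the selected elements of the sets
listed by `A`, and dummies. -/
structure IsQuery (q : Partity) (n : ℕ) (A : Fin 3 → ℕ → ℤ) (P : Fin 3 → ℤ → Prop)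
    (f : ℕ → ℤ → ℤ) : Prop where
  image : ∀ k, ∀ i < n, P k (A k i) →
    f (arrayOf q 10 k) (offsetCoeff q k * n + i) = G.value n (G.side n) (.inl k) (A k i)
  cell : ∀ u, ∀ j : ℕ, j < G.querySize n →
    f (arrayOf q 10 u) j = G.value n (G.side n) (padClass q u) j ∨
    ∃ k, ∃ i < n, P k (A k i) ∧ arrayOf q 10 u = arrayOf q 10 k ∧ j = offsetCoeff q k * n + i ∧
      f (arrayOf q 10 u) j = G.value n (G.side n) (.inl k) (A k i)

variable {G}

theorem side_cast_pos (G : Gadget α β s t) (n : ℕ) : (0 : ℤ) < G.side n := by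
  exact_mod_cast G.side_pos n

theorem mul_succ_le_side_sq (G : Gadget α β s t) (n : ℕ) :
    (G.μ : ℤ) * (n + 1) ≤ G.side n * G.side n := by
  exact_mod_cast G.mul_succ_le_querySize n

variable {q : Partity} {n : ℕ} {A : Fin 3 → ℕ → ℤ} {P : Fin 3 → ℤ → Prop} {f : ℕ → ℤ → ℤ}

theorem IsQuery.exists_value (h : IsQuery G q n A P f) (hA : ∀ k, ∀ i < n, |A k i| ≤ (n : ℤ) ^ 3)
    (u : Fin 3) {j : ℕ} (hj : j < G.querySize n) :
    ∃ a z, f (arrayOf q 10 u) j = G.value n (G.side n) a z ∧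
      Gadget.Admissible n (G.side n) a z ∧
      ((a = padClass q u ∧ z = j) ∨
        ∃ k, ∃ i < n, P k (A k i) ∧ arrayOf q 10 u = arrayOf q 10 k ∧ j = offsetCoeff q k * n + i ∧
          a = .inl k ∧ z = A k i) := by
  rcases h.cell u j hj with hf | ⟨k, i, hi, hP, hu, hj', hf⟩
  · exact ⟨_, _, hf, admissible_padClass (by positivity) (by exact_mod_cast hj), .inl ⟨rfl, rfl⟩⟩
  · exact ⟨_, _, hf, hA k i hi, .inr ⟨k, i, hi, hP, hu, hj', rfl, rfl⟩⟩

/-- Different classes are told apart by their weights, dummies by their cells, and images within one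
class by the elements they come from. -/
theorem IsQuery.injOn (h : IsQuery G q n A P f) (hA : ∀ k, ∀ i < n, |A k i| ≤ (n : ℤ) ^ 3)
    (hinj : ∀ k, ∀ i < n, ∀ i' < n, A k i = A k i' → i = i') (u : Fin 3) {j j' : ℕ}
    (hj : j < G.querySize n) (hj' : j' < G.querySize n)
    (hjj : f (arrayOf q 10 u) j = f (arrayOf q 10 u) j') : j = j' := by
  obtain ⟨a, z, hf, had, hc⟩ := h.exists_value hA u hj
  obtain ⟨a', z', hf', had', hc'⟩ := h.exists_value hA u hj'
  have hR := side_cast_pos G n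
  have hm := mul_succ_le_side_sq G n
  rw [hf, hf'] at hjj
  have key : a' = a ∧ z = z' := by
    rcases hc with ⟨ha, -⟩ | ⟨k, -, -, -, -, -, ha, -⟩
    · rcases hc' with ⟨ha', -⟩ | ⟨k, -, -, -, -, -, ha', -⟩
      · exact G.value_injective hR hm had had' (.inl (by rw [ha, ha'])) hjj
      · have := G.value_injective hR hm had' had (.inr ⟨k, ha'⟩) hjj.symm
        exact ⟨this.1.symm, this.2.symm⟩
    · exact G.value_injective hR hm had had' (.inr ⟨k, ha⟩) hjj
  obtain ⟨rfl, rfl⟩ := key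
  obtain ⟨v, hv⟩ := padClass_eq_inr q u
  rcases hc with ⟨ha, hz⟩ | ⟨k, i, hi, -, -, hk, ha, hz⟩ <;>
    rcases hc' with ⟨ha', hz'⟩ | ⟨k', i', hi', -, -, hk', ha', hz'⟩
  · exact_mod_cast hz.symm.trans hz'
  · rw [ha, hv] at ha'; cases ha'
  · rw [ha', hv] at ha; cases ha
  · obtain rfl := Sum.inl.inj (ha.symm.trans ha')
    have := hinj k i hi i' hi' (hz.symm.trans hz')
    omega

/-- The set listed in the first `m` cells of an array. -/
def listed (f : ℕ → ℤ → ℤ) (m a : ℕ) : Finset ℤ :=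
  (Finset.range m).image fun i : ℕ => f a i

theorem IsQuery.isInstance (h : IsQuery G q n A P f) (hA : ∀ k, ∀ i < n, |A k i| ≤ (n : ℤ) ^ 3)
    (hinj : ∀ k, ∀ i < n, ∀ i' < n, A k i = A k i' → i = i') :
    (ldt q β t).IsInstance (G.querySize n) fun j => listed f (G.querySize n) (10 + j) := by
  rw [isInstance_ldt_iff (f := listed f (G.querySize n))]
  intro u
  constructor
  · rw [listed, Finset.card_image_of_injOn, Finset.card_range]
    intro j hj j' hj' hjj
    exact h.injOn hA hinj u (by simpa using hj) (by simpa using hj') hjj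
  · intro y hy
    obtain ⟨j, hj, rfl⟩ := Finset.mem_image.1 hy
    obtain ⟨a, z, hf, had, -⟩ := h.exists_value hA u (Finset.mem_range.1 hj)
    have := G.abs_value_le (side_cast_pos G n) (mul_succ_le_side_sq G n) had
    simp only [hf, Finset.mem_Icc]
    have e : (G.querySize n : ℤ) = G.side n * G.side n := by
      simp [Gadget.querySize]
    rw [← e] at this
    exact abs_le.1 this

/-- Conversely to `exists_perm_of_sum_value_eq`, the images of a source solution lie in three
different classes. So they are distinct, as a 1-partite target demands, even if elements of
different source sets coincide. -/
theorem IsQuery.yes_iff (h : IsQuery G q n A P f) (hA : ∀ k, ∀ i < n, |A k i| ≤ (n : ℤ) ^ 3)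
    (hfree : ∀ k, ∑ i, β i = 0 → ∀ z : Fin 3 → ℤ, (∀ i, P k (z i)) → (∀ i, |z i| ≤ (n : ℤ) ^ 3) →
      ∑ i, β i * z i = 0 → z 0 = z 1) :
    ((ldt q β t).yes fun j => listed f (G.querySize n) (10 + j)) ↔
      ∃ x : Fin 3 → ℤ, (∀ k, (∃ i < n, A k i = x k) ∧ P k (x k)) ∧ ∑ i, α i * x i = s := by
  have hR := side_cast_pos G n
  have hm := mul_succ_le_side_sq G n
  rw [yes_ldt_iff (f := listed f (G.querySize n))]
  constructor
  · rintro ⟨y, hyinj, hy, hsum⟩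
    have hy' : ∀ i, ∃ j < G.querySize n, f (arrayOf q 10 i) j = y i := fun i => by
      obtain ⟨j, hj, hjy⟩ := Finset.mem_image.1 (hy i)
      exact ⟨j, Finset.mem_range.1 hj, hjy⟩
    choose j hj hjy using hy'
    choose a z hf had hc using fun i => h.exists_value hA i (hj i)
    simp_rw [← hjy, hf] at hsum
    have hyz : ∀ i, y i = G.value n (G.side n) (a i) (z i) := fun i => by rw [← hjy, hf]
    have hsel : ∀ i k, a i = .inl k → (∃ i' < n, A k i' = z i) ∧ P k (z i) := by
      intro i k hik
      rcases hc i with ⟨ha, -⟩ | ⟨k', i', hi', hP, -, -, ha, hz⟩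
      · obtain ⟨v, hv⟩ := padClass_eq_inr q i
        rw [ha, hv] at hik; cases hik
      · obtain rfl := Sum.inl.inj (ha.symm.trans hik)
        exact ⟨⟨i', hi', hz.symm⟩, hz ▸ hP⟩
    -- Within one class, equal arguments would give `y 0 = y 1`, which a 1-partite query forbids; in
    -- a 3-partite query the arrays have no class in common.
    obtain ⟨σ, hσ, hx⟩ := G.exists_perm_of_sum_value_eq hR hm had hsum (by
        intro hconst hz
        cases q with
        | one =>
          have := hyinj rfl (show y 0 = y 1 by rw [hyz, hyz, hconst 1, hz])
          exact absurd this (by decide)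
        | three =>
          have hcl : ∀ i, a i = .inl i ∨ a i = .inr i := by
            intro i
            rcases hc i with ⟨ha, -⟩ | ⟨k, i', -, -, hk, -, ha, -⟩
            · exact .inr ha
            · simp only [arrayOf] at hk
              have : i = k := Fin.ext (by omega)
              exact .inl (this ▸ ha)
          have h10 := hconst 1
          rcases hcl 0 with h0 | h0 <;> rcases hcl 1 with h1 | h1 <;> rw [h0, h1] at h10 <;>
            simp at h10) (by
        intro k hk h0 hz0
        have hAz := fun i => hsel i k (hk i)
        refine hfree k h0 z (fun i => (hAz i).2) (fun i => ?_) hz0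
        obtain ⟨i', hi', he⟩ := (hAz i).1
        rw [← he]
        exact hA k i' hi')
    refine ⟨fun k => z (σ.symm k), fun k => hsel _ k ?_, hx⟩
    rw [hσ, Equiv.apply_symm_apply]
  · rintro ⟨x, hx, hsum⟩
    have hx' : ∀ k, ∃ i < n, A k i = x k := fun k => (hx k).1
    choose i hi hiA using hx'
    have hadm : ∀ k, Gadget.Admissible n (G.side n) (.inl k) (x k) := fun k => by
      rw [← hiA]; exact hA k _ (hi k)
    refine ⟨fun k => G.value n (G.side n) (.inl k) (x k), fun _ k k' hkk => ?_, fun k => ?_,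
      (G.sum_value_inl_iff x).2 hsum⟩
    · have := G.value_injective hR hm (hadm k) (hadm k') (.inr ⟨k, rfl⟩) hkk
      exact (Sum.inl.inj this.1).symm
    · refine Finset.mem_image.2 ⟨offsetCoeff q k * n + i k, ?_, ?_⟩
      · have h1 := G.mul_succ_le_querySize n
        have h2 := Nat.mul_le_mul_right (n + 1) G.three_le_μ
        have h3 : offsetCoeff q k * n ≤ 2 * n :=
          Nat.mul_le_mul_right _ (by cases q <;> simp only [offsetCoeff] <;> omega)
        have := hi k
        rw [Finset.mem_range]; omega
      · have := h.image k (i k) (hi k) (by rw [hiA]; exact (hx k).2)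
        rw [hiA] at this
        refine Eq.trans ?_ this
        push_cast; rfl

/-! ### Correctness of the program -/

variable {α β : Fin 3 → ℤ} {s₀ t₀ : ℤ} {G : Gadget α β s₀ t₀} {s : State} {B : SetProblem}
  {κ n : ℕ}

theorem abs_value_le_radix (G : Gadget α β s₀ t₀) {a : Fin 3 ⊕ Fin 3} {z : ℤ}
    (hz : Gadget.Admissible n (G.side n) a z) :
    |G.value n (G.side n) a z| ≤ radix n ^ G.degree := by
  have h := G.abs_value_le (side_cast_pos G n) (mul_succ_le_side_sq G n) hz
  have e : (G.querySize n : ℤ) = G.side n * G.side n := by simp [Gadget.querySize]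
  rw [← e] at h
  exact h.trans (G.fits n).querySize_pow

theorem ter_padWrite {q : Partity} {k : Fin 3} {j : ℕ} {Q : State → Prop} (hs : Ready G n s)
    (hj : s.reg 20 = j) (hjm : j < G.querySize n)
    (hQ : Q (s.setMem (arrayOf q 10 k) j (G.value n (G.side n) (padClass q k) j))) :
    Ter (setting B κ G n) (padWrite G q k) s 1 0 Q := by
  refine Ter.write_eq (j : ℤ) (G.value n (G.side n) (padClass q k) j) le_rfl (by simp [hj]) ?_
    (abs_value_le_radix G (admissible_padClass (q := q) (u := k) (by positivity)
      (by exact_mod_cast hjm))) hQ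
  obtain ⟨v, hv⟩ := padClass_eq_inr q k
  simp [hv, paraboloidExpr, hs.scale, hs.side, hj, Gadget.value, Gadget.offset, paraboloid]

theorem ter_pad (hs : Ready G n s) (q : Partity) :
    Ter (setting B κ G n) (padProg G q) s (G.querySize n + 1) 0 fun s' =>
      (∀ a < 10, s'.mem a = s.mem a) ∧ (∀ x < 20, s'.reg x = s.reg x) ∧
        ∀ k, ∀ j : ℕ, j < G.querySize n →
          s'.mem (arrayOf q 10 k) j = G.value n (G.side n) (padClass q k) j := by
  have hY : (1 : ℤ) ≤ radix n ^ G.degree := one_le_radix_pow _ _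
  refine Ter.seq_of_zero (Ter.assign_eq 0 (by omega) (by simp)
    (by rw [abs_zero]; exact le_trans (by norm_num) hY) ?_)
  have hloop := Ter.loop (S := setting B κ G n) (e := .bin .lt (.var 20) (.var 5))
    (c := padWrite G q 0 ;; padWrite G q 1 ;; padWrite G q 2 ;; .assign 20 (.var 20 + 1))
    (s := s.setReg 20 0) (T := 1) (q := 0)
    (fun i s' => (∀ a < 10, s'.mem a = s.mem a) ∧ (∀ x < 20, s'.reg x = s.reg x) ∧
      s'.reg 20 = i ∧ ∀ k, ∀ j : ℕ, j < i →
          s'.mem (arrayOf q 10 k) j = G.value n (G.side n) (padClass q k) j)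
    (G.querySize n) le_rfl ?init ?step ?fin
  case init =>
    refine ⟨fun _ _ => rfl, fun x hx => ?_, by simp, fun k j hj => by omega⟩
    rw [State.reg_setReg, if_neg (by omega)]
  case fin =>
    rintro s' ⟨-, h1, h2, -⟩
    simp [h1, h2, hs.query]
  case step =>
    rintro i hi s' ⟨hm, hr, h20, hv⟩
    have hs' : Ready G n s' := hs.congr fun x hx => hr x (by omega)
    refine ⟨by simp [hr, h20, hs.query, hi], ?_⟩
    refine Ter.seq_of_zero (ter_padWrite hs' h20 hi ?_)
    refine Ter.seq_of_zero (ter_padWrite (hs'.congr fun _ _ => rfl) h20 hi ?_)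
    refine Ter.seq_of_zero (ter_padWrite (hs'.congr fun _ _ => rfl) h20 hi ?_)
    refine Ter.assign_eq ((i : ℤ) + 1) le_rfl (by simp [h20]) ?_ ?_
    · rw [abs_of_nonneg (by positivity)]
      refine le_trans ?_ (querySize_le_degree G n)
      exact_mod_cast hi
    refine ⟨fun a ha => ?_, fun x hx => ?_, by simp, fun k j hj => ?_⟩
    · funext z
      have h10 := fun k => le_arrayOf q 10 k
      simp only [State.mem_setReg, State.mem_setMem]
      rw [if_neg (by have := h10 2; omega), if_neg (by have := h10 1; omega),
        if_neg (by have := h10 0; omega), hm a ha]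
    · rw [State.reg_setReg, if_neg (by omega)]; exact hr x hx
    · simp only [State.mem_setReg, State.mem_setMem, Nat.cast_inj]
      by_cases hji : j = i
      · subst hji
        simp only [and_true]
        split_ifs with h2 h1 h0
        · rw [padClass_eq h2]
        · rw [padClass_eq h1]
        · rw [padClass_eq h0]
        · fin_cases k <;> simp_all
      · simp only [hji, and_false, if_false]
        exact hv k j (by omega)
  refine Ter.mono (T := (G.querySize n + 1) * 1) hloop (by omega) ?_
  rintro s' ⟨hm, hr, -, hv⟩
  exact ⟨hm, hr, hv⟩

/-- The code has been read into the registers. -/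
structure Decoded (p : Partity) (C : Code) (s : State) : Prop where
  pos : s.reg 10 = C.a
  pos' : s.reg 11 = C.a'
  lab : ∀ k : Fin 3, s.reg (12 + k) = C.l k
  flag : s.reg 15 = open Classical in if C.Allowed p then 1 else 0

theorem Decoded.congr {p : Partity} {C : Code} {s s' : State} (h : Decoded p C s)
    (hs : ∀ x < 20, s'.reg x = s.reg x) : Decoded p C s' :=
  ⟨by rw [hs 10 (by omega), h.pos], by rw [hs 11 (by omega), h.pos'],
    fun k => by rw [hs _ (by omega), h.lab], by rw [hs 15 (by omega), h.flag]⟩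

/-- The last clause is a frame condition: it preserves the input, the remaining dummies and the
images of the other sets. -/
theorem ter_fill {p : Partity} {C : Code} {A : ℕ → ℤ} (q : Partity) (k : Fin 3) (hs : Ready G n s)
    (hd : Decoded p C s) (hA : ∀ i < n, s.mem (arrayOf p 0 k) i = A i)
    (hA3 : ∀ i < n, |A i| ≤ (n : ℤ) ^ 3) :
    Ter (setting B κ G n) (fillProg G p q k) s ((n + 1) * (4 * sqrtLog n + 1)) 0 fun s' =>
      (∀ x < 20, s'.reg x = s.reg x) ∧
      (∀ i < n, C.Selects p G.h n k (A i) →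
        s'.mem (arrayOf q 10 k) (offsetCoeff q k * n + i) =
          G.value n (G.side n) (.inl k) (A i)) ∧
      ∀ (a : ℕ) (z : ℤ), (∀ i < n, C.Selects p G.h n k (A i) →
        ¬ (a = arrayOf q 10 k ∧ z = offsetCoeff q k * n + i)) → s'.mem a z = s.mem a z := by
  classical
  have hY : (1 : ℤ) ≤ radix n ^ G.degree := one_le_radix_pow _ _
  have hsrc : arrayOf p 0 k < 10 := by have := arrayOf_le p 0 k; omega
  have htgt : 10 ≤ arrayOf q 10 k := le_arrayOf q 10 k
  have hT : 1 ≤ 4 * sqrtLog n + 1 := by omega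
  refine Ter.seq_of_zero (Ter.assign_eq 0 (Nat.mul_pos (by omega) hT) (by simp)
    (by rw [abs_zero]; exact le_trans (by norm_num) hY) ?_)
  refine Ter.mono (Ter.loop (q := 0)
    (fun c s' => (∀ x < 20, s'.reg x = s.reg x) ∧ s'.reg 20 = c ∧
      (∀ i < c, C.Selects p G.h n k (A i) →
        s'.mem (arrayOf q 10 k) (offsetCoeff q k * n + i) =
          G.value n (G.side n) (.inl k) (A i)) ∧
      ∀ (a : ℕ) (z : ℤ), (∀ i < c, C.Selects p G.h n k (A i) →
        ¬ (a = arrayOf q 10 k ∧ z = offsetCoeff q k * n + i)) → s'.mem a z = s.mem a z)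
    n hT ?_ ?_ ?_) le_rfl ?_
  · refine ⟨fun x hx => ?_, by simp, fun i hi => by omega, fun _ _ _ => rfl⟩
    rw [State.reg_setReg, if_neg (by omega)]
  · rintro c hc s₁ ⟨hr, h20, hw, hk⟩
    have hs₁ : Ready G n s₁ := hs.congr fun x hx => hr x (by omega)
    have hd₁ := hd.congr hr
    have hAc : s₁.mem (arrayOf p 0 k) (s₁.reg 20) = A c := by
      rw [hk _ _ fun i _ _ h => by omega, h20, hA c hc]
    refine ⟨by simp [hr, h20, hs.size, hc], ?_⟩
    refine Ter.seq_of_zero (Ter.mono (ter_label hs₁ (by rw [hAc]; exact hA3 c hc)) le_rfl ?_)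
    rintro s₂ ⟨hm₂, hr₂, h36⟩
    rw [hAc] at h36
    have hs₂ : Ready G n s₂ := hs₁.congr fun x hx => hr₂ x (by omega)
    have hd₂ := hd₁.congr fun x hx => hr₂ x (by omega)
    have h20₂ : s₂.reg 20 = c := by rw [hr₂ 20 (by omega), h20]
    have hflag : (Expr.var 15 * .bin .eq (.var 36) (.var (12 + k))).exact s₂ =
        if C.Selects p G.h n k (A c) then 1 else 0 := by
      simp only [Expr.exact_mul, Expr.exact_var, Expr.exact_eq, hd₂.flag, hd₂.lab, h36, hd₁.pos,
        hd₁.pos', Code.Selects]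
      by_cases h1 : C.Allowed p <;> by_cases h2 : label G.h n C.a C.a' (A c) = C.l k <;>
        simp [h1, h2]
    -- The end of the iteration, common to both branches.
    have hlast : ∀ s₃ : State, (∀ x < 30, s₃.reg x = s₂.reg x) →
        (C.Selects p G.h n k (A c) → s₃.mem (arrayOf q 10 k) (offsetCoeff q k * n + c) =
          G.value n (G.side n) (.inl k) (A c)) →
        (∀ (a : ℕ) (z : ℤ), (C.Selects p G.h n k (A c) →
          ¬ (a = arrayOf q 10 k ∧ z = offsetCoeff q k * n + c)) → s₃.mem a z = s₂.mem a z) →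
        Ter (setting B κ G n) (.assign 20 (.var 20 + 1)) s₃ (4 * sqrtLog n + 1) 0 fun s' =>
          (∀ x < 20, s'.reg x = s.reg x) ∧ s'.reg 20 = (c + 1 : ℕ) ∧
          (∀ i < c + 1, C.Selects p G.h n k (A i) →
            s'.mem (arrayOf q 10 k) (offsetCoeff q k * n + i) =
              G.value n (G.side n) (.inl k) (A i)) ∧
          ∀ (a : ℕ) (z : ℤ), (∀ i < c + 1, C.Selects p G.h n k (A i) →
            ¬ (a = arrayOf q 10 k ∧ z = offsetCoeff q k * n + i)) → s'.mem a z = s.mem a z := by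
      intro s₃ hr₃ hw₃ hk₃
      refine Ter.assign_eq ((c : ℤ) + 1) hT (by simp [hr₃, h20₂]) ?_ ?_
      · rw [abs_of_nonneg (by positivity)]
        refine le_trans ?_ (querySize_le_degree G n)
        have := three_mul_succ_le G n
        have : (c : ℤ) < n := by exact_mod_cast hc
        linarith
      refine ⟨fun x hx => ?_, by simp, fun i hi hsel => ?_, fun a z ha => ?_⟩
      · rw [State.reg_setReg, if_neg (by omega), hr₃ x (by omega), hr₂ x (by omega), hr x hx]
      · rcases Nat.lt_succ_iff_lt_or_eq.1 hi with hi | rfl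
        · rw [State.mem_setReg, hk₃ _ _ fun _ h => by omega, hm₂]
          exact hw i hi hsel
        · exact hw₃ hsel
      · rw [State.mem_setReg, hk₃ a z (ha c (by omega)), hm₂]
        exact hk a z fun i hi => ha i (by omega)
    refine Ter.seq_of_zero (Ter.branch hT (fun hne => ?_) fun heq => ?_)
    · rw [hflag] at hne
      refine Ter.write_eq (offsetCoeff q k * n + c) (G.value n (G.side n) (.inl k) (A c)) hT
        (by simp [hs₂.size, h20₂]) ?_ (abs_value_le_radix G (hA3 c hc)) ?_
      · have : s₂.mem (arrayOf p 0 k) c = A c := by rw [hm₂, ← hAc, h20]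
        simp [hs₂.scale, h20₂, this, Gadget.value, Gadget.offset]
      · refine hlast _ (fun _ _ => rfl) (fun _ => by simp [State.mem_setMem]) fun a z h => ?_
        rw [State.mem_setMem, if_neg (h (by by_contra h'; simp [h'] at hne))]
    · rw [hflag] at heq
      refine Ter.skip hT (hlast _ (fun _ _ => rfl) (fun h => by simp [h] at heq) fun _ _ _ => rfl)
  · rintro s₁ ⟨hr, h20, -, -⟩
    simp [hr, h20, hs.size]
  · rintro s₁ ⟨hr, -, hw, hk⟩
    exact ⟨hr, hw, hk⟩

theorem ter_decode (hs : Ready G n s) (p : Partity) :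
    Ter (setting B κ G n) (decodeProg p) s 1 0 fun s' =>
      s'.mem = s.mem ∧ (∀ x < 10, s'.reg x = s.reg x) ∧
        Decoded p (Code.decode (labelBase G.h n) (s.reg 8)) s' := by
  classical
  have hM := labelBase_pos G.h n
  have hM3 : 0 < labelBase G.h n ^ 3 := by positivity
  have hY : (1 : ℤ) ≤ radix n ^ G.degree := one_le_radix_pow _ _
  have b1 : ∀ z, |z % labelBase G.h n| ≤ radix n ^ G.degree := fun z => by
    rw [abs_of_nonneg (Int.emod_nonneg _ hM.ne')]
    exact (Int.emod_lt_of_pos _ hM).le.trans (labelBase_le G n)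
  have b3 : ∀ z, |z % labelBase G.h n ^ 3| ≤ radix n ^ G.degree := fun z => by
    rw [abs_of_nonneg (Int.emod_nonneg _ hM3.ne')]
    exact (Int.emod_lt_of_pos _ hM3).le.trans (labelBase_pow_le G n (by omega))
  have r6 := hs.base
  set C := Code.decode (labelBase G.h n) (s.reg 8) with hC
  refine Ter.seq_of_zero (Ter.assign_eq C.a le_rfl (by simp [r6, hC, Code.decode]) (b1 _) ?_)
  refine Ter.seq_of_zero (Ter.assign_eq C.a' le_rfl (by simp [r6, hC, Code.decode]) (b1 _) ?_)
  refine Ter.seq_of_zero (Ter.assign_eq (C.l 0) le_rfl (by simp [r6, hC, Code.decode]) (b3 _) ?_)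
  refine Ter.seq_of_zero (Ter.assign_eq (C.l 1) le_rfl (by simp [r6, hC, Code.decode]) (b3 _) ?_)
  refine Ter.seq_of_zero (Ter.assign_eq (C.l 2) le_rfl (by simp [r6, hC, Code.decode]) (b3 _) ?_)
  refine Ter.assign_eq (if C.Allowed p then 1 else 0) le_rfl ?_ ?_ ?_
  · cases p with
    | one =>
      simp only [flagExpr, Code.Allowed, forall_const]
      simp
      split_ifs <;> simp_all
    | three => simp [flagExpr, Code.Allowed]
  · split_ifs
    · rw [abs_one]; exact hY
    · rw [abs_zero]; exact le_trans (by norm_num) hY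
  · refine ⟨rfl, fun x hx => ?_, ?_⟩
    · simp only [State.reg_setReg]
      rw [if_neg (by omega), if_neg (by omega), if_neg (by omega), if_neg (by omega),
        if_neg (by omega), if_neg (by omega)]
    · refine ⟨by simp, by simp, fun k => ?_, by simp⟩
      fin_cases k <;> simp

variable {α β : Fin 3 → ℤ} {s₀ t₀ : ℤ} {G : Gadget α β s₀ t₀} {s : State} {κ n : ℕ}

/-- The truth value of a proposition as a word. -/
noncomputable def truth (v : Prop) : ℤ := open Classical in if v then 1 else 0

theorem truth_of {v : Prop} (h : v) : truth v = 1 := if_pos h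

theorem truth_of_not {v : Prop} (h : ¬ v) : truth v = 0 := if_neg h

theorem abs_truth_le (v : Prop) : |truth v| ≤ 1 := by
  unfold truth; split_ifs <;> simp

/-- The selected elements contain a solution. -/
def IsHit (α : Fin 3 → ℤ) (s₀ : ℤ) (p : Partity) (h n : ℕ) (A : Fin 3 → ℕ → ℤ) (C : Code) : Prop :=
  ∃ x : Fin 3 → ℤ, (∀ k, (∃ i < n, A k i = x k) ∧ C.Selects p h n k (x k)) ∧ ∑ i, α i * x i = s₀

/-- The time for one iteration of the main loop, up to a constant factor. -/
def bodyTime (G : Gadget α β s₀ t₀) (n : ℕ) : ℕ := (G.querySize n + 1) * (4 * sqrtLog n + 1)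

theorem size_le_querySize (G : Gadget α β s₀ t₀) (n : ℕ) : n + 1 ≤ G.querySize n := by
  have := three_mul_succ_le G n
  omega

theorem querySize_succ_le_bodyTime (G : Gadget α β s₀ t₀) (n : ℕ) :
    G.querySize n + 1 ≤ bodyTime G n := Nat.le_mul_of_pos_right _ (by omega)

theorem one_le_bodyTime (G : Gadget α β s₀ t₀) (n : ℕ) : 1 ≤ bodyTime G n :=
  le_trans (by omega) (querySize_succ_le_bodyTime G n)

/-- Stated with a continuation `c`, which may assume that its initial state holds a correct query.
-/
theorem ter_writeQuery {B : SetProblem} {p : Partity} {C : Code} {A : Fin 3 → ℕ → ℤ} (q : Partity)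
    {c : Prog} {l : ℕ} {Q : State → Prop} (hs : Ready G n s) (hd : Decoded p C s)
    (hA : ∀ k, ∀ i < n, s.mem (arrayOf p 0 k) i = A k i)
    (hA3 : ∀ k, ∀ i < n, |A k i| ≤ (n : ℤ) ^ 3)
    (hQ : ∀ s', (∀ a < 10, s'.mem a = s.mem a) → (∀ x < 20, s'.reg x = s.reg x) →
      IsQuery G q n A (C.Selects p G.h n) s'.mem → Ter (setting B κ G n) c s' (bodyTime G n) l Q) :
    Ter (setting B κ G n) (padProg G q ;; fillProg G p q 0 ;; fillProg G p q 1 ;;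
      fillProg G p q 2 ;; c) s (bodyTime G n) l Q := by
  have hfillT : (n + 1) * (4 * sqrtLog n + 1) ≤ bodyTime G n := by
    have := size_le_querySize G n
    exact Nat.mul_le_mul_right _ (by omega)
  have hsrc := fun k => arrayOf_le p 0 k
  have htgt := fun k => le_arrayOf q 10 k
  have hover : ∀ {k k' : Fin 3}, k ≠ k' → ∀ i < n, ∀ i' < n, ¬ (arrayOf q 10 k = arrayOf q 10 k' ∧
      (offsetCoeff q k * n + i : ℤ) = offsetCoeff q k' * n + i') := by
    rintro k k' hkk i hi i' hi' ⟨h1, h2⟩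
    exact hkk (place_injective hi hi' h1 (by exact_mod_cast h2)).1
  refine Ter.seq_of_zero (Ter.mono (ter_pad hs q) (querySize_succ_le_bodyTime G n) ?_)
  rintro s₁ ⟨hm₁, hr₁, hp₁⟩
  refine Ter.seq_of_zero (Ter.mono (ter_fill (A := A 0) q 0 (hs.congr fun x hx => hr₁ x (by omega))
    (hd.congr hr₁) (fun i hi => by rw [hm₁ _ (by have := hsrc 0; omega), hA 0 i hi]) (hA3 0))
    hfillT ?_)
  rintro s₂ ⟨hr₂', hw₂, hk₂⟩
  have hr₂ : ∀ x < 20, s₂.reg x = s.reg x := fun x hx => (hr₂' x hx).trans (hr₁ x hx)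
  have hm₂ : ∀ a < 10, s₂.mem a = s.mem a := fun a ha => by
    funext z
    rw [hk₂ a z (fun i _ _ h => by have := htgt 0; omega), hm₁ a ha]
  refine Ter.seq_of_zero (Ter.mono (ter_fill (A := A 1) q 1 (hs.congr fun x hx => hr₂ x (by omega))
    (hd.congr hr₂) (fun i hi => by rw [hm₂ _ (by have := hsrc 1; omega), hA 1 i hi]) (hA3 1))
    hfillT ?_)
  rintro s₃ ⟨hr₃', hw₃, hk₃⟩
  have hr₃ : ∀ x < 20, s₃.reg x = s.reg x := fun x hx => (hr₃' x hx).trans (hr₂ x hx)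
  have hm₃ : ∀ a < 10, s₃.mem a = s.mem a := fun a ha => by
    funext z
    rw [hk₃ a z (fun i _ _ h => by have := htgt 1; omega), hm₂ a ha]
  refine Ter.seq_of_zero (Ter.mono (ter_fill (A := A 2) q 2 (hs.congr fun x hx => hr₃ x (by omega))
    (hd.congr hr₃) (fun i hi => by rw [hm₃ _ (by have := hsrc 2; omega), hA 2 i hi]) (hA3 2))
    hfillT ?_)
  rintro s₄ ⟨hr₄', hw₄, hk₄⟩
  have hr₄ : ∀ x < 20, s₄.reg x = s.reg x := fun x hx => (hr₄' x hx).trans (hr₃ x hx)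
  have hm₄ : ∀ a < 10, s₄.mem a = s.mem a := fun a ha => by
    funext z
    rw [hk₄ a z (fun i _ _ h => by have := htgt 2; omega), hm₃ a ha]
  -- Later passes spare the images written earlier, since the reserved places are disjoint.
  have image : ∀ k, ∀ i < n, C.Selects p G.h n k (A k i) →
      s₄.mem (arrayOf q 10 k) (offsetCoeff q k * n + i) =
        G.value n (G.side n) (.inl k) (A k i) := by
    intro k i hi hsel
    fin_cases k
    · refine (hk₄ _ _ fun i' hi' _ => hover (by decide) i hi i' hi').trans ?_
      refine (hk₃ _ _ fun i' hi' _ => hover (by decide) i hi i' hi').trans ?_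
      exact hw₂ i hi hsel
    · refine (hk₄ _ _ fun i' hi' _ => hover (by decide) i hi i' hi').trans ?_
      exact hw₃ i hi hsel
    · exact hw₄ i hi hsel
  refine hQ s₄ hm₄ hr₄ ⟨image, fun u j hj => ?_⟩
  by_cases hex : ∃ k, ∃ i < n, C.Selects p G.h n k (A k i) ∧ arrayOf q 10 u = arrayOf q 10 k ∧
      j = offsetCoeff q k * n + i
  · obtain ⟨k, i, hi, hsel, hu, hji⟩ := hex
    refine .inr ⟨k, i, hi, hsel, hu, hji, ?_⟩
    rw [hu, ← image k i hi hsel, hji]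
    push_cast; rfl
  · have hno : ∀ k, ∀ i < n, C.Selects p G.h n k (A k i) →
        ¬ (arrayOf q 10 u = arrayOf q 10 k ∧ (j : ℤ) = offsetCoeff q k * n + i) :=
      fun k i hi hsel h => hex ⟨k, i, hi, hsel, h.1, by exact_mod_cast h.2⟩
    left
    rw [hk₄ _ _ (hno 2), hk₃ _ _ (hno 1), hk₂ _ _ (hno 0), hp₁ u j hj]

theorem ter_body {p : Partity} {A : Fin 3 → ℕ → ℤ} (q : Partity) {c : ℕ} {v : Prop}
    (hs : Ready G n s) (hc : (c : ℤ) < labelBase G.h n ^ 11) (h8 : s.reg 8 = c)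
    (h9 : s.reg 9 = truth v)
    (hA : ∀ k, ∀ i < n, s.mem (arrayOf p 0 k) i = A k i)
    (hA3 : ∀ k, ∀ i < n, |A k i| ≤ (n : ℤ) ^ 3)
    (hinj : ∀ k, ∀ i < n, ∀ i' < n, A k i = A k i' → i = i') :
    Ter (setting (ldt q β t₀) κ G n) (bodyProg G p q) s (bodyTime G n) 1 fun s' =>
      (∀ a < 10, s'.mem a = s.mem a) ∧ (∀ x < 8, s'.reg x = s.reg x) ∧ s'.reg 8 = (c + 1 : ℕ) ∧
        s'.reg 9 = truth (v ∨ IsHit α s₀ p G.h n A (Code.decode (labelBase G.h n) c)) := by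
  have hT := one_le_bodyTime G n
  have hY : (1 : ℤ) ≤ radix n ^ G.degree := one_le_radix_pow _ _
  unfold bodyProg
  refine Ter.seq_of_zero (Ter.mono (ter_decode hs p) hT ?_)
  rintro s₁ ⟨hm₁, hr₁, hd₁⟩
  rw [h8] at hd₁
  set C := Code.decode (labelBase G.h n) c with hC
  refine ter_writeQuery q (hs.congr fun x hx => hr₁ x (by omega)) hd₁
    (fun k i hi => by rw [hm₁, hA k i hi]) hA3 fun s₂ hm₂ hr₂ hq => ?_
  have hm : ∀ a < 10, s₂.mem a = s.mem a := fun a ha => by rw [hm₂ a ha, hm₁]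
  have hr : ∀ x < 10, s₂.reg x = s.reg x := fun x hx => by rw [hr₂ x (by omega), hr₁ x hx]
  -- All elements selected for one class share a label, so Behrend's construction applies to them.
  have hyes := hq.yes_iff hA3 fun k h0 z hz hz3 hsum =>
    eq_of_label_eq (h := G.h) (n := n) (a := C.a) (a' := C.a') G.ne h0 G.abs_sum_le hz3 hsum
      fun i => by rw [(hz i).2, (hz 0).2]
  have hlast : ∀ w : ℤ, w = truth (IsHit α s₀ p G.h n A C) →
      Ter (setting (ldt q β t₀) κ G n)
        (.assign 9 (.bin .lt 0 (.var 9 + .var 16)) ;; .assign 8 (.var 8 + 1))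
        (s₂.setReg 16 w) (bodyTime G n) 0 fun s' =>
        (∀ a < 10, s'.mem a = s.mem a) ∧ (∀ x < 8, s'.reg x = s.reg x) ∧ s'.reg 8 = (c + 1 : ℕ) ∧
        s'.reg 9 = truth (v ∨ IsHit α s₀ p G.h n A C) := by
    intro w hw
    refine Ter.seq_of_zero (Ter.assign_eq
      (truth (v ∨ IsHit α s₀ p G.h n A C)) hT ?_ ((abs_truth_le _).trans hY) ?_)
    · by_cases hv : v <;> by_cases hh : IsHit α s₀ p G.h n A C <;> simp [hr, h9, hw, hv, hh, truth]
    refine Ter.assign_eq ((c : ℤ) + 1) hT (by simp [hr, h8]) ?_ ?_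
    · rw [abs_of_nonneg (by positivity)]
      exact le_trans (Int.add_one_le_iff.2 hc) (labelBase_pow_le G n le_rfl)
    · refine ⟨hm, fun x hx => ?_, by simp, by simp⟩
      simp only [State.reg_setReg]
      rw [if_neg (by omega), if_neg (by omega), if_neg (by omega), hr x (by omega)]
  refine Ter.seq (q₁ := 1) (q₂ := 0) (Ter.query (querySize_succ_le_bodyTime G n) ?_
    (hq.isInstance hA3 hinj) (fun hy => hlast 1 ?_) fun hy => hlast 0 ?_)
  · simp only [Expr.exact_var, hr 5 (by omega), hs.query]; rfl
  · have : IsHit α s₀ p G.h n A C := hyes.1 hy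
    rw [truth_of this]
  · have : ¬ IsHit α s₀ p G.h n A C := fun h => hy (hyes.2 h)
    rw [truth_of_not this]

theorem ter_setupBlock {B : SetProblem} (h0 : s.reg 0 = n) :
    Ter (setting B κ G n) setupBlock s (bodyTime G n) 0 fun s' =>
      s'.mem = s.mem ∧ s'.reg 0 = n ∧ s'.reg 1 = blockSize n ∧ s'.reg 2 = sqrtLog n := by
  have hT := one_le_bodyTime G n
  have hp := two_le_blockSize n
  have hM : blockSize n ≤ radix n ^ G.degree := by
    refine le_trans ?_ (labelBase_le G n)
    exact le_self_pow₀ (by linarith) (by omega)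
  have hk : ∀ i, i + 2 ≤ sqrtLog n → |(2 : ℤ) ^ (i + 2)| ≤ radix n ^ G.degree := fun i hi => by
    rw [abs_of_nonneg (by positivity)]
    exact le_trans (pow_le_pow_right₀ (by norm_num) hi) hM
  have htwo : |(2 : ℤ)| ≤ radix n ^ G.degree := by rw [abs_of_nonneg (by norm_num)]; linarith
  refine Ter.seq_of_zero (Ter.assign_eq 2 hT (by simp) htwo ?_)
  refine Ter.seq_of_zero (Ter.assign_eq 1 hT (by simp) (by rw [abs_one]; exact one_le_radix_pow _ _)
    ?_)
  refine Ter.seq_of_zero (Ter.assign_eq 2 hT (by simp) htwo ?_)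
  refine Ter.mono (T := (sqrtLog n - 1 + 1) * 1) (Ter.loop (q := 0)
    (fun i s' => s'.mem = s.mem ∧ s'.reg 0 = n ∧ s'.reg 1 = 2 ^ (i + 1) ∧ s'.reg 2 = (i + 1 : ℕ) ∧
      s'.reg 3 = 2 ^ (i + 1) ^ 2) (sqrtLog n - 1) le_rfl ?_ ?_ ?_) ?_ ?_
  · simp [h0]
  · rintro i hi s' ⟨hm, r0, r1, r2, r3⟩
    have hlt : ((2 ^ (i + 1) ^ 2 : ℕ) : ℤ) < n + 1 := by
      have := Nat.find_min (exists_lt_two_pow_sq n) (m := i)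
        (by unfold sqrtLog at hi; omega)
      omega
    push_cast at hlt
    refine ⟨by simp [r0, r3, hlt], ?_⟩
    -- Since `(i + 2)² = (i + 1)² + 2 (i + 1) + 1`, multiplying by the square of register `1` and by
    -- `2` suffices.
    refine Ter.seq_of_zero (Ter.assign_eq (2 ^ (i + 2) ^ 2) le_rfl (by simp [r1, r3]; ring) ?_ ?_)
    · rw [abs_of_nonneg (by positivity)]
      refine le_trans (pow_le_pow_right₀ (by norm_num) ?_) (G.fits n).two_pow_le
      exact Nat.pow_le_pow_left (by omega) 2
    refine Ter.seq_of_zero (Ter.assign_eq (2 ^ (i + 2)) le_rfl (by simp [r1]; ring)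
      (hk i (by omega)) ?_)
    refine Ter.assign_eq ((i : ℤ) + 2) le_rfl (by simp [r2]; ring) ?_ ?_
    · rw [abs_of_nonneg (by positivity)]
      have h1 := sqrtLog_lt_blockSize n
      have h2 : (i : ℤ) + 2 ≤ sqrtLog n := by exact_mod_cast (by omega : i + 2 ≤ sqrtLog n)
      exact h2.trans (h1.le.trans hM)
    · refine ⟨hm, by simp [r0], by simp, ?_, by simp⟩
      simp; ring
  · rintro s' ⟨-, r0, -, -, r3⟩
    have h1 := one_le_sqrtLog n
    have h2 : ((n + 1 : ℕ) : ℤ) ≤ (2 ^ sqrtLog n ^ 2 : ℕ) := by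
      exact_mod_cast lt_two_pow_sqrtLog_sq n
    push_cast at h2
    rw [Nat.sub_add_cancel h1] at r3
    simp [r0, r3]; linarith
  · have := one_le_sqrtLog n
    have : 4 * sqrtLog n + 1 ≤ bodyTime G n := Nat.le_mul_of_pos_left _ (by omega)
    omega
  · rintro s' ⟨hm, r0, r1, r2, -⟩
    rw [Nat.sub_add_cancel (one_le_sqrtLog n)] at r1 r2
    exact ⟨hm, r0, r1, r2⟩

theorem ter_setupRoot {B : SetProblem} (h0 : s.reg 0 = n) :
    Ter (setting B κ G n) setupRoot s (bodyTime G n) 0 fun s' =>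
      s'.mem = s.mem ∧ (∀ x < 4, s'.reg x = s.reg x) ∧ s'.reg 4 = 2 ^ rootLog n := by
  have hT := one_le_bodyTime G n
  have hside : 2 ^ rootLog n ≤ G.querySize n := by
    have h1 : 1 ≤ G.side n := G.side_pos n
    have h2 := G.three_le_μ
    calc 2 ^ rootLog n ≤ G.μ * 2 ^ rootLog n := Nat.le_mul_of_pos_left _ (by omega)
      _ ≤ G.querySize n := Nat.le_mul_of_pos_left _ h1
  refine Ter.seq_of_zero (Ter.assign_eq 1 hT (by simp) (by rw [abs_one]; exact one_le_radix_pow _ _)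
    ?_)
  refine Ter.mono (T := (rootLog n + 1) * 1) (Ter.loop (q := 0)
    (fun i s' => s'.mem = s.mem ∧ (∀ x < 4, s'.reg x = s.reg x) ∧ s'.reg 4 = 2 ^ i)
    (rootLog n) le_rfl ?_ ?_ ?_) ?_ ?_
  · refine ⟨rfl, fun x hx => ?_, by simp⟩
    rw [State.reg_setReg, if_neg (by omega)]
  · rintro i hi s' ⟨hm, hr, r4⟩
    have hlt : ((2 ^ i * 2 ^ i : ℕ) : ℤ) < n + 1 := by
      have := Nat.find_min (exists_lt_two_pow_pow_two n) (m := i) hi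
      omega
    push_cast at hlt
    refine ⟨by simp [hr, h0, r4, hlt], ?_⟩
    refine Ter.assign_eq (2 ^ (i + 1)) le_rfl (by simp [r4]; ring) ?_ ?_
    · rw [abs_of_nonneg (by positivity)]
      refine le_trans ?_ (querySize_le_degree G n)
      have h1 : 2 ^ (i + 1) ≤ 2 ^ rootLog n := Nat.pow_le_pow_right (by norm_num) hi
      exact_mod_cast h1.trans hside
    · refine ⟨hm, fun x hx => ?_, by simp⟩
      rw [State.reg_setReg, if_neg (by omega), hr x hx]
  · rintro s' ⟨-, hr, r4⟩
    have h1 : ((n + 1 : ℕ) : ℤ) ≤ (2 ^ rootLog n * 2 ^ rootLog n : ℕ) := by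
      exact_mod_cast lt_root_sq n
    push_cast at h1
    simp [hr, h0, r4]; linarith
  · have h1 := querySize_succ_le_bodyTime G n
    have h2 : rootLog n < 2 ^ rootLog n := Nat.lt_two_pow_self
    omega
  · exact fun s' h => h

/-- The number of iterations of the main loop. -/
def codeCount (h n : ℕ) : ℕ := ((2 ^ sqrtLog n) ^ (4 * h + 6)) ^ 11

theorem codeCount_cast (h n : ℕ) : (codeCount h n : ℤ) = labelBase h n ^ 11 := by
  simp [codeCount, labelBase, blockSize]

theorem ter_main {p : Partity} {A : Fin 3 → ℕ → ℤ} (q : Partity) (h0 : s.reg 0 = n)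
    (hA : ∀ k, ∀ i < n, s.mem (arrayOf p 0 k) i = A k i)
    (hA3 : ∀ k, ∀ i < n, |A k i| ≤ (n : ℤ) ^ 3)
    (hinj : ∀ k, ∀ i < n, ∀ i' < n, A k i = A k i' → i = i') :
    Ter (setting (ldt q β t₀) κ G n) (mainProg G p q) s ((codeCount G.h n + 1) * bodyTime G n)
      (codeCount G.h n) fun s' => s'.reg 0 = truth
        (∃ c < codeCount G.h n, IsHit α s₀ p G.h n A (Code.decode (labelBase G.h n) c)) := by
  have hT₀ := one_le_bodyTime G n
  have hle : bodyTime G n ≤ (codeCount G.h n + 1) * bodyTime G n :=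
    Nat.le_mul_of_pos_left _ (by omega)
  have hT := hT₀.trans hle
  have hY : (1 : ℤ) ≤ radix n ^ G.degree := one_le_radix_pow _ _
  have hzero : |(0 : ℤ)| ≤ radix n ^ G.degree := by rw [abs_zero]; linarith
  have hη := G.η_pos
  refine Ter.seq_of_zero (Ter.mono (ter_setupBlock h0) hle ?_)
  rintro s₁ ⟨hm₁, r0, r1, r2⟩
  refine Ter.seq_of_zero (Ter.mono (ter_setupRoot r0) hle ?_)
  rintro s₂ ⟨hm₂, hr₂, r4⟩
  refine Ter.seq_of_zero (Ter.assign_eq (G.side n) hT (by simp [r4, Gadget.side]) ?_ ?_)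
  · rw [abs_of_nonneg (by positivity)]
    refine le_trans ?_ (querySize_le_degree G n)
    exact_mod_cast Nat.le_mul_of_pos_left _ (G.side_pos n)
  refine Ter.seq_of_zero (Ter.assign_eq (G.querySize n) hT (by simp [Gadget.querySize]) ?_ ?_)
  · rw [abs_of_nonneg (by positivity)]
    exact querySize_le_degree G n
  refine Ter.seq_of_zero (Ter.assign_eq (labelBase G.h n) hT
    (by simp [hr₂, r1, labelBase]) ?_ ?_)
  · rw [abs_of_nonneg (labelBase_pos G.h n).le]
    exact labelBase_le G n
  refine Ter.seq_of_zero (Ter.assign_eq (G.scale n (G.side n)) hT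
    (by simp [hr₂, r0, Gadget.scale, Gadget.querySize, sq]) ?_ ?_)
  · rw [abs_of_nonneg (by unfold Gadget.scale; positivity)]
    exact (G.fits n).scale_le
  refine Ter.seq_of_zero (Ter.assign_eq 0 hT (by simp) hzero ?_)
  refine Ter.seq_of_zero (Ter.assign_eq 0 hT (by simp) hzero ?_)
  refine Ter.seq (q₁ := codeCount G.h n * 1) (q₂ := 0) ?_ |> cast (by rw [mul_one, add_zero])
  refine Ter.mono (Ter.loop (q := 1)
    (fun c s' => Ready G n s' ∧ (∀ a < 10, s'.mem a = s.mem a) ∧ s'.reg 8 = c ∧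
      s'.reg 9 = truth (∃ c' < c, IsHit α s₀ p G.h n A (Code.decode (labelBase G.h n) c')))
    (codeCount G.h n) hT₀ ?_ ?_ ?_) le_rfl ?_
  · refine ⟨⟨by simp [hr₂, r0], by simp [hr₂, r1], by simp [hr₂, r2], by simp, by simp, by simp,
      by simp⟩, fun a _ => ?_, by simp, by simp [truth]⟩
    simp only [State.mem_setReg, hm₂, hm₁]
  · rintro c hc s' ⟨hs', hm', h8, h9⟩
    have hc' : (c : ℤ) < labelBase G.h n ^ 11 := by
      rw [← codeCount_cast]; exact_mod_cast hc
    refine ⟨by simp [h8, hs'.base, hc'], ?_⟩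
    refine Ter.mono (ter_body q hs' hc' h8 h9 (fun k i hi => ?_) hA3 hinj) le_rfl ?_
    · rw [hm' _ (by have := arrayOf_le p 0 k; omega), hA k i hi]
    rintro s'' ⟨hm'', hr'', h8'', h9''⟩
    refine ⟨hs'.congr hr'', fun a ha => by rw [hm'' a ha, hm' a ha], h8'', ?_⟩
    rw [h9'']
    refine congrArg truth (propext ?_)
    constructor
    · rintro (⟨c', h1, h2⟩ | h)
      · exact ⟨c', by omega, h2⟩
      · exact ⟨c, by omega, h⟩
    · rintro ⟨c', h1, h2⟩
      rcases Nat.lt_succ_iff_lt_or_eq.1 h1 with h1 | rfl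
      · exact .inl ⟨c', h1, h2⟩
      · exact .inr h2
  · rintro s' ⟨hs', -, h8, -⟩
    simp [h8, hs'.base, codeCount_cast]
  · rintro s' ⟨-, -, -, h9⟩
    exact Ter.assign_eq _ hT h9 ((abs_truth_le _).trans hY) (by simp)

/-! ### The reduction -/

variable {α β : Fin 3 → ℤ} {s₀ t₀ : ℤ}

/-- A solution is found by the code made of its own labels. For one set, the positions are chosen to
make these labels distinct, and distinct labels in turn guarantee distinct elements; for three sets
the positions are irrelevant. -/
theorem yes_iff_exists_isHit (p : Partity) (α : Fin 3 → ℤ) (s₀ : ℤ) (h : ℕ) {n : ℕ} {s : State}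
    (hA3 : ∀ k : Fin 3, ∀ i < n, |s.mem (arrayOf p 0 k) (i : ℕ)| ≤ (n : ℤ) ^ 3) :
    ((ldt p α s₀).yes fun j => s.contents (0 + j) n) ↔ ∃ c < codeCount h n,
      IsHit α s₀ p h n (fun k i => s.mem (arrayOf p 0 k) i) (Code.decode (labelBase h n) c) := by
  rw [yes_ldt_iff (f := fun a => s.contents a n)]
  have hmem : ∀ k (x : ℤ), x ∈ s.contents (arrayOf p 0 k) n ↔
      ∃ i < n, s.mem (arrayOf p 0 k) (i : ℕ) = x := by
    intro k x
    simp [State.contents]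
  constructor
  · rintro ⟨y, hinj, hy, hsum⟩
    have hy3 : ∀ i, |y i| ≤ (n : ℤ) ^ 3 := fun i => by
      obtain ⟨j, hj, hjy⟩ := (hmem i _).1 (hy i)
      rw [← hjy]; exact hA3 i j hj
    obtain ⟨a, a', ha, ha1, ha', ha1', hl⟩ : ∃ a a' : ℤ, 0 ≤ a ∧ a < labelBase h n ∧ 0 ≤ a' ∧
        a' < labelBase h n ∧
          (p = .one → Function.Injective fun i => label h n a a' (y i)) := by
      cases p with
      | one =>
        obtain ⟨a, a', h1, h2, h3, h4, h5⟩ := exists_label_injective (h := h) hy3 (hinj rfl)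
        exact ⟨a, a', h1, h2, h3, h4, fun _ => h5⟩
      | three =>
        exact ⟨0, 0, le_rfl, labelBase_pos h n, le_rfl, labelBase_pos h n, nofun⟩
    obtain ⟨c, hc, hdec⟩ := Code.exists_decode_eq
      (C := ⟨a, a', fun k => label h n a a' (y k)⟩) ha ha1 ha' ha1'
      fun k => label_bounds h n a a' (y k)
    refine ⟨c, by rw [← codeCount_cast] at hc; exact_mod_cast hc, y, fun k => ?_, hsum⟩
    rw [hdec]
    refine ⟨(hmem k _).1 (hy k), fun hp => ⟨?_, ?_, ?_⟩, rfl⟩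
    · exact (hl hp).ne (by decide)
    · exact (hl hp).ne (by decide)
    · exact (hl hp).ne (by decide)
  · rintro ⟨c, -, x, hx, hsum⟩
    refine ⟨x, fun hp => ?_, fun k => (hmem k _).2 (hx k).1, hsum⟩
    obtain ⟨h01, h02, h12⟩ := (hx 0).2.1 hp
    rw [← (hx 0).2.2, ← (hx 1).2.2] at h01
    rw [← (hx 0).2.2, ← (hx 2).2.2] at h02
    rw [← (hx 1).2.2, ← (hx 2).2.2] at h12
    have e01 : x 0 ≠ x 1 := fun e => h01 (by rw [e])
    have e02 : x 0 ≠ x 2 := fun e => h02 (by rw [e])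
    have e12 : x 1 ≠ x 2 := fun e => h12 (by rw [e])
    intro i j hij
    fin_cases i <;> fin_cases j <;> simp_all

/-- A bound for the running time of the reduction, up to a constant factor. -/
def totalTime (G : Gadget α β s₀ t₀) (n : ℕ) : ℕ := (codeCount G.h n + 1) * bodyTime G n

theorem exists_exec (G : Gadget α β s₀ t₀) (p q : Partity) {κ : ℕ}
    (hκ : (mainProg G p q).deg G.degree + 2 ≤ κ) {n : ℕ} {X : Fin (ldt p α s₀).arity → Finset ℤ}
    {s : State} (hX : (ldt p α s₀).IsInstance n X) (hs : IsInitial (ldt p α s₀) n X s) :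
    ∃ s' τ L, Exec (ldt q β t₀) (wordSize κ n) (mainProg G p q) s s' τ L ∧
      τ ≤ (mainProg G p q).size (ldt q β t₀).arity * totalTime G n ∧
      L.length ≤ codeCount G.h n ∧ (∀ l ∈ L, l = G.querySize n) ∧
      s'.reg 0 = truth ((ldt p α s₀).yes X) := by
  obtain ⟨h0, hreg, hcont, hmem⟩ := hs
  obtain rfl : X = fun j : Fin (ldt p α s₀).arity => s.contents (0 + (j : ℕ)) n := by
    funext j; rw [← hcont j, zero_add]
  have hX' := (isInstance_ldt_iff (f := fun a => s.contents a n) ..).1 hX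
  have hA3 : ∀ k : Fin 3, ∀ i < n, |s.mem (arrayOf p 0 k) (i : ℕ)| ≤ (n : ℤ) ^ 3 := by
    intro k i hi
    have := (hX' k).2 (Finset.mem_image_of_mem _ (Finset.mem_range.2 hi))
    exact abs_le.2 (Finset.mem_Icc.1 this)
  have hinj : ∀ k : Fin 3, ∀ i < n, ∀ i' < n,
      s.mem (arrayOf p 0 k) (i : ℕ) = s.mem (arrayOf p 0 k) (i' : ℕ) → i = i' := by
    intro k i hi i' hi' hii
    have := (hX' k).1
    -- As many values as cells: the list has no repetitions.
    have hcard : (State.contents s (arrayOf p 0 k) n).card = (Finset.range n).card := by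
      rw [Finset.card_range]; exact this
    exact Finset.injOn_of_card_image_eq hcard (by simpa using hi) (by simpa using hi') hii
  have hbound : s.Bounded (radix n ^ G.degree) := by
    have h3 : (n : ℤ) ^ 3 ≤ radix n ^ G.degree := by
      have h1 := two_mul_cube_le G n
      have h2 : (0 : ℤ) ≤ (n : ℤ) ^ 3 := by positivity
      linarith
    have hn : (n : ℤ) ≤ radix n ^ G.degree := by
      have h1 := size_le_querySize G n
      have h2 : (n : ℤ) ≤ G.querySize n := by exact_mod_cast (Nat.le_succ n).trans h1
      exact h2.trans (querySize_le_degree G n)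
    have hY := one_le_radix_pow n G.degree
    refine ⟨fun x => ?_, fun a i => ?_⟩
    · rcases eq_or_ne x 0 with rfl | hx
      · rw [h0, abs_of_nonneg (by positivity)]; exact hn
      · rw [hreg x hx, abs_zero]; linarith
    · by_cases hai : (ldt p α s₀).arity ≤ a ∨ i < 0 ∨ (n : ℤ) ≤ i
      · rw [hmem a i hai, abs_zero]; linarith
      · push Not at hai
        obtain ⟨ha, hi0, hin⟩ := hai
        obtain ⟨i, rfl⟩ := Int.eq_ofNat_of_zero_le hi0
        have := (hX ⟨a, ha⟩).2 (Finset.mem_image_of_mem (fun i : ℕ => s.mem (0 + a) i)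
          (Finset.mem_range.2 (by exact_mod_cast hin)))
        rw [zero_add] at this
        exact (abs_le.2 (Finset.mem_Icc.1 this)).trans h3
  obtain ⟨s', τ, L, h1, h2, h3, h4, -, h6⟩ := ter_main (G := G) (κ := κ) (p := p)
    (A := fun k i => s.mem (arrayOf p 0 k) i) q h0 (fun _ _ _ => rfl) hA3 hinj hbound hκ
  refine ⟨s', τ, L, h1, h2, h3, h4, ?_⟩
  rw [h6, propext (yes_iff_exists_isHit p α s₀ G.h hA3)]

/-! ### Asymptotics of the running time and of the oracle calls -/

theorem tendsto_sqrtLog : Tendsto sqrtLog atTop atTop := by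
  refine tendsto_atTop.2 fun K => ?_
  filter_upwards [eventually_ge_atTop (2 ^ K ^ 2)] with n hn
  by_contra! h
  have h1 := lt_two_pow_sqrtLog_sq n
  have h2 : 2 ^ sqrtLog n ^ 2 ≤ 2 ^ K ^ 2 :=
    Nat.pow_le_pow_right (by norm_num) (Nat.pow_le_pow_left h.le 2)
  omega

/-- The block size is subpolynomial in `n`. -/
theorem eventually_blockSize_pow_le (C : ℝ) (e : ℕ) {η : ℝ} (hη : 0 < η) :
    ∀ᶠ n : ℕ in atTop, C * ((2 : ℝ) ^ sqrtLog n) ^ e ≤ (n : ℝ) ^ η := by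
  obtain ⟨c, hc⟩ := pow_unbounded_of_one_lt C (one_lt_two (α := ℝ))
  filter_upwards [eventually_ge_atTop 1,
    tendsto_sqrtLog.eventually_ge_atTop (⌈(e + c : ℝ) / η⌉₊ + 2)] with n hn hk
  have hk' : (e + c : ℝ) / η + 2 ≤ sqrtLog n := by
    have h1 := Nat.le_ceil ((e + c : ℝ) / η)
    have h2 : ((⌈(e + c : ℝ) / η⌉₊ + 2 : ℕ) : ℝ) ≤ sqrtLog n := by exact_mod_cast hk
    push_cast at h2
    linarith
  set k := sqrtLog n with hkdef
  have hk2 : (2 : ℝ) ≤ k := by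
    have : (0 : ℝ) ≤ (e + c : ℝ) / η := by positivity
    linarith
  have hprod : (e + c : ℝ) ≤ η * (k - 2) := by
    have : (e + c : ℝ) / η ≤ k - 2 := by linarith
    rw [div_le_iff₀ hη] at this
    linarith
  have hexp : (c : ℝ) + k * e ≤ (k * (k - 2)) * η := by
    have hc0 : (0 : ℝ) ≤ c := by positivity
    have : (k : ℝ) * (e + c) ≤ k * (η * (k - 2)) := by gcongr
    nlinarith
  -- With `k = j + 1` one has `2 * n ≥ n + 1 ≥ 2 ^ j ^ 2`, and `j² - 1 = k * (k - 2)`.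
  have hlow : (2 : ℝ) ^ ((k : ℝ) * (k - 2)) ≤ n := by
    have h1 := two_pow_sq_le n
    obtain ⟨j, hj⟩ := Nat.exists_eq_add_of_le' (one_le_sqrtLog n)
    rw [hj, Nat.add_sub_cancel] at h1
    have h2 : (2 : ℝ) ^ j ^ 2 ≤ n + 1 := by exact_mod_cast h1
    have hkj : (k : ℝ) = j + 1 := by rw [hkdef, hj]; push_cast; rfl
    have h3 : (2 : ℝ) ^ ((k : ℝ) * (k - 2)) = 2 ^ j ^ 2 / 2 := by
      rw [hkj, show ((j : ℝ) + 1) * (j + 1 - 2) = ((j ^ 2 : ℕ) : ℝ) - 1 by push_cast; ring,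
        Real.rpow_sub_one (by norm_num), Real.rpow_natCast]
    have hn1 : (1 : ℝ) ≤ n := by exact_mod_cast hn
    rw [h3]; linarith
  calc C * ((2 : ℝ) ^ k) ^ e ≤ 2 ^ c * ((2 : ℝ) ^ k) ^ e := by gcongr
    _ = (2 : ℝ) ^ ((c : ℝ) + k * e) := by
        rw [← pow_mul, ← pow_add, ← Real.rpow_natCast]; push_cast; rfl
    _ ≤ (2 : ℝ) ^ ((k * (k - 2)) * η) := Real.rpow_le_rpow_of_exponent_le (by norm_num) hexp
    _ = ((2 : ℝ) ^ ((k : ℝ) * (k - 2))) ^ η := Real.rpow_mul (by norm_num) _ _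
    _ ≤ (n : ℝ) ^ η := Real.rpow_le_rpow (by positivity) hlow hη.le

theorem codeCount_eq (h n : ℕ) :
    (codeCount h n : ℝ) = ((2 : ℝ) ^ sqrtLog n) ^ ((4 * h + 6) * 11) := by
  simp only [codeCount]
  push_cast
  rw [← pow_mul _ (4 * h + 6) 11]

theorem querySize_le_mul (G : Gadget α β s₀ t₀) {n : ℕ} (hn : 1 ≤ n) :
    (G.querySize n : ℝ) ≤ 8 * (G.μ : ℝ) ^ 2 * n := by
  have h1 : (G.querySize n : ℝ) ≤ 4 * (G.μ : ℝ) ^ 2 * (n + 1) := by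
    exact_mod_cast G.querySize_le n
  have h2 : (1 : ℝ) ≤ n := by exact_mod_cast hn
  have h3 : (0 : ℝ) ≤ (G.μ : ℝ) ^ 2 := by positivity
  nlinarith

/-- The number of codes and the length of a label are together absorbed by `n ^ (1 / 2)`, and the
rest is linear. The constant `160 = 2 * 2 * 8 * 5` collects crude estimates. -/
theorem eventually_totalTime_le (G : Gadget α β s₀ t₀) {δ : ℝ} (hδ : δ ≤ 1 / 2) :
    ∀ᶠ n : ℕ in atTop, (totalTime G n : ℝ) ≤ 160 * (G.μ : ℝ) ^ 2 * (n : ℝ) ^ (2 - δ) := by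
  filter_upwards [eventually_ge_atTop 1, eventually_blockSize_pow_le 1
    ((4 * G.h + 6) * 11 + 1) (η := 1 / 2) (by norm_num)] with n hn hgrow
  have hn1 : (1 : ℝ) ≤ n := by exact_mod_cast hn
  have hm := querySize_le_mul G hn
  have hm1 : (1 : ℝ) ≤ G.querySize n := by
    exact_mod_cast (Nat.le_add_left 1 n).trans (size_le_querySize G n)
  have hcc : (1 : ℝ) ≤ codeCount G.h n := by
    rw [codeCount_eq]
    exact one_le_pow₀ (one_le_pow₀ (by norm_num))
  have hk : (4 * sqrtLog n + 1 : ℝ) ≤ 5 * 2 ^ sqrtLog n := by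
    have h1 : (sqrtLog n : ℝ) ≤ 2 ^ sqrtLog n := by
      exact_mod_cast (Nat.lt_two_pow_self (n := sqrtLog n)).le
    have h2 : (1 : ℝ) ≤ 2 ^ sqrtLog n := one_le_pow₀ (by norm_num)
    linarith
  calc (totalTime G n : ℝ)
      = (codeCount G.h n + 1) * ((G.querySize n + 1) * (4 * sqrtLog n + 1)) := by
        simp only [totalTime, bodyTime]; push_cast; rfl
    _ ≤ (2 * codeCount G.h n) * ((2 * (8 * (G.μ : ℝ) ^ 2 * n)) * (5 * 2 ^ sqrtLog n)) := by
        gcongr <;> linarith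
    _ = 160 * (G.μ : ℝ) ^ 2 * (n * (1 * (2 ^ sqrtLog n) ^ ((4 * G.h + 6) * 11 + 1))) := by
        rw [codeCount_eq]; ring
    _ ≤ 160 * (G.μ : ℝ) ^ 2 * (n * (n : ℝ) ^ (1 / 2 : ℝ)) := by gcongr
    _ = 160 * (G.μ : ℝ) ^ 2 * (n : ℝ) ^ (3 / 2 : ℝ) := by
        rw [show (3 / 2 : ℝ) = 1 + 1 / 2 by norm_num, Real.rpow_add (by linarith), Real.rpow_one]
    _ ≤ 160 * (G.μ : ℝ) ^ 2 * (n : ℝ) ^ (2 - δ) := by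
        gcongr; linarith

/-- Passing to `min ε 1` keeps the exponent positive, so that the bound for the query size can be
inserted. Half of the gain then pays for the number of calls and the constants. -/
theorem eventually_queries_le (G : Gadget α β s₀ t₀) {ε : ℝ} (hε : 0 < ε) :
    ∀ᶠ n : ℕ in atTop, (codeCount G.h n : ℝ) * (G.querySize n : ℝ) ^ (2 - ε) ≤
      (n : ℝ) ^ (2 - min ε 1 / 2) := by
  have hε' : 0 < min ε 1 := by positivity
  filter_upwards [eventually_ge_atTop 1, eventually_blockSize_pow_le ((8 * (G.μ : ℝ) ^ 2) ^ 2)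
    ((4 * G.h + 6) * 11) (η := min ε 1 / 2) (by positivity)] with n hn hgrow
  have hn1 : (1 : ℝ) ≤ n := by exact_mod_cast hn
  have hm := querySize_le_mul G hn
  have hm1 : (1 : ℝ) ≤ G.querySize n := by
    exact_mod_cast (Nat.le_add_left 1 n).trans (size_le_querySize G n)
  have hμ : (1 : ℝ) ≤ 8 * (G.μ : ℝ) ^ 2 := by
    have : (3 : ℝ) ≤ G.μ := by exact_mod_cast G.three_le_μ
    nlinarith
  have hle1 : min ε 1 ≤ 1 := min_le_right _ _
  have hq : (G.querySize n : ℝ) ^ (2 - ε) ≤ (8 * (G.μ : ℝ) ^ 2) ^ 2 * (n : ℝ) ^ (2 - min ε 1) := by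
    calc (G.querySize n : ℝ) ^ (2 - ε) ≤ (G.querySize n : ℝ) ^ (2 - min ε 1) :=
          Real.rpow_le_rpow_of_exponent_le hm1 (by linarith [min_le_left ε 1])
      _ ≤ (8 * (G.μ : ℝ) ^ 2 * n) ^ (2 - min ε 1) :=
          Real.rpow_le_rpow (by positivity) hm (by linarith)
      _ = (8 * (G.μ : ℝ) ^ 2) ^ (2 - min ε 1) * (n : ℝ) ^ (2 - min ε 1) :=
          Real.mul_rpow (by positivity) (by positivity)
      _ ≤ (8 * (G.μ : ℝ) ^ 2) ^ (2 : ℝ) * (n : ℝ) ^ (2 - min ε 1) := by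
          gcongr; linarith
      _ = _ := by rw [Real.rpow_two]
  calc (codeCount G.h n : ℝ) * (G.querySize n : ℝ) ^ (2 - ε)
      ≤ codeCount G.h n * ((8 * (G.μ : ℝ) ^ 2) ^ 2 * (n : ℝ) ^ (2 - min ε 1)) := by gcongr
    _ = ((8 * (G.μ : ℝ) ^ 2) ^ 2 * ((2 : ℝ) ^ sqrtLog n) ^ ((4 * G.h + 6) * 11)) *
          (n : ℝ) ^ (2 - min ε 1) := by rw [codeCount_eq]; ring
    _ ≤ (n : ℝ) ^ (min ε 1 / 2) * (n : ℝ) ^ (2 - min ε 1) := by gcongr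
    _ = (n : ℝ) ^ (2 - min ε 1 / 2) := by
        rw [← Real.rpow_add (by linarith)]; congr 1; ring

theorem subquadraticReduction_of_gadget (G : Gadget α β s₀ t₀) (p q : Partity) :
    SubquadraticReduction (ldt p α s₀) (ldt q β t₀) := by
  -- The word length constant depends on the gadget and the program, not on `n`.
  obtain ⟨κ, hκ4, hκ⟩ : ∃ κ, 4 ≤ κ ∧ (mainProg G p q).deg G.degree + 2 ≤ κ :=
    ⟨(mainProg G p q).deg G.degree + 4, Nat.le_add_left .., Nat.add_le_add_left (by norm_num) _⟩
  have hexec := fun n X s => exists_exec G p q hκ (n := n) (X := X) (s := s)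
  clear hκ
  -- From here on only the specification of the program matters.
  generalize mainProg G p q = c at hexec
  obtain ⟨K, hK⟩ : ∃ K : ℕ, c.size (ldt q β t₀).arity = K := ⟨_, rfl⟩
  rw [hK] at hexec
  have hrun : ∀ {n s' τ L}, IsRun (ldt p α s₀) (ldt q β t₀) κ c n s' τ L →
      τ ≤ K * totalTime G n ∧ L.length ≤ codeCount G.h n ∧ ∀ l ∈ L, l = G.querySize n := by
    rintro n s' τ L ⟨X, s, hX, hs, he⟩
    obtain ⟨s'', τ', L', h1, h2, h3, h4, -⟩ := hexec n X s hX hs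
    -- By determinism, an arbitrary run is the verified one.
    obtain ⟨-, rfl, rfl⟩ := he.deterministic h1
    exact ⟨h2, h3, h4⟩
  refine ⟨c, κ, by omega, fun n X s hX hs => ?_, fun ε hε => ?_⟩
  · obtain ⟨s', τ, L, h1, -, -, -, h5⟩ := hexec n X s hX hs
    exact ⟨s', τ, L, h1, fun hy => h5.trans (truth_of hy), fun hy => h5.trans (truth_of_not hy)⟩
  · have hδ : min ε 1 / 2 ≤ 1 / 2 := by linarith [min_le_right ε 1]
    refine ⟨min ε 1 / 2, by positivity, ⟨K * (160 * (G.μ : ℝ) ^ 2), ?_⟩, ?_⟩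
    · filter_upwards [eventually_totalTime_le G hδ] with n hn s' τ L h
      calc (τ : ℝ) ≤ ((K * totalTime G n : ℕ) : ℝ) := Nat.cast_le.2 (hrun h).1
        _ = K * (totalTime G n : ℝ) := Nat.cast_mul ..
        _ ≤ K * (160 * (G.μ : ℝ) ^ 2 * (n : ℝ) ^ (2 - min ε 1 / 2)) := by gcongr
        _ = _ := by ring
    · filter_upwards [eventually_queries_le G hε] with n hn s' τ L h
      obtain ⟨-, hlen, hL⟩ := hrun h
      have hle : (L.map fun m : ℕ => (m : ℝ) ^ (2 - ε)).sum ≤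
          L.length • (G.querySize n : ℝ) ^ (2 - ε) := by
        have := List.sum_le_card_nsmul (L.map fun m : ℕ => (m : ℝ) ^ (2 - ε))
          ((G.querySize n : ℝ) ^ (2 - ε)) (by
            intro x hx
            obtain ⟨l, hl, rfl⟩ := List.mem_map.1 hx
            rw [hL l hl])
        rwa [List.length_map] at this
      refine hle.trans (le_trans ?_ hn)
      rw [nsmul_eq_mul]
      have : (L.length : ℝ) ≤ codeCount G.h n := by exact_mod_cast hlen
      gcongr

end WordRAM

theorem subquadraticReduction_ldt (p q : Partity) {α β : Fin 3 → ℤ} {s t : ℤ}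
    (hα : ¬ IsTrivialVariant α s) (hβ : ¬ IsTrivialVariant β t) :
    SubquadraticReduction (ldt p α s) (ldt q β t) := by
  unfold IsTrivialVariant at hα hβ
  push Not at hα hβ
  obtain ⟨G⟩ := Gadget.exists hα.1 hβ.1 (or_iff_not_imp_left.2 hβ.2)
  exact WordRAM.subquadraticReduction_of_gadget G p q

/-- All non-trivial variants (1- and 3-partite) of 3-LDT are subquadratic-equivalent. -/
theorem theorem1 (p q : Partity) (α β : Fin 3 → ℤ) (s t : ℤ)
    (hα : ¬ IsTrivialVariant α s) (hβ : ¬ IsTrivialVariant β t) :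
    SubquadraticEquivalent (ldt p α s) (ldt q β t) :=
  ⟨subquadraticReduction_ldt p q hα hβ, subquadraticReduction_ldt q p hβ hα⟩
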